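/- Let $n\ge 0$ and $d\ge 1$ be integers, $0<\alpha\le 1$ and $\delta>e^{-n/8000}$. Let $X_1,\dots,X_n$ be i.i.d. random vectors in $\mathbb R^d$ with mean $\mu$ that satisfy the weak moment condition $\mathbb E\,|\langle X_i-\mu,v\rangle|^{1+\alpha}\le 1$ for every unit vector $v$, and let $x^\dagger\in\mathbb R^d$ be a (deterministic) point with $\|x^\dagger-\mu\|\le 24\sqrt d$. Localization algorithm, with inputs $X_1,\dots,X_n$, $x^\dagger$ and $\delta$. Put $$\tau=\max\Big(100\,n^{\frac1{1+\alpha}}d^{-\frac{1-\alpha}{2(1+\alpha)}},\ 100\sqrt d\Big),\qquad k=\max\big(0,\lceil 4000\log(1/\delta)\rceil\big).$$ Keep those $X_i$ with $\|X_i-x^\dagger\|\le\tau$; let $m$ be their number. Cut the kept points, in their given order, into $k$ consecutive buckets of size $\lfloor m/k\rfloor$ (the fewer than $k$ points left over when $m \ge k$ are unused; the output is $0,\dots,0$ if $m<k$), and return the bucket means $Z_1,\dots,Z_k$. Semidefinite program. For $x\in\mathbb R^d$, $r\in\mathbb R$ and $Z=(Z_1,\dots,Z_k)$, $\mathrm{MT}(x,r,Z)$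 maximizes $\sum_{i=1}^k X_{b_i,b_i}$ over the real positive semidefinite matrices $X$ with rows and columns indexed by $1,b_1,\dots,b_k,v_1,\dots,v_d$ that satisfy $$X_{1,1}=1,\qquad X_{b_i,b_i}=X_{1,b_i},\qquad \sum_{j=1}^d X_{v_j,v_j}=1,\qquad \sum_{j=1}^d X_{b_i,v_j}(Z_i-x)_j\ \ge\ r\,X_{b_i,b_i}\quad(1\le i\le k).$$ Then there is a (deterministic) point $\tilde\mu\in\mathbb R^d$ with $$\|\tilde\mu-\mu\|\le 2\Big(\frac dn\Big)^{\frac{\alpha}{1+\alpha}}$$ (the right-hand side is read as $0$ if $n=0$) such that, with probability at least $1-\delta/2$, the following holds simultaneously for all $$r\ \ge\ 100\sqrt{\frac{750\,\max\big(n^{\frac{1-\alpha}{1+\alpha}}d^{\frac{2\alpha}{1+\alpha}},\,d\big)}{n}}+40\Big(80\Big(\frac kn\Big)^{\alpha}\Big)^{\frac1{1+\alpha}}$$ (fractions with denominator $n=0$ being read as $0$): the maximum in $\mathrm{MT}(\tilde\mu,r,Z)$ is attained, and it is at most $k/20$. -/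

import Mathlib

open MeasureTheory ProbabilityTheory

noncomputable section

/-- The weak `(1 + α)`-moment condition for a law `ν` on `ℝ^d` centred at `m`:
`𝔼 |⟨X - m, v⟩| ^ (1 + α) ≤ 1` for every unit vector `v`. The expectation is taken in `[0, ∞]`,
so that the bound includes its finiteness. -/
def WeakMoment {d : ℕ} (α : ℝ) (ν : Measure (EuclideanSpace ℝ (Fin d)))
    (m : EuclideanSpace ℝ (Fin d)) : Prop :=
  ∀ v : EuclideanSpace ℝ (Fin d), ‖v‖ = 1 →
    ∫⁻ x, ENNReal.ofReal (|inner ℝ (x - m) v| ^ (1 + α)) ∂ν ≤ 1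

/-- The pruning radius
`τ = max (100 n^{1/(1+α)} d^{-(1-α)/(2(1+α))}, 100 √d)`. -/
def pruneRadius (n d : ℕ) (α : ℝ) : ℝ :=
  max (100 * (n : ℝ) ^ (1 / (1 + α)) * (d : ℝ) ^ (-((1 - α) / (2 * (1 + α)))))
    (100 * Real.sqrt d)

open Classical in
/-- The indices of the data points that survive pruning, i.e. of those within distance `τ` of the
initial estimate `x₀`. -/
def survivors {n d : ℕ} (α : ℝ) (x₀ : EuclideanSpace ℝ (Fin d))
    (X : Fin n → EuclideanSpace ℝ (Fin d)) : Finset (Fin n) :=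
  Finset.univ.filter fun j => ‖X j - x₀‖ ≤ pruneRadius n d α

/-- The position (counted from `0`) of the index `j` in the increasing enumeration of `S`,
for `j ∈ S`. -/
def position {n : ℕ} (S : Finset (Fin n)) (j : Fin n) : ℕ :=
  (S.filter fun i => i < j).card

/-- The `i`-th bucket when the elements of `S`, in increasing order, are cut into `k` consecutive
buckets of equal size `⌊|S| / k⌋` (the fewer than `k` elements left over at the end are unused). -/
def bucket {n : ℕ} (S : Finset (Fin n)) (k : ℕ) (i : Fin k) : Finset (Fin n) :=
  S.filter fun j =>
    (i : ℕ) * (S.card / k) ≤ position S j ∧ position S j < ((i : ℕ) + 1) * (S.card / k)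

/-- The number `k = ⌈4000 log (1/δ)⌉` of buckets. -/
def numBuckets (δ : ℝ) : ℕ := ⌈4000 * Real.log (1 / δ)⌉₊

/-- The localization algorithm: prune the data around `x₀`, cut the remaining points into
`k = numBuckets δ` buckets of equal size, and return the `k` bucket means. (If fewer than `k`
points survive, the buckets are empty and the output vectors are `0`.) -/
def bucketMeans {n d : ℕ} (α : ℝ) (X : Fin n → EuclideanSpace ℝ (Fin d))
    (x₀ : EuclideanSpace ℝ (Fin d)) (δ : ℝ) :
    Fin (numBuckets δ) → EuclideanSpace ℝ (Fin d) := fun i =>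
  ((bucket (survivors α x₀ X) (numBuckets δ) i).card : ℝ)⁻¹ •
    ∑ j ∈ bucket (survivors α x₀ X) (numBuckets δ) i, X j

/-- Rows and columns of the semidefinite program: `1`, `b_1, …, b_k` and `v_1, …, v_d`. -/
inductive MTIndex (k d : ℕ) : Type
  | one : MTIndex k d
  | b : Fin k → MTIndex k d
  | v : Fin d → MTIndex k d

/-- The feasible solutions of the semidefinite program `MT(x, r, Z)`, the relaxation of the problem
of finding a unit vector `v` and a set of indices `i` (with indicators `b_i`) as large as possible
such that `⟨v, Z_i - x⟩ ≥ r` for each of them. -/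
structure MTFeasible {k d : ℕ} (x : EuclideanSpace ℝ (Fin d)) (r : ℝ)
    (Z : Fin k → EuclideanSpace ℝ (Fin d))
    (X : Matrix (MTIndex k d) (MTIndex k d) ℝ) : Prop where
  posSemidef : X.PosSemidef
  one_one : X .one .one = 1
  b_b : ∀ i, X (.b i) (.b i) = X .one (.b i)
  v_trace : ∑ j, X (.v j) (.v j) = 1
  separation : ∀ i, X (.b i) (.b i) * r ≤ ∑ j, X (.b i) (.v j) * (Z i - x) j

/-- The objective `∑ i, X_{b_i, b_i}` of the semidefinite program. -/
def mtObjective {k d : ℕ} (X : Matrix (MTIndex k d) (MTIndex k d) ℝ) : ℝ :=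
  ∑ i, X (.b i) (.b i)

/-- `m` is the optimal value of `MT(x, r, Z)`: the maximum of the objective over the feasible
solutions. -/
def IsMTValue {k d : ℕ} (x : EuclideanSpace ℝ (Fin d)) (r : ℝ)
    (Z : Fin k → EuclideanSpace ℝ (Fin d)) (m : ℝ) : Prop :=
  IsGreatest (mtObjective '' {X | MTFeasible x r Z X}) m

/-- The threshold
`100 √(750 max (n^{(1-α)/(1+α)} d^{2α/(1+α)}, d) / n) + 40 (80 (k/n)^α)^{1/(1+α)}`
for the radius `r`. -/
def mtRadius (n d k : ℕ) (α : ℝ) : ℝ :=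
  100 * Real.sqrt
      (750 * max ((n : ℝ) ^ ((1 - α) / (1 + α)) * (d : ℝ) ^ (2 * α / (1 + α))) (d : ℝ) / n) +
    40 * (80 * ((k : ℝ) / n) ^ α) ^ (1 / (1 + α))

end

set_option linter.unusedSectionVars false

noncomputable section

/-! ### Product measures over `Fin (k + 1)` and the bounded differences inequality -/

/-! The point `μ'` is the mean of the law `ν` conditioned on the ball K of points kept by the
pruning. Testing the weak moment in a Gaussian direction gives 𝔼‖X - μ‖^(1+α) ≤ (1.26 √d)^(1+α), so
Markov's inequality bounds ν(Kᶜ) by both 1/60 and d/n. Hölder's inequality over Kᶜ then controls the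
bias of `μ'` (`norm_integral_cond_sub_le`).

The set of survivors is random, but the event that it equals S is a box, on which the product
measure is a multiple of a product of conditioned laws (`measureReal_pi_survivors_le`). With S
fixed, the survivors are i.i.d. with a boundedly supported law of mean `μ'`, the buckets are fixed
disjoint blocks, and the bucket means are independent.

A feasible matrix is a Gram matrix. If e, b, v_j are the vectors behind 1, b_i, v_j, and w = ∑ (Z_i
- x)_j v_j, then ‖b‖² = ⟨e, b⟩ makes 2b - e a unit vector, whence ‖b‖² ≤ min(1, (⟨e, w⟩ + ‖w‖) / 2r)
(`MTFeasible.mtObjective_le`). The supremum `mtBound` of the sum of these terms dominates the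
program for every radius at least r, so one event serves all radii.

With z_i = Z_i - x, the terms ⟨e, w⟩ add up to at most ‖∑ z_i‖, and Gaussian rounding replaces ∑
‖w_i‖ by 1.26 sup_u ∑ |⟨u, z_i⟩| (`sum_norm_synth_le`). Symmetrization and contraction bound the
centred supremum by second moments (`integral_ballSup_sum_abs_inner_sub_le_sqrt`), while each mean
𝔼|⟨u, z_i⟩| is bounded by truncating the one-dimensional marginals (`integral_abs_average_le`). At
the stated threshold the expectation of `mtBound` is at most k/64 (`integral_mtBound_bucket_le`).

Thanks to the cap at 1, changing one bucket mean changes `mtBound` by at most 1, so McDiarmid's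
inequality makes the level k/20 exponentially unlikely. Markov's inequality covers δ close to 1. The
same two inequalities show that at least 3n/4 points survive. -/

theorem measurePreserving_finCons {k : ℕ} {G : Type*} [MeasurableSpace G]
    (μ : Fin (k + 1) → Measure G) [∀ i, SigmaFinite (μ i)] :
    MeasurePreserving (fun p : G × (Fin k → G) => (Fin.cons p.1 p.2 : Fin (k + 1) → G))
      ((μ 0).prod (Measure.pi fun i => μ i.succ)) (Measure.pi μ) := by
  have h := (measurePreserving_piFinSuccAbove μ 0).symm
  convert! h using 1
  funext p
  simp [MeasurableEquiv.piFinSuccAbove_symm_apply, Fin.insertNthEquiv]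

theorem measurableEmbedding_finCons {k : ℕ} {G : Type*} [MeasurableSpace G] :
    MeasurableEmbedding (fun p : G × (Fin k → G) => (Fin.cons p.1 p.2 : Fin (k + 1) → G)) := by
  have h := (MeasurableEquiv.piFinSuccAbove (fun _ : Fin (k + 1) => G) 0).symm.measurableEmbedding
  convert! h using 1
  funext p
  simp [MeasurableEquiv.piFinSuccAbove_symm_apply, Fin.insertNthEquiv]

theorem integrable_finCons {k : ℕ} {G : Type*} [MeasurableSpace G]
    {μ : Fin (k + 1) → Measure G} [∀ i, SigmaFinite (μ i)] {f : (Fin (k + 1) → G) → ℝ}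
    (hf : Integrable f (Measure.pi μ)) :
    Integrable (fun p : G × (Fin k → G) => f (Fin.cons p.1 p.2))
      ((μ 0).prod (Measure.pi fun i => μ i.succ)) :=
  (measurePreserving_finCons μ).integrable_comp_of_integrable hf

theorem integral_pi_finCons {k : ℕ} {G : Type*} [MeasurableSpace G]
    (μ : Fin (k + 1) → Measure G) [∀ i, SigmaFinite (μ i)] {f : (Fin (k + 1) → G) → ℝ}
    (hf : Integrable f (Measure.pi μ)) :
    ∫ z, f z ∂Measure.pi μ
      = ∫ x, ∫ y, f (Fin.cons x y) ∂(Measure.pi fun i => μ i.succ) ∂μ 0 := by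
  rw [← (measurePreserving_finCons μ).integral_comp measurableEmbedding_finCons,
    integral_prod _ (integrable_finCons hf)]

theorem integral_pi_finCons_swap {k : ℕ} {G : Type*} [MeasurableSpace G]
    (μ : Fin (k + 1) → Measure G) [∀ i, SigmaFinite (μ i)] {f : (Fin (k + 1) → G) → ℝ}
    (hf : Integrable f (Measure.pi μ)) :
    ∫ z, f z ∂Measure.pi μ
      = ∫ y, ∫ x, f (Fin.cons x y) ∂μ 0 ∂(Measure.pi fun i => μ i.succ) := by
  rw [← (measurePreserving_finCons μ).integral_comp measurableEmbedding_finCons,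
    integral_prod_symm _ (integrable_finCons hf)]

theorem integrable_of_measurable_of_bound {Ω : Type*} [MeasurableSpace Ω] {μ : Measure Ω}
    [IsFiniteMeasure μ] {f : Ω → ℝ} (hf : Measurable f) {C : ℝ} (hC : ∀ x, |f x| ≤ C) :
    Integrable f μ :=
  Integrable.of_bound hf.aestronglyMeasurable C (Filter.Eventually.of_forall hC)

/-- Hoeffding's lemma for a function of oscillation at most `1`. -/
theorem integral_exp_sub_integral_le {Ω : Type*} [MeasurableSpace Ω] {μ : Measure Ω}
    [IsProbabilityMeasure μ] {f : Ω → ℝ} (hf : Measurable f) (hosc : ∀ x y, f x ≤ f y + 1)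
    (t : ℝ) : ∫ x, Real.exp (t * (f x - ∫ y, f y ∂μ)) ∂μ ≤ Real.exp (t ^ 2 / 8) := by
  obtain ⟨x₀⟩ : Nonempty Ω := μ.nonempty_of_neZero
  have hbdd : BddBelow (Set.range f) := ⟨f x₀ - 1, by
    rintro _ ⟨y, rfl⟩
    linarith [hosc x₀ y]⟩
  -- Oscillation at most 1 confines f to an interval of length 1 above its infimum, where
  -- Hoeffding's lemma has variance proxy 1/4.
  have hmem : ∀ᵐ x ∂μ, f x ∈ Set.Icc (⨅ y, f y) ((⨅ y, f y) + 1) :=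
    Filter.Eventually.of_forall fun x => ⟨ciInf_le hbdd x, by
      have : Nonempty Ω := ⟨x₀⟩
      have : f x - 1 ≤ ⨅ y, f y := le_ciInf fun y => by linarith [hosc x y]
      linarith⟩
  have h := (hasSubgaussianMGF_of_mem_Icc hf.aemeasurable hmem).mgf_le t
  simp only [mgf] at h
  refine h.trans (le_of_eq ?_)
  congr 1
  simp
  ring

/-- The moment generating function of a function of independent variables with bounded
differences. -/
theorem integral_exp_le_of_bounded_differences {G : Type*} [MeasurableSpace G] :
    ∀ (k : ℕ) (μ : Fin k → Measure G) [∀ i, IsProbabilityMeasure (μ i)] (f : (Fin k → G) → ℝ),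
      Measurable f → (∃ C, ∀ x, |f x| ≤ C) →
      (∀ x i y, f (Function.update x i y) ≤ f x + 1) → ∀ t : ℝ,
      ∫ x, Real.exp (t * (f x - ∫ y, f y ∂Measure.pi μ)) ∂Measure.pi μ
        ≤ Real.exp (k * t ^ 2 / 8) := by
  intro k
  induction k with
  | zero =>
    intro μ _ f hf _ _ t
    have h : ∀ x : Fin 0 → G, f x = f finZeroElim := fun x => by
      congr 1; exact Subsingleton.elim _ _
    simp [h]
  | succ k ih =>
    intro μ _ f hf hC hd t
    obtain ⟨C, hC⟩ := hC
    have hcons : Measurable fun p : G × (Fin k → G) => f (Fin.cons p.1 p.2) :=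
      hf.comp measurableEmbedding_finCons.measurable
    set π := Measure.pi fun i : Fin k => μ i.succ with hπ
    set g : G → ℝ := fun x => ∫ y, f (Fin.cons x y) ∂π with hg
    have hgm : Measurable g := hcons.stronglyMeasurable.integral_prod_right.measurable
    have hsec : ∀ x, Measurable fun y : Fin k → G => f (Fin.cons x y) := fun x =>
      hcons.comp measurable_prodMk_left
    have hint : ∀ x, Integrable (fun y : Fin k → G => f (Fin.cons x y)) π := fun x =>
      integrable_of_measurable_of_bound (hsec x) fun y => hC _
    -- Averaging out the other coordinates preserves the bounded difference in the first one.
    have hgosc : ∀ x x', g x ≤ g x' + 1 := by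
      intro x x'
      have : g x ≤ ∫ y, (f (Fin.cons x' y) + 1) ∂π := by
        refine integral_mono (hint x) ((hint x').add (integrable_const 1)) fun y => ?_
        have := hd (Fin.cons x' y) 0 x
        rwa [Fin.update_cons_zero] at this
      rwa [integral_add (hint x') (integrable_const 1), integral_const, probReal_univ,
        one_smul] at this
    have hmean : ∫ z, f z ∂Measure.pi μ = ∫ x, g x ∂μ 0 :=
      integral_pi_finCons μ (integrable_of_measurable_of_bound hf hC)
    set m := ∫ z, f z ∂Measure.pi μ with hm
    have hexpint : Integrable (fun z => Real.exp (t * (f z - m))) (Measure.pi μ) := by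
      refine integrable_of_measurable_of_bound (C := Real.exp (|t| * (C + |m|))) (by fun_prop)
        fun z => ?_
      rw [Real.abs_exp]
      refine Real.exp_le_exp.2 ((le_abs_self _).trans ?_)
      rw [abs_mul]
      exact mul_le_mul_of_nonneg_left ((abs_sub _ _).trans (by gcongr; exact hC z)) (abs_nonneg t)
    rw [integral_pi_finCons μ hexpint]
    have hgb : ∀ x, |g x| ≤ C := fun x => by
      have := norm_integral_le_of_norm_le_const (μ := π) (f := fun y => f (Fin.cons x y)) (C := C)
        (Filter.Eventually.of_forall fun y => hC _)
      simpa using this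
    have hexpg : Integrable (fun x => Real.exp (t * (g x - m))) (μ 0) := by
      refine integrable_of_measurable_of_bound (C := Real.exp (|t| * (C + |m|))) (by fun_prop)
        fun z => ?_
      rw [Real.abs_exp]
      refine Real.exp_le_exp.2 ((le_abs_self _).trans ?_)
      rw [abs_mul]
      exact mul_le_mul_of_nonneg_left ((abs_sub _ _).trans (by gcongr; exact hgb z)) (abs_nonneg t)
    -- Given the first coordinate x, the deviation splits into that of the section from its mean g x
    -- (induction) and that of g x from m (Hoeffding).
    calc ∫ x, ∫ y, Real.exp (t * (f (Fin.cons x y) - m)) ∂π ∂μ 0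
        ≤ ∫ x, Real.exp (t * (g x - m)) * Real.exp (k * t ^ 2 / 8) ∂μ 0 := by
          refine integral_mono (integrable_finCons hexpint).integral_prod_left
            (hexpg.mul_const _) fun x => ?_
          have hx := ih (fun i => μ i.succ) (fun y => f (Fin.cons x y)) (hsec x) ⟨C, fun y => hC _⟩
            (fun y i y' => by
              have := hd (Fin.cons x y) i.succ y'
              rwa [← Fin.cons_update] at this) t
          have hsplit : ∀ y : Fin k → G, Real.exp (t * (f (Fin.cons x y) - m))
              = Real.exp (t * (g x - m)) * Real.exp (t * (f (Fin.cons x y) - g x)) := fun y => by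
            rw [← Real.exp_add]; congr 1; ring
          simp only [hsplit]
          rw [integral_const_mul]
          exact mul_le_mul_of_nonneg_left hx (Real.exp_pos _).le
      _ ≤ Real.exp (t ^ 2 / 8) * Real.exp (k * t ^ 2 / 8) := by
          rw [integral_mul_const]
          refine mul_le_mul_of_nonneg_right ?_ (Real.exp_pos _).le
          have := integral_exp_sub_integral_le (μ := μ 0) hgm hgosc t
          rwa [← hmean] at this
      _ = Real.exp ((k + 1 : ℕ) * t ^ 2 / 8) := by
          rw [← Real.exp_add]; congr 1; push_cast; ring

/-- **McDiarmid's inequality**. -/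
theorem measureReal_ge_le_of_bounded_differences {G : Type*} [MeasurableSpace G] {k : ℕ}
    (μ : Fin k → Measure G) [∀ i, IsProbabilityMeasure (μ i)]
    {f : (Fin k → G) → ℝ} (hf : Measurable f) {C : ℝ} (hC : ∀ x, |f x| ≤ C)
    (hd : ∀ x i y, f (Function.update x i y) ≤ f x + 1) {ε a : ℝ} (hε : 0 ≤ ε)
    (ha : ∫ y, f y ∂Measure.pi μ + k * ε ≤ a) :
    (Measure.pi μ).real {x | a ≤ f x} ≤ Real.exp (-(2 * ε ^ 2 * k)) := by
  set m := ∫ y, f y ∂Measure.pi μ with hm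
  have hint : Integrable (fun z => Real.exp (4 * ε * (f z - m))) (Measure.pi μ) := by
    refine integrable_of_measurable_of_bound (C := Real.exp (|4 * ε| * (C + |m|))) (by fun_prop)
      fun z => ?_
    rw [Real.abs_exp]
    refine Real.exp_le_exp.2 ((le_abs_self _).trans ?_)
    rw [abs_mul]
    exact mul_le_mul_of_nonneg_left ((abs_sub _ _).trans (by gcongr; exact hC z)) (abs_nonneg _)
  -- The choice t = 4ε minimizes the Chernoff exponent -t k ε + k t² / 8.
  have h1 := measure_ge_le_exp_mul_mgf (μ := Measure.pi μ) (X := fun z => f z - m) (k * ε)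
    (t := 4 * ε) (by positivity) hint
  have h2 := integral_exp_le_of_bounded_differences k μ f hf ⟨C, hC⟩ hd (4 * ε)
  calc (Measure.pi μ).real {x | a ≤ f x}
      ≤ (Measure.pi μ).real {x | k * ε ≤ f x - m} :=
        measureReal_mono fun x (hx : a ≤ f x) => by
          show k * ε ≤ f x - m
          linarith
    _ ≤ Real.exp (-(4 * ε) * (k * ε)) * Real.exp (k * (4 * ε) ^ 2 / 8) :=
        h1.trans (mul_le_mul_of_nonneg_left h2 (Real.exp_pos _).le)
    _ = Real.exp (-(2 * ε ^ 2 * k)) := by rw [← Real.exp_add]; congr 1; ring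

/-! ### Suprema over the closed unit ball -/

/-- The supremum of a function over the closed unit ball. -/
def ballSup {E : Type*} [NormedAddCommGroup E] (f : E → ℝ) : ℝ :=
  ⨆ v : Metric.closedBall (0 : E) 1, f v

/-- Boundedness on the closed unit ball. -/
def BallBounded {E : Type*} [NormedAddCommGroup E] (f : E → ℝ) : Prop :=
  ∃ C, ∀ v, ‖v‖ ≤ 1 → |f v| ≤ C

section BallSup

variable {E : Type*} [NormedAddCommGroup E]

theorem ballSup_le {f : E → ℝ} {C : ℝ} (h : ∀ v, ‖v‖ ≤ 1 → f v ≤ C) : ballSup f ≤ C := by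
  have : Nonempty (Metric.closedBall (0 : E) 1) := ⟨0, by simp⟩
  exact ciSup_le fun v => h v (mem_closedBall_zero_iff.1 v.2)

theorem BallBounded.le_ballSup {f : E → ℝ} (hf : BallBounded f) {v : E} (hv : ‖v‖ ≤ 1) :
    f v ≤ ballSup f := by
  obtain ⟨C, hC⟩ := hf
  refine le_ciSup (f := fun v : Metric.closedBall (0 : E) 1 => f v) ⟨C, ?_⟩ ⟨v, by simpa using hv⟩
  rintro _ ⟨w, rfl⟩
  exact (le_abs_self _).trans (hC w (mem_closedBall_zero_iff.1 w.2))

theorem abs_ballSup_le {f : E → ℝ} {C : ℝ} (h : ∀ v, ‖v‖ ≤ 1 → |f v| ≤ C) : |ballSup f| ≤ C := by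
  have h0 : ‖(0 : E)‖ ≤ 1 := by simp
  refine abs_le.2 ⟨?_, ballSup_le fun v hv => (le_abs_self _).trans (h v hv)⟩
  exact (abs_le.1 (h 0 h0)).1.trans (BallBounded.le_ballSup ⟨C, h⟩ h0)

theorem BallBounded.add {f g : E → ℝ} (hf : BallBounded f) (hg : BallBounded g) :
    BallBounded fun v => f v + g v := by
  obtain ⟨C, hC⟩ := hf
  obtain ⟨D, hD⟩ := hg
  exact ⟨C + D, fun v hv => (abs_add_le _ _).trans (add_le_add (hC v hv) (hD v hv))⟩

theorem BallBounded.sub {f g : E → ℝ} (hf : BallBounded f) (hg : BallBounded g) :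
    BallBounded fun v => f v - g v := by
  obtain ⟨C, hC⟩ := hf
  obtain ⟨D, hD⟩ := hg
  exact ⟨C + D, fun v hv => (abs_sub _ _).trans (add_le_add (hC v hv) (hD v hv))⟩

theorem BallBounded.sum {ι : Type*} (s : Finset ι) {f : ι → E → ℝ}
    (hf : ∀ i, BallBounded (f i)) : BallBounded fun v => ∑ i ∈ s, f i v := by
  choose C hC using hf
  exact ⟨∑ i ∈ s, C i, fun v hv => (Finset.abs_sum_le_sum_abs _ _).trans
    (Finset.sum_le_sum fun i _ => hC i v hv)⟩

theorem BallBounded.const_mul {f : E → ℝ} (hf : BallBounded f) (a : ℝ) :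
    BallBounded fun v => a * f v := by
  obtain ⟨C, hC⟩ := hf
  exact ⟨|a| * C, fun v hv => by
    rw [abs_mul]
    exact mul_le_mul_of_nonneg_left (hC v hv) (abs_nonneg a)⟩

/-- A supremum of uniformly Lipschitz functions is Lipschitz. Measurability of the uncountable
suprema in the symmetrization argument rests on this. -/
theorem continuous_ballSup {Z : Type*} [PseudoMetricSpace Z] {h : Z → E → ℝ} {L : ℝ}
    (hb : ∀ z, BallBounded (h z)) (hL : ∀ z z' v, ‖v‖ ≤ 1 → h z v ≤ h z' v + L * dist z z') :
    Continuous fun z => ballSup (h z) := by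
  refine (LipschitzWith.of_le_add_mul L.toNNReal fun z z' => ballSup_le fun v hv => ?_).continuous
  have h1 := hL z z' v hv
  have h2 := (hb z').le_ballSup hv
  have h3 : L * dist z z' ≤ (L.toNNReal : ℝ) * dist z z' :=
    mul_le_mul_of_nonneg_right (Real.le_coe_toNNReal L) dist_nonneg
  linarith

end BallSup

/-! ### Symmetrization and contraction -/

section Symmetrization

variable {E : Type*} [NormedAddCommGroup E] [InnerProductSpace ℝ E]

theorem abs_inner_le_of_norm_le_one {v : E} (hv : ‖v‖ ≤ 1) (z : E) : |inner ℝ v z| ≤ ‖z‖ :=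
  (abs_real_inner_le_norm v z).trans (mul_le_of_le_one_left (norm_nonneg z) hv)

theorem ballBounded_inner (z : E) : BallBounded fun v => inner ℝ v z :=
  ⟨‖z‖, fun _ hv => abs_inner_le_of_norm_le_one hv z⟩

theorem ballBounded_abs_inner (z : E) : BallBounded fun v => |inner ℝ v z| :=
  ⟨‖z‖, fun v hv => by rw [abs_abs]; exact abs_inner_le_of_norm_le_one hv z⟩

/-- The contraction step: a pair of suprema with opposite signs dominates the swapped difference
of absolute values. -/
theorem ballSup_abs_sub_add_swap_le {A : E → ℝ} (hA : BallBounded A) (z z' : E) :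
    ballSup (fun v => A v + (|inner ℝ v z| - |inner ℝ v z'|))
      + ballSup (fun v => A v + (|inner ℝ v z'| - |inner ℝ v z|))
    ≤ (1 / 2) * ((ballSup (fun v => A v + 2 * inner ℝ v z)
          + ballSup (fun v => A v + 2 * inner ℝ v (-z)))
        + (ballSup (fun v => A v + 2 * inner ℝ v z')
          + ballSup (fun v => A v + 2 * inner ℝ v (-z')))) := by
  set P := fun u : E => ballSup (fun v => A v + 2 * inner ℝ v u) with hP
  have hle : ∀ u v, ‖v‖ ≤ 1 → A v + 2 * inner ℝ v u ≤ P u := fun u v hv =>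
    (hA.add ((ballBounded_inner u).const_mul 2)).le_ballSup hv
  have hneg : ∀ u v, ‖v‖ ≤ 1 → A v - 2 * inner ℝ v u ≤ P (-u) := fun u v hv => by
    have := hle (-u) v hv
    rw [inner_neg_right] at this
    linarith
  -- Write |⟨v, u⟩| with the sign that attains it and bound -|⟨w, u⟩| using the opposite sign of u.
  -- One point is then charged to P u and the other to P (-u).
  have key : ∀ u v w, ‖v‖ ≤ 1 → ‖w‖ ≤ 1 →
      A v + A w + 2 * (|inner ℝ v u| - |inner ℝ w u|) ≤ P u + P (-u) := by
    intro u v w hv hw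
    have h1 := hle u v hv
    have h2 := hneg u w hw
    have h3 := hle u w hw
    have h4 := hneg u v hv
    rcases abs_cases (inner ℝ v u) with ⟨h, _⟩ | ⟨h, _⟩ <;>
    rcases abs_cases (inner ℝ w u) with ⟨h', _⟩ | ⟨h', _⟩ <;> rw [h, h'] <;> linarith
  have main : ∀ v w, ‖v‖ ≤ 1 → ‖w‖ ≤ 1 →
      (A v + (|inner ℝ v z| - |inner ℝ v z'|)) + (A w + (|inner ℝ w z'| - |inner ℝ w z|))
        ≤ (1 / 2) * ((P z + P (-z)) + (P z' + P (-z'))) := by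
    intro v w hv hw
    have h1 := key z v w hv hw
    have h2 := key z' w v hw hv
    linarith
  rw [← le_sub_iff_add_le]
  refine ballSup_le fun v hv => ?_
  rw [le_sub_iff_add_le, ← le_sub_iff_add_le']
  refine ballSup_le fun w hw => ?_
  rw [le_sub_iff_add_le']
  exact main v w hv hw

theorem continuous_ballSup_inner {A : E → ℝ} (hA : BallBounded A) (a : ℝ) :
    Continuous fun z : E => ballSup fun v => A v + a * inner ℝ v z := by
  refine continuous_ballSup (L := |a|) (fun z => hA.add ((ballBounded_inner z).const_mul a))
    fun z z' v hv => ?_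
  have h : a * inner ℝ v z - a * inner ℝ v z' ≤ |a| * dist z z' := by
    rw [← mul_sub, ← inner_sub_right, dist_eq_norm]
    refine (le_abs_self _).trans ?_
    rw [abs_mul]
    exact mul_le_mul_of_nonneg_left (abs_inner_le_of_norm_le_one hv _) (abs_nonneg a)
  linarith

theorem abs_inner_sub_le_dist {v : E} (hv : ‖v‖ ≤ 1) (z z' : E) :
    |inner ℝ v z| ≤ |inner ℝ v z'| + dist z z' := by
  have h := abs_sub_abs_le_abs_sub (inner ℝ v z) (inner ℝ v z')
  rw [← inner_sub_right] at h
  have := abs_inner_le_of_norm_le_one hv (z - z')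
  rw [dist_eq_norm]
  linarith

theorem ballBounded_integral_abs_inner [MeasurableSpace E] {ν : Measure E} (hν : Integrable (fun z : E => z) ν) :
    BallBounded fun v => ∫ z, |inner ℝ v z| ∂ν := by
  refine ⟨∫ z, ‖z‖ ∂ν, fun v hv => ?_⟩
  rw [abs_of_nonneg (integral_nonneg fun z => abs_nonneg _)]
  exact integral_mono (hν.const_inner v).abs hν.norm fun z => abs_inner_le_of_norm_le_one hv z

variable [FiniteDimensional ℝ E] [MeasurableSpace E] [BorelSpace E]

/-- One coordinate of the symmetrization inequality. -/
theorem integral_ballSup_abs_inner_sub_le {ν : Measure E} [IsProbabilityMeasure ν]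
    (hν : Integrable (fun z : E => z) ν) {A : E → ℝ} (hA : BallBounded A) :
    ∫ z, ballSup (fun v => A v + (|inner ℝ v z| - ∫ z', |inner ℝ v z'| ∂ν)) ∂ν
      ≤ (1 / 2) * (∫ z, ballSup (fun v => A v + 2 * inner ℝ v z) ∂ν
          + ∫ z, ballSup (fun v => A v + 2 * inner ℝ v (-z)) ∂ν) := by
  obtain ⟨C, hC⟩ := id hA
  set m := fun v : E => ∫ z', |inner ℝ v z'| ∂ν with hm
  have hmb : BallBounded m := ballBounded_integral_abs_inner hν
  obtain ⟨D, hD⟩ := id hmb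
  set G := fun z z' : E => ballSup fun v => A v + (|inner ℝ v z| - |inner ℝ v z'|) with hG
  have hGb : ∀ z z', BallBounded fun v => A v + (|inner ℝ v z| - |inner ℝ v z'|) := fun z z' =>
    hA.add ((ballBounded_abs_inner z).sub (ballBounded_abs_inner z'))
  have hGc : Continuous fun p : E × E => G p.1 p.2 := by
    refine continuous_ballSup (L := 2) (fun p => hGb p.1 p.2) fun p q v hv => ?_
    have h1 := abs_inner_sub_le_dist hv p.1 q.1
    have h2 := abs_inner_sub_le_dist hv q.2 p.2
    rw [dist_comm] at h2
    have h3 : dist p.1 q.1 ≤ dist p q := le_max_left _ _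
    have h4 : dist p.2 q.2 ≤ dist p q := le_max_right _ _
    linarith
  have hGi : Integrable (fun p : E × E => G p.1 p.2) (ν.prod ν) := by
    refine Integrable.mono' (((integrable_const C).add (hν.norm.comp_fst ν)).add
      (hν.norm.comp_snd ν)) hGc.measurable.aestronglyMeasurable
      (Filter.Eventually.of_forall fun p => abs_ballSup_le fun v hv => ?_)
    have h1 := hC v hv
    have h2 := abs_inner_le_of_norm_le_one hv p.1
    have h3 := abs_inner_le_of_norm_le_one hv p.2
    have h4 := abs_add_le (A v) (|inner ℝ v p.1| - |inner ℝ v p.2|)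
    have h5 := abs_sub (|inner ℝ v p.1|) (|inner ℝ v p.2|)
    rw [abs_abs, abs_abs] at h5
    simp only [Pi.add_apply]
    linarith
  have hPi : ∀ a : ℝ, Integrable (fun z => ballSup fun v => A v + a * inner ℝ v z) ν := by
    intro a
    refine Integrable.mono' ((integrable_const C).add (hν.norm.const_mul |a|))
      (continuous_ballSup_inner hA a).measurable.aestronglyMeasurable
      (Filter.Eventually.of_forall fun z => abs_ballSup_le fun v hv => ?_)
    have h1 := hC v hv
    have h2 := mul_le_mul_of_nonneg_left (abs_inner_le_of_norm_le_one hv z) (abs_nonneg a)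
    have h4 := abs_add_le (A v) (a * inner ℝ v z)
    rw [abs_mul] at h4
    simp only [Pi.add_apply]
    linarith
  have hPn : Integrable (fun z => ballSup fun v => A v + 2 * inner ℝ v (-z)) ν := by
    have := hPi (-2)
    refine this.congr (Filter.Eventually.of_forall fun z => ?_)
    simp
  have hKi : Integrable (fun z => ballSup (fun v => A v + 2 * inner ℝ v z)
      + ballSup (fun v => A v + 2 * inner ℝ v (-z))) ν := (hPi 2).add hPn
  have hLc : Continuous fun z => ballSup fun v => A v + (|inner ℝ v z| - m v) := by
    refine continuous_ballSup (L := 1) (fun p => hA.add ((ballBounded_abs_inner p).sub hmb))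
      fun p q v hv => ?_
    have h1 := abs_inner_sub_le_dist hv p q
    linarith
  have hLi : Integrable (fun z => ballSup fun v => A v + (|inner ℝ v z| - m v)) ν := by
    refine Integrable.mono' ((integrable_const (C + D)).add hν.norm)
      hLc.measurable.aestronglyMeasurable
      (Filter.Eventually.of_forall fun p => abs_ballSup_le fun v hv => ?_)
    have h1 := hC v hv
    have h2 := abs_inner_le_of_norm_le_one hv p
    have h3 := hD v hv
    have h4 := abs_add_le (A v) (|inner ℝ v p| - m v)
    have h5 := abs_sub (|inner ℝ v p|) (m v)
    rw [abs_abs] at h5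
    simp only [Pi.add_apply]
    linarith
  -- Jensen's inequality: the mean is replaced by an independent copy z', and the supremum is moved
  -- inside its expectation.
  have step1 : ∫ z, ballSup (fun v => A v + (|inner ℝ v z| - m v)) ∂ν ≤ ∫ z, ∫ z', G z z' ∂ν ∂ν := by
    refine integral_mono_ae hLi hGi.integral_prod_left ?_
    filter_upwards [hGi.prod_right_ae] with z hz
    refine ballSup_le fun v hv => ?_
    have hvi : Integrable (fun z' => |inner ℝ v z'|) ν := (hν.const_inner v).abs
    have hvs : Integrable (fun z' => |inner ℝ v z| - |inner ℝ v z'|) ν :=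
      (integrable_const _).sub hvi
    have e : A v + (|inner ℝ v z| - m v)
        = ∫ z', (A v + (|inner ℝ v z| - |inner ℝ v z'|)) ∂ν := by
      rw [integral_add (integrable_const _) hvs, integral_sub (integrable_const _) hvi]
      simp [hm]
    rw [e]
    exact integral_mono ((integrable_const _).add hvs) hz
      fun z' => (hGb z z').le_ballSup hv
  have e1 : ∫ z, ∫ z', G z z' ∂ν ∂ν = ∫ p : E × E, G p.1 p.2 ∂ν.prod ν :=
    (integral_prod _ hGi).symm
  have hGs : Integrable (fun p : E × E => G p.2 p.1) (ν.prod ν) := hGi.swap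
  have e2 : ∫ p : E × E, G p.2 p.1 ∂ν.prod ν = ∫ p : E × E, G p.1 p.2 ∂ν.prod ν :=
    integral_prod_swap (fun p : E × E => G p.1 p.2)
  set K := fun z : E => ballSup (fun v => A v + 2 * inner ℝ v z)
      + ballSup (fun v => A v + 2 * inner ℝ v (-z)) with hK
  -- Since (z, z') is exchangeable, G may be averaged with its swap. The pointwise contraction
  -- inequality then applies, without introducing signs.
  have step2 : ∫ p : E × E, (G p.1 p.2 + G p.2 p.1) ∂ν.prod ν
      ≤ ∫ p : E × E, (1 / 2) * (K p.1 + K p.2) ∂ν.prod ν :=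
    integral_mono (hGi.add hGs) (((hKi.comp_fst ν).add (hKi.comp_snd ν)).const_mul _)
      fun p => ballSup_abs_sub_add_swap_le hA p.1 p.2
  rw [integral_add hGi hGs, e2, integral_const_mul,
    integral_add (hKi.comp_fst ν) (hKi.comp_snd ν), integral_fun_fst K, integral_fun_snd K] at step2
  simp only [probReal_univ, one_smul] at step2
  have e3 : ∫ z, K z ∂ν = ∫ z, ballSup (fun v => A v + 2 * inner ℝ v z) ∂ν
          + ∫ z, ballSup (fun v => A v + 2 * inner ℝ v (-z)) ∂ν := integral_add (hPi 2) hPn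
  linarith

end Symmetrization

section SymmetrizationPi

variable {E : Type*} [NormedAddCommGroup E] [MeasurableSpace E] [BorelSpace E]

theorem integrable_pi_eval {k : ℕ} {ν : Fin k → Measure E} [∀ i, IsProbabilityMeasure (ν i)]
    (h : ∀ i, Integrable (fun z : E => z) (ν i)) (i : Fin k) :
    Integrable (fun z : Fin k → E => z i) (Measure.pi ν) :=
  integrable_eval (h i)

/-- The law of `ε z` for `z` of law `ν` and an independent random sign `ε`. -/
def symmLaw (ν : Measure E) : Measure E := (2⁻¹ : ENNReal) • (ν + ν.map fun z => -z)

instance isProbabilityMeasure_symmLaw (ν : Measure E) [IsProbabilityMeasure ν] :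
    IsProbabilityMeasure (symmLaw ν) := by
  have : IsProbabilityMeasure (ν.map fun z => -z) :=
    Measure.isProbabilityMeasure_map measurable_neg.aemeasurable
  refine ⟨?_⟩
  simp only [symmLaw, Measure.smul_apply, Measure.add_apply, measure_univ, smul_eq_mul]
  rw [one_add_one_eq_two]
  exact ENNReal.inv_mul_cancel two_ne_zero ENNReal.ofNat_ne_top

theorem integrable_symmLaw {F : Type*} [NormedAddCommGroup F] {ν : Measure E} {f : E → F}
    (h1 : Integrable f ν) (h2 : Integrable (fun z => f (-z)) ν) : Integrable f (symmLaw ν) := by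
  refine Integrable.smul_measure (h1.add_measure ?_) (by simp)
  exact (MeasurableEquiv.neg E).measurableEmbedding.integrable_map_iff.2 h2

theorem integral_symmLaw {F : Type*} [NormedAddCommGroup F] [NormedSpace ℝ F] {ν : Measure E}
    {f : E → F} (h1 : Integrable f ν) (h2 : Integrable (fun z => f (-z)) ν) :
    ∫ z, f z ∂symmLaw ν = (1 / 2 : ℝ) • (∫ z, f z ∂ν + ∫ z, f (-z) ∂ν) := by
  have h3 : Integrable f (ν.map fun z => -z) :=
    (MeasurableEquiv.neg E).measurableEmbedding.integrable_map_iff.2 h2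
  have h4 : ∫ z, f z ∂(ν.map fun z => -z) = ∫ z, f (-z) ∂ν :=
    (MeasurableEquiv.neg E).measurableEmbedding.integral_map f
  rw [symmLaw, integral_smul_measure, integral_add_measure h1 h3, h4]
  simp

variable [InnerProductSpace ℝ E] [FiniteDimensional ℝ E]

/-- The symmetrization and contraction inequality for the process `v ↦ ∑ i, |⟪v, z i⟫|`. -/
theorem integral_ballSup_sum_abs_inner_le : ∀ (k : ℕ) (ν : Fin k → Measure E)
    [∀ i, IsProbabilityMeasure (ν i)], (∀ i, Integrable (fun z : E => z) (ν i)) →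
    ∀ A : E → ℝ, BallBounded A →
    ∫ z, ballSup (fun v => A v + ∑ i, (|inner ℝ v (z i)| - ∫ z', |inner ℝ v z'| ∂ν i)) ∂Measure.pi ν
      ≤ ∫ z, ballSup (fun v => A v + 2 * inner ℝ v (∑ i, z i)) ∂Measure.pi fun i => symmLaw (ν i) := by
  intro k
  induction k with
  | zero =>
    intro ν _ _ A _
    simp
  | succ k ih =>
    intro ν _ hν A hA
    obtain ⟨C, hC⟩ := id hA
    have hm : ∀ i, BallBounded fun v => ∫ z', |inner ℝ v z'| ∂ν i := fun i =>
      ballBounded_integral_abs_inner (hν i)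
    set m := fun (i : Fin (k + 1)) v => ∫ z', |inner ℝ v z'| ∂ν i with hm_def
    choose D hD using id hm
    have hs : ∀ i, Integrable (fun z : E => z) (symmLaw (ν i)) := fun i =>
      integrable_symmLaw (hν i) (hν i).neg
    set π := Measure.pi fun i : Fin k => ν i.succ with hπ
    set σ := Measure.pi fun i : Fin k => symmLaw (ν i.succ) with hσ
    have hLb : ∀ z : Fin (k + 1) → E,
        BallBounded fun v => A v + ∑ i, (|inner ℝ v (z i)| - m i v) := fun z =>
      hA.add (BallBounded.sum _ fun i => (ballBounded_abs_inner (z i)).sub (hm i))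
    have hL : Integrable (fun z : Fin (k + 1) → E =>
        ballSup fun v => A v + ∑ i, (|inner ℝ v (z i)| - m i v)) (Measure.pi ν) := by
      have hc : Continuous fun z : Fin (k + 1) → E =>
          ballSup fun v => A v + ∑ i, (|inner ℝ v (z i)| - m i v) := by
        refine continuous_ballSup (L := (k + 1 : ℕ)) hLb fun z z' v hv => ?_
        have : ∑ i, (|inner ℝ v (z i)| - m i v)
            ≤ ∑ i : Fin (k + 1), ((|inner ℝ v (z' i)| - m i v) + dist z z') :=
          Finset.sum_le_sum fun i _ => by
            have h1 := abs_inner_sub_le_dist hv (z i) (z' i)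
            have h2 := dist_le_pi_dist z z' i
            linarith
        rw [Finset.sum_add_distrib, Finset.sum_const, Finset.card_univ, Fintype.card_fin,
          nsmul_eq_mul] at this
        linarith
      refine Integrable.mono' (g := fun z => C + ∑ i, (‖z i‖ + D i))
        ((integrable_const C).add (integrable_finsetSum _ fun i _ =>
          (integrable_comp_eval (hν i).norm).add (integrable_const _)))
        hc.measurable.aestronglyMeasurable
        (Filter.Eventually.of_forall fun z => abs_ballSup_le fun v hv => ?_)
      refine (abs_add_le _ _).trans (add_le_add (hC v hv)
        ((Finset.abs_sum_le_sum_abs _ _).trans (Finset.sum_le_sum fun i _ => ?_)))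
      refine (abs_sub _ _).trans (add_le_add ?_ (hD i v hv))
      rw [abs_abs]
      exact abs_inner_le_of_norm_le_one hv _
    have hRbound : ∀ (a : E → ℝ) (c : ℝ) (u : E), (∀ v, ‖v‖ ≤ 1 → |a v| ≤ c) →
        |ballSup fun v => a v + 2 * inner ℝ v u| ≤ c + 2 * ‖u‖ := fun a c u ha =>
      abs_ballSup_le fun v hv => (abs_add_le _ _).trans (add_le_add (ha v hv) (by
        rw [abs_mul, abs_of_pos two_pos]
        exact mul_le_mul_of_nonneg_left (abs_inner_le_of_norm_le_one hv u) zero_le_two))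
    have hR : Integrable (fun z : Fin (k + 1) → E =>
        ballSup fun v => A v + 2 * inner ℝ v (∑ i, z i))
        (Measure.pi fun i => symmLaw (ν i)) := by
      have hc : Continuous fun z : Fin (k + 1) → E =>
          ballSup fun v => A v + 2 * inner ℝ v (∑ i, z i) :=
        (continuous_ballSup_inner hA 2).comp (by fun_prop)
      refine Integrable.mono' (g := fun z => C + 2 * ‖∑ i, z i‖)
        ((integrable_const C).add (Integrable.const_mul (Integrable.norm
          (integrable_finsetSum _ fun i _ => integrable_pi_eval hs i)) 2))
        hc.measurable.aestronglyMeasurable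
        (Filter.Eventually.of_forall fun z => hRbound A C _ hC)
    have hM : Integrable (fun p : E × (Fin k → E) =>
        ballSup fun v => (A v + (|inner ℝ v p.1| - m 0 v)) + 2 * inner ℝ v (∑ i, p.2 i))
        ((ν 0).prod σ) := by
      have hb : ∀ p : E × (Fin k → E), BallBounded fun v =>
          (A v + (|inner ℝ v p.1| - m 0 v)) + 2 * inner ℝ v (∑ i, p.2 i) := fun p =>
        (hA.add ((ballBounded_abs_inner p.1).sub (hm 0))).add
          ((ballBounded_inner _).const_mul 2)
      have hc : Continuous fun q : E × E =>
          ballSup fun v => (A v + (|inner ℝ v q.1| - m 0 v)) + 2 * inner ℝ v q.2 := by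
        refine continuous_ballSup (L := 3) (fun p =>
          (hA.add ((ballBounded_abs_inner p.1).sub (hm 0))).add
          ((ballBounded_inner _).const_mul 2)) fun p q v hv => ?_
        have h1 := abs_inner_sub_le_dist hv p.1 q.1
        have h2 : inner ℝ v p.2 - inner ℝ v q.2 ≤ dist p.2 q.2 := by
          rw [← inner_sub_right, dist_eq_norm]
          exact (le_abs_self _).trans (abs_inner_le_of_norm_le_one hv _)
        have h3 : dist p.1 q.1 ≤ dist p q := le_max_left _ _
        have h4 : dist p.2 q.2 ≤ dist p q := le_max_right _ _
        linarith
      have hc' : Continuous fun p : E × (Fin k → E) =>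
          ballSup fun v => (A v + (|inner ℝ v p.1| - m 0 v)) + 2 * inner ℝ v (∑ i, p.2 i) :=
        hc.comp (f := fun p : E × (Fin k → E) => (p.1, ∑ i, p.2 i)) (by fun_prop)
      have hsum : Integrable (fun y : Fin k → E => ∑ i, y i) σ :=
        integrable_finsetSum _ fun i _ => integrable_pi_eval (fun i => hs (Fin.succ i)) i
      refine Integrable.mono' (g := fun p => (C + (‖p.1‖ + D 0)) + 2 * ‖∑ i, p.2 i‖)
        (((integrable_const C).add (((hν 0).norm.comp_fst σ).add (integrable_const _))).add
          ((hsum.norm.comp_snd (ν 0)).const_mul 2))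
        hc'.measurable.aestronglyMeasurable
        (Filter.Eventually.of_forall fun p => hRbound _ _ _ fun v hv => ?_)
      refine (abs_add_le _ _).trans (add_le_add (hC v hv)
        ((abs_sub _ _).trans (add_le_add ?_ (hD 0 v hv))))
      rw [abs_abs]
      exact abs_inner_le_of_norm_le_one hv _
    rw [integral_pi_finCons ν hL]
    calc ∫ x, ∫ y : Fin k → E, ballSup (fun v => A v +
            ∑ i, (|inner ℝ v ((Fin.cons x y : Fin (k + 1) → E) i)| - m i v)) ∂π ∂ν 0
        ≤ ∫ x, ∫ y : Fin k → E, ballSup (fun v => (A v + (|inner ℝ v x| - m 0 v))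
            + 2 * inner ℝ v (∑ i, y i)) ∂σ ∂ν 0 := by
          refine integral_mono (integrable_finCons hL).integral_prod_left hM.integral_prod_left
            fun x => ?_
          -- The unsymmetrized first coordinate is absorbed into A while induction treats the
          -- others; this is why A is arbitrary.
          have := ih (fun i => ν i.succ) (fun i => hν i.succ)
            (fun v => A v + (|inner ℝ v x| - m 0 v))
            (hA.add ((ballBounded_abs_inner x).sub (hm 0)))
          refine le_trans (le_of_eq ?_) this
          simp only [Fin.sum_univ_succ, Fin.cons_zero, Fin.cons_succ, add_assoc, hm_def]
          rfl
      _ = ∫ y : Fin k → E, ∫ x, ballSup (fun v => (A v + (|inner ℝ v x| - m 0 v))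
            + 2 * inner ℝ v (∑ i, y i)) ∂ν 0 ∂σ := integral_integral_swap hM
      _ ≤ ∫ y : Fin k → E, ∫ x, ballSup (fun v => A v
            + 2 * inner ℝ v (∑ i, (Fin.cons x y : Fin (k + 1) → E) i)) ∂symmLaw (ν 0) ∂σ := by
          have hR' := (integrable_finCons hR).integral_prod_right
          refine integral_mono hM.integral_prod_right hR' fun y => ?_
          -- Now the symmetrized coordinates y are frozen inside B, and only the first coordinate
          -- remains to be symmetrized.
          set B := fun v : E => A v + 2 * inner ℝ v (∑ i, y i) with hB
          have hBb : BallBounded B := hA.add ((ballBounded_inner _).const_mul 2)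
          obtain ⟨c, hc⟩ := id hBb
          have hi : Integrable (fun z => ballSup fun v => B v + 2 * inner ℝ v z) (ν 0) :=
            Integrable.mono' (g := fun z => c + 2 * ‖z‖)
              ((integrable_const c).add ((hν 0).norm.const_mul 2))
              (continuous_ballSup_inner hBb 2).measurable.aestronglyMeasurable
              (Filter.Eventually.of_forall fun z => hRbound B c z hc)
          have hi' : Integrable (fun z => ballSup fun v => B v + 2 * inner ℝ v (-z)) (ν 0) :=
            Integrable.mono' (g := fun z => c + 2 * ‖z‖)
              ((integrable_const c).add ((hν 0).norm.const_mul 2))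
              ((continuous_ballSup_inner hBb 2).comp continuous_neg).measurable.aestronglyMeasurable
              (Filter.Eventually.of_forall fun z => by
                have := hRbound B c (-z) hc
                rwa [norm_neg] at this)
          have h := integral_ballSup_abs_inner_sub_le (hν 0) hBb
          rw [← smul_eq_mul, ← integral_symmLaw hi hi'] at h
          refine le_trans (le_of_eq ?_) (h.trans (le_of_eq ?_))
          · congr 1; funext x; congr 1; funext v; simp only [hB, hm_def]; ring
          · congr 1; funext x; congr 1; funext v
            simp only [hB, Fin.sum_univ_succ, Fin.cons_zero, Fin.cons_succ, inner_add_right]; ring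
      _ = _ := (integral_pi_finCons_swap (fun i => symmLaw (ν i)) hR).symm

end SymmetrizationPi

/-! ### Second moments of sums of independent random vectors -/

section Variance

variable {E : Type*} [NormedAddCommGroup E] [InnerProductSpace ℝ E] [FiniteDimensional ℝ E]
  [MeasurableSpace E] [BorelSpace E]

/-- The second moment of a sum of independent centred random vectors. -/
theorem integral_norm_sq_sum_of_iIndepFun {Ω ι : Type*} [MeasurableSpace Ω] {P : Measure Ω}
    [IsProbabilityMeasure P] {Y : ι → Ω → E} (hind : iIndepFun Y P) (s : Finset ι)
    (hL2 : ∀ i ∈ s, MemLp (Y i) 2 P) (h0 : ∀ i ∈ s, ∫ ω, Y i ω ∂P = 0) :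
    ∫ ω, ‖∑ i ∈ s, Y i ω‖ ^ 2 ∂P = ∑ i ∈ s, ∫ ω, ‖Y i ω‖ ^ 2 ∂P := by
  have hinn : ∀ i ∈ s, ∀ j ∈ s, Integrable (fun ω => (inner ℝ (Y i ω) (Y j ω) : ℝ)) P :=
    fun i hi j hj => Integrable.mono' ((hL2 i hi).norm.integrable_mul (hL2 j hj).norm)
      ((hL2 i hi).1.inner (hL2 j hj).1)
      (Filter.Eventually.of_forall fun ω => abs_real_inner_le_norm _ _)
  have hexp : ∀ ω, ‖∑ i ∈ s, Y i ω‖ ^ 2 = ∑ i ∈ s, ∑ j ∈ s, (inner ℝ (Y i ω) (Y j ω) : ℝ) := by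
    intro ω
    rw [← real_inner_self_eq_norm_sq, sum_inner]
    exact Finset.sum_congr rfl fun i _ => inner_sum _ _ _
  simp only [hexp]
  rw [integral_finsetSum _ fun i hi => integrable_finsetSum _ fun j hj => hinn i hi j hj]
  refine Finset.sum_congr rfl fun i hi => ?_
  rw [integral_finsetSum _ fun j hj => hinn i hi j hj, Finset.sum_eq_single_of_mem i hi]
  · simp only [real_inner_self_eq_norm_sq]
  · intro j hj hji
    have h := (hind.indepFun hji.symm).integral_bilin ((hL2 i hi).integrable one_le_two)
      ((hL2 j hj).integrable one_le_two) (innerSL ℝ)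
    change ∫ ω, innerSL ℝ (Y i ω) (Y j ω) ∂P = 0
    rw [h, h0 i hi]
    simp

theorem integral_le_sqrt_integral_sq {Ω : Type*} [MeasurableSpace Ω] {P : Measure Ω}
    [IsProbabilityMeasure P] {f : Ω → ℝ} (hf : MemLp f 2 P) :
    ∫ ω, f ω ∂P ≤ √(∫ ω, f ω ^ 2 ∂P) := by
  refine Real.le_sqrt_of_sq_le ?_
  have h := variance_nonneg f P
  rw [variance_eq_sub hf] at h
  simp only [Pi.pow_apply] at h
  linarith

theorem integral_norm_sum_le_sqrt {Ω ι : Type*} [MeasurableSpace Ω] {P : Measure Ω}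
    [IsProbabilityMeasure P] {Y : ι → Ω → E} (hind : iIndepFun Y P) (s : Finset ι)
    (hL2 : ∀ i ∈ s, MemLp (Y i) 2 P) (h0 : ∀ i ∈ s, ∫ ω, Y i ω ∂P = 0) :
    ∫ ω, ‖∑ i ∈ s, Y i ω‖ ∂P ≤ √(∑ i ∈ s, ∫ ω, ‖Y i ω‖ ^ 2 ∂P) := by
  rw [← integral_norm_sq_sum_of_iIndepFun hind s hL2 h0]
  exact integral_le_sqrt_integral_sq (memLp_finsetSum s hL2).norm

theorem memLp_comp_eval {k : ℕ} {ν : Fin k → Measure E} [∀ i, IsProbabilityMeasure (ν i)]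
    {i : Fin k} {q : ENNReal} (h : MemLp (fun z : E => z) q (ν i)) :
    MemLp (fun z : Fin k → E => z i) q (Measure.pi ν) :=
  h.comp_measurePreserving (measurePreserving_eval ν i)

theorem integral_norm_sum_pi_le_sqrt {k : ℕ} (ν : Fin k → Measure E)
    [∀ i, IsProbabilityMeasure (ν i)] (hν : ∀ i, MemLp (fun z : E => z) 2 (ν i))
    (h0 : ∀ i, ∫ z, z ∂ν i = 0) :
    ∫ z, ‖∑ i, z i‖ ∂Measure.pi ν ≤ √(∑ i, ∫ z, ‖z‖ ^ 2 ∂ν i) := by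
  have h := integral_norm_sum_le_sqrt (P := Measure.pi ν) (Y := fun i z => z i)
    (iIndepFun_pi (X := fun _ z => z) fun i => aemeasurable_id) Finset.univ
    (fun i _ => memLp_comp_eval (hν i)) (fun i _ => by rw [integral_eval, h0])
  refine h.trans (le_of_eq ?_)
  congr 1
  refine Finset.sum_congr rfl fun i _ => ?_
  exact integral_comp_eval (μ := ν) (i := i) (f := fun z : E => ‖z‖ ^ 2)
    (by fun_prop : Continuous fun z : E => ‖z‖ ^ 2).measurable.aestronglyMeasurable

theorem memLp_two_symmLaw {ν : Measure E} (h : MemLp (fun z : E => z) 2 ν) :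
    MemLp (fun z : E => z) 2 (symmLaw ν) := by
  have hi := h.integrable_norm_pow two_ne_zero
  exact (memLp_two_iff_integrable_sq_norm aestronglyMeasurable_id).2
    (integrable_symmLaw hi (by simpa using hi))

theorem integral_symmLaw_id {ν : Measure E} (h : Integrable (fun z : E => z) ν) :
    ∫ z, z ∂symmLaw ν = 0 := by
  rw [integral_symmLaw h h.neg, integral_neg, add_neg_cancel, smul_zero]

theorem integral_norm_sq_symmLaw {ν : Measure E} (h : MemLp (fun z : E => z) 2 ν) :
    ∫ z, ‖z‖ ^ 2 ∂symmLaw ν = ∫ z, ‖z‖ ^ 2 ∂ν := by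
  have hi := h.integrable_norm_pow two_ne_zero
  rw [integral_symmLaw hi (by simpa only [norm_neg] using hi)]
  simp only [norm_neg, smul_eq_mul]
  ring

/-- The expected supremum of the centred process `v ↦ ∑ i, |⟪v, z i⟫|` over the unit ball. -/
theorem integral_ballSup_sum_abs_inner_sub_le_sqrt {k : ℕ} (ν : Fin k → Measure E)
    [∀ i, IsProbabilityMeasure (ν i)] (hν : ∀ i, MemLp (fun z : E => z) 2 (ν i)) :
    ∫ z, ballSup (fun v => ∑ i, (|inner ℝ v (z i)| - ∫ z', |inner ℝ v z'| ∂ν i)) ∂Measure.pi ν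
      ≤ 2 * √(∑ i, ∫ z, ‖z‖ ^ 2 ∂ν i) := by
  have hi : ∀ i, Integrable (fun z : E => z) (ν i) := fun i => (hν i).integrable one_le_two
  have hA : BallBounded fun _ : E => (0 : ℝ) := ⟨0, fun v _ => by simp⟩
  have h1 := integral_ballSup_sum_abs_inner_le k ν hi (fun _ => 0) hA
  simp only [zero_add] at h1
  have hs : ∀ i, MemLp (fun z : E => z) 2 (symmLaw (ν i)) := fun i => memLp_two_symmLaw (hν i)
  have h2 := integral_norm_sum_pi_le_sqrt (fun i => symmLaw (ν i)) hs
    fun i => integral_symmLaw_id (hi i)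
  simp only [integral_norm_sq_symmLaw (hν _)] at h2
  have hsum : Integrable (fun z : Fin k → E => ‖∑ i, z i‖)
      (Measure.pi fun i => symmLaw (ν i)) :=
    (integrable_finsetSum _ fun i _ => integrable_pi_eval
      (fun i => (hs i).integrable one_le_two) i).norm
  have hb : ∀ u : E, |ballSup fun v => 2 * inner ℝ v u| ≤ 2 * ‖u‖ := fun u =>
    abs_ballSup_le fun v hv => by
      rw [abs_mul, abs_of_pos two_pos]
      exact mul_le_mul_of_nonneg_left (abs_inner_le_of_norm_le_one hv u) zero_le_two
  have hc : Continuous fun z : Fin k → E => ballSup fun v => 2 * inner ℝ v (∑ i, z i) := by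
    have := continuous_ballSup_inner hA 2
    simp only [zero_add] at this
    exact this.comp (by fun_prop : Continuous fun z : Fin k → E => ∑ i, z i)
  calc _ ≤ _ := h1
    _ ≤ ∫ z : Fin k → E, 2 * ‖∑ i, z i‖ ∂Measure.pi fun i => symmLaw (ν i) := by
        refine integral_mono ?_ (hsum.const_mul 2) fun z => (le_abs_self _).trans (hb _)
        exact Integrable.mono' (hsum.const_mul 2) hc.measurable.aestronglyMeasurable
          (Filter.Eventually.of_forall fun z => hb _)
    _ ≤ _ := by
        rw [integral_const_mul]
        exact mul_le_mul_of_nonneg_left h2 zero_le_two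

end Variance

/-! ### Gaussian rounding -/

section Gaussian

open Real in
theorem integral_abs_gaussianReal_zero_one : ∫ x, |x| ∂gaussianReal 0 1 = 2 / √(2 * π) := by
  rw [integral_gaussianReal_eq_integral_smul one_ne_zero]
  have h1 : ∀ x : ℝ, gaussianPDFReal 0 1 x • |x|
      = (√(2 * π))⁻¹ * ((fun y : ℝ => y * exp (-(1 / 2) * y ^ 2)) |x|) := by
    intro x
    simp only [gaussianPDFReal, smul_eq_mul, sub_zero, NNReal.coe_one, mul_one, sq_abs]
    rw [show -x ^ 2 / 2 = -(1 / 2) * x ^ 2 by ring]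
    ring
  simp only [h1]
  rw [integral_const_mul, integral_comp_abs (f := fun y : ℝ => y * exp (-(1 / 2) * y ^ 2))]
  have h2 := integral_rpow_mul_exp_neg_mul_rpow (p := 2) (q := 1) (b := 1 / 2) two_pos
    (by norm_num) (by norm_num)
  have h3 : ∫ x in Set.Ioi (0 : ℝ), x * exp (-(1 / 2) * x ^ 2) = 1 := by
    simp only [rpow_one, rpow_ofNat] at h2
    rw [h2]
    norm_num [rpow_neg_one]
  rw [h3]
  ring

/-- The mean of |g| is √(2/π), and √(π/2) ≤ 1.26. This is the source of the factor 1.26 throughout.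
-/
theorem one_le_integral_abs_gaussianReal : 1 ≤ 1.26 * ∫ x, |x| ∂gaussianReal 0 1 := by
  rw [integral_abs_gaussianReal_zero_one, ← mul_div_assoc, le_div_iff₀ (by positivity), one_mul]
  refine Real.sqrt_le_iff.2 ⟨by norm_num, ?_⟩
  nlinarith [Real.pi_lt_d2]

variable {E : Type*} [NormedAddCommGroup E] [InnerProductSpace ℝ E] [FiniteDimensional ℝ E]
  [MeasurableSpace E] [BorelSpace E]

theorem map_inner_stdGaussian (z : E) :
    (stdGaussian E).map (fun g => inner ℝ z g) = (gaussianReal 0 1).map fun x => ‖z‖ * x := by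
  have h := IsGaussian.map_eq_gaussianReal (μ := stdGaussian E) (innerSL ℝ z)
  rw [integral_strongDual_stdGaussian, variance_dual_stdGaussian, innerSL_apply_norm] at h
  rw [gaussianReal_map_const_mul]
  convert! h using 2
  · simp
  · ext
    simp

theorem memLp_inner_stdGaussian (z : E) : MemLp (fun g : E => (inner ℝ z g : ℝ)) 2 (stdGaussian E) :=
  (IsGaussian.memLp_two_id (μ := stdGaussian E)).const_inner z

theorem norm_le_integral_abs_inner_stdGaussian (z : E) :
    ‖z‖ ≤ 1.26 * ∫ g, |inner ℝ z g| ∂stdGaussian E := by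
  have h : ∫ g, |inner ℝ z g| ∂stdGaussian E = ‖z‖ * ∫ x, |x| ∂gaussianReal 0 1 := by
    have e := integral_map (μ := stdGaussian E) (φ := fun g => (inner ℝ z g : ℝ)) (by fun_prop)
      (f := fun x : ℝ => |x|) (by fun_prop)
    rw [← e, map_inner_stdGaussian, integral_map (by fun_prop) (by fun_prop),
      ← integral_const_mul]
    simp [abs_mul]
  rw [h]
  nlinarith [one_le_integral_abs_gaussianReal, norm_nonneg z]

theorem integral_inner_sq_stdGaussian (z : E) :
    ∫ g, (inner ℝ z g : ℝ) ^ 2 ∂stdGaussian E = ‖z‖ ^ 2 := by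
  have h := variance_dual_stdGaussian (innerSL ℝ z)
  rw [variance_of_integral_eq_zero (by fun_prop) (integral_strongDual_stdGaussian _),
    innerSL_apply_norm] at h
  exact h

theorem integral_norm_sq_stdGaussian_euclidean (d : ℕ) :
    ∫ g, ‖g‖ ^ 2 ∂stdGaussian (EuclideanSpace ℝ (Fin d)) = d := by
  have h : ∀ g : EuclideanSpace ℝ (Fin d),
      ‖g‖ ^ 2 = ∑ j, (inner ℝ (EuclideanSpace.basisFun (Fin d) ℝ j) g : ℝ) ^ 2 := fun g =>
    ((EuclideanSpace.basisFun (Fin d) ℝ).sum_sq_inner_right g).symm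
  simp only [h]
  rw [integral_finsetSum _ fun j _ => (memLp_inner_stdGaussian _).integrable_sq]
  simp only [integral_inner_sq_stdGaussian, OrthonormalBasis.norm_eq_one]
  simp

/-- The vector `∑ j, x j • v j`. -/
def synth {d : ℕ} (v : Fin d → E) (x : EuclideanSpace ℝ (Fin d)) : E := ∑ j, x j • v j

theorem synth_sum {d : ℕ} {ι : Type*} (v : Fin d → E) (s : Finset ι)
    (z : ι → EuclideanSpace ℝ (Fin d)) : synth v (∑ i ∈ s, z i) = ∑ i ∈ s, synth v (z i) := by
  simp only [synth, WithLp.ofLp_sum, Finset.sum_apply, Finset.sum_smul]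
  exact Finset.sum_comm

/-- Triangle inequality, then Cauchy–Schwarz between the coordinates of x and the lengths ‖v j‖. -/
theorem norm_synth_le {d : ℕ} {v : Fin d → E} (hv : ∑ j, ‖v j‖ ^ 2 = 1)
    (x : EuclideanSpace ℝ (Fin d)) : ‖synth v x‖ ≤ ‖x‖ := by
  refine (norm_sum_le _ _).trans ?_
  have h := Finset.sum_mul_sq_le_sq_mul_sq Finset.univ (fun j => ‖x j‖) (fun j => ‖v j‖)
  rw [hv, mul_one, ← EuclideanSpace.norm_sq_eq] at h
  simp only [norm_smul]
  exact abs_le_of_sq_le_sq' h (norm_nonneg x) |>.2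

theorem norm_inv_norm_smul {F : Type*} [NormedAddCommGroup F] [NormedSpace ℝ F] {a : F}
    (ha : a ≠ 0) : ‖‖a‖⁻¹ • a‖ = 1 := by
  rw [norm_smul, norm_inv, norm_norm, inv_mul_cancel₀ (norm_ne_zero_iff.2 ha)]

theorem sum_abs_inner_le_norm_mul_ballSup {F ι : Type*} [NormedAddCommGroup F]
    [InnerProductSpace ℝ F] [Fintype ι] (z : ι → F) (a : F) :
    ∑ i, |inner ℝ a (z i)| ≤ ‖a‖ * ballSup fun v => ∑ i, |inner ℝ v (z i)| := by
  rcases eq_or_ne a 0 with rfl | ha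
  · simp
  have h : BallBounded fun v => ∑ i, |inner ℝ v (z i)| :=
    BallBounded.sum _ fun i => ballBounded_abs_inner (z i)
  have h1 := h.le_ballSup (v := ‖a‖⁻¹ • a) ((norm_inv_norm_smul ha).le)
  have hpos : 0 < ‖a‖ := norm_pos_iff.2 ha
  refine le_trans (le_of_eq ?_) (mul_le_mul_of_nonneg_left h1 hpos.le)
  rw [Finset.mul_sum]
  refine Finset.sum_congr rfl fun i _ => ?_
  rw [real_inner_smul_left, abs_mul, abs_of_pos (inv_pos.2 hpos), mul_inv_cancel_left₀ hpos.ne']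

/-- A Grothendieck type inequality: the vector relaxation of `sup_v ∑ i, |⟪v, z i⟫|` exceeds it
by at most a constant factor. -/
theorem sum_norm_synth_le {d : ℕ} {ι : Type*} [Fintype ι] {v : Fin d → E}
    (hv : ∑ j, ‖v j‖ ^ 2 = 1) (z : ι → EuclideanSpace ℝ (Fin d)) :
    ∑ i, ‖synth v (z i)‖ ≤ 1.26 * ballSup fun u => ∑ i, |inner ℝ u (z i)| := by
  set γ := stdGaussian E
  set W := ballSup fun u => ∑ i, |inner ℝ u (z i)| with hW
  have hW0 : 0 ≤ W :=
    (Finset.sum_nonneg fun i _ => abs_nonneg _).trans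
      ((BallBounded.sum Finset.univ fun i => ballBounded_abs_inner (z i)).le_ballSup
        (v := 0) (by simp))
  -- The rounding direction: pairing `synth v x` with g is pairing x with a g, and the mean of ‖a
  -- g‖² is ∑ ‖v j‖² = 1. Thus a g has mean length at most 1, and homogeneity reduces it to a point
  -- of the unit ball.
  set a : E → EuclideanSpace ℝ (Fin d) := fun g => WithLp.toLp 2 fun j => inner ℝ (v j) g with ha
  have hinner : ∀ g x, (inner ℝ (synth v x) g : ℝ) = inner ℝ (a g) x := by
    intro g x
    simp [synth, sum_inner, real_inner_smul_left, ha, PiLp.inner_apply]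
  have hac : Continuous a := by
    refine (PiLp.continuous_toLp 2 _).comp (continuous_pi fun j => by fun_prop)
  have hasq : ∀ g, ‖a g‖ ^ 2 = ∑ j, (inner ℝ (v j) g : ℝ) ^ 2 := fun g => by
    rw [EuclideanSpace.norm_sq_eq]
    simp [ha]
  have ha2 : ∫ g, ‖a g‖ ^ 2 ∂γ = 1 := by
    simp only [hasq]
    rw [integral_finsetSum _ fun j _ => (memLp_inner_stdGaussian _).integrable_sq]
    simp only [integral_inner_sq_stdGaussian, hv]
  have haL : MemLp (fun g => ‖a g‖) 2 γ := by
    refine (memLp_two_iff_integrable_sq hac.norm.measurable.aestronglyMeasurable).2 ?_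
    simp only [hasq]
    exact integrable_finsetSum _ fun j _ => (memLp_inner_stdGaussian _).integrable_sq
  have ha1 : ∫ g, ‖a g‖ ∂γ ≤ 1 := by
    have := integral_le_sqrt_integral_sq haL
    rwa [ha2, Real.sqrt_one] at this
  have hint : ∀ i, Integrable (fun g => |inner ℝ (synth v (z i)) g|) γ := fun i =>
    ((memLp_inner_stdGaussian _).integrable one_le_two).abs
  calc ∑ i, ‖synth v (z i)‖ ≤ ∑ i, 1.26 * ∫ g, |inner ℝ (synth v (z i)) g| ∂γ :=
        Finset.sum_le_sum fun i _ => norm_le_integral_abs_inner_stdGaussian _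
    _ = 1.26 * ∫ g, ∑ i, |inner ℝ (a g) (z i)| ∂γ := by
        rw [← Finset.mul_sum, ← integral_finsetSum _ fun i _ => hint i]
        simp only [hinner]
    _ ≤ 1.26 * ∫ g, ‖a g‖ * W ∂γ := by
        refine mul_le_mul_of_nonneg_left (integral_mono ?_
          ((haL.integrable one_le_two).mul_const W)
          fun g => sum_abs_inner_le_norm_mul_ballSup z (a g)) (by norm_num)
        have := integrable_finsetSum Finset.univ fun i _ => hint i
        simpa only [hinner] using this
    _ ≤ 1.26 * W := by
        rw [integral_mul_const]
        exact mul_le_mul_of_nonneg_left (mul_le_of_le_one_left hW0 ha1) (by norm_num)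

end Gaussian

/-! ### From weak moments to moments of the norm -/

section Moment

variable {d : ℕ}

/-- The norm is at most 1.26 times a first Gaussian moment, which is at most the p-th one by
monotonicity of Lᵖ norms. Extended nonnegative values let Tonelli's theorem swap the integrals later
with no integrability assumption. -/
theorem enorm_rpow_le_lintegral_stdGaussian {p : ℝ} (hp : 1 ≤ p) (y : EuclideanSpace ℝ (Fin d)) :
    ‖y‖ₑ ^ p ≤ ENNReal.ofReal 1.26 ^ p *
      ∫⁻ g, ‖(inner ℝ y g : ℝ)‖ₑ ^ p ∂stdGaussian (EuclideanSpace ℝ (Fin d)) := by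
  set γ := stdGaussian (EuclideanSpace ℝ (Fin d))
  have hp0 : 0 < p := by linarith
  have h1 : ‖y‖ₑ ≤ ENNReal.ofReal 1.26 * ∫⁻ g, ‖(inner ℝ y g : ℝ)‖ₑ ∂γ := by
    rw [← ofReal_norm, ← ofReal_integral_norm_eq_lintegral_enorm
      ((memLp_inner_stdGaussian y).integrable one_le_two), ← ENNReal.ofReal_mul (by norm_num)]
    exact ENNReal.ofReal_le_ofReal (norm_le_integral_abs_inner_stdGaussian y)
  have h2 : ∫⁻ g, ‖(inner ℝ y g : ℝ)‖ₑ ∂γ ≤ (∫⁻ g, ‖(inner ℝ y g : ℝ)‖ₑ ^ p ∂γ) ^ (1 / p) := by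
    have := eLpNorm_le_eLpNorm_of_exponent_le (μ := γ) (f := fun g => (inner ℝ y g : ℝ))
      (p := 1) (q := ENNReal.ofReal p) (by simpa using hp)
      (memLp_inner_stdGaussian y).1
    rwa [eLpNorm_one_eq_lintegral_enorm, eLpNorm_eq_lintegral_rpow_enorm_toReal (by simpa using hp0)
      ENNReal.ofReal_ne_top, ENNReal.toReal_ofReal hp0.le] at this
  calc ‖y‖ₑ ^ p ≤ (ENNReal.ofReal 1.26 * (∫⁻ g, ‖(inner ℝ y g : ℝ)‖ₑ ^ p ∂γ) ^ (1 / p)) ^ p :=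
        ENNReal.rpow_le_rpow (h1.trans (mul_le_mul_right h2 _)) hp0.le
    _ = _ := by
        rw [ENNReal.mul_rpow_of_nonneg _ _ hp0.le, ← ENNReal.rpow_mul, one_div,
          inv_mul_cancel₀ hp0.ne', ENNReal.rpow_one]

/-- A weak moment bound implies a bound on the moment of the norm. -/
theorem lintegral_enorm_rpow_le {p : ℝ} (hp : 1 ≤ p) (hp2 : p ≤ 2)
    {ν : Measure (EuclideanSpace ℝ (Fin d))} [SFinite ν] (m : EuclideanSpace ℝ (Fin d))
    (h : ∀ v : EuclideanSpace ℝ (Fin d), ‖v‖ = 1 → ∫⁻ x, ‖(inner ℝ (x - m) v : ℝ)‖ₑ ^ p ∂ν ≤ 1) :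
    ∫⁻ x, ‖x - m‖ₑ ^ p ∂ν ≤ ENNReal.ofReal (1.26 ^ p * (d : ℝ) ^ (p / 2)) := by
  set γ := stdGaussian (EuclideanSpace ℝ (Fin d))
  have hp0 : 0 < p := by linarith
  have hhom : ∀ g : EuclideanSpace ℝ (Fin d),
      ∫⁻ x, ‖(inner ℝ (x - m) g : ℝ)‖ₑ ^ p ∂ν ≤ ‖g‖ₑ ^ p := by
    intro g
    rcases eq_or_ne g 0 with rfl | hg
    · simp [hp0]
    have e : ∀ x, ‖(inner ℝ (x - m) g : ℝ)‖ₑ ^ p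
        = ‖g‖ₑ ^ p * ‖(inner ℝ (x - m) (‖g‖⁻¹ • g) : ℝ)‖ₑ ^ p := fun x => by
      rw [← ENNReal.mul_rpow_of_nonneg _ _ hp0.le]
      congr 1
      rw [← enorm_norm g, ← enorm_mul, real_inner_smul_right,
        mul_inv_cancel_left₀ (norm_ne_zero_iff.2 hg)]
    simp only [e]
    rw [lintegral_const_mul _ (by fun_prop)]
    exact mul_le_of_le_one_right' (h _ (norm_inv_norm_smul hg))
  -- Because p ≤ 2, the p-th moment of ‖g‖ is at most the power p/2 of its second moment d.
  have h3 : ∫⁻ g, ‖g‖ₑ ^ p ∂γ ≤ ENNReal.ofReal ((d : ℝ) ^ (p / 2)) := by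
    have h4 := eLpNorm_le_eLpNorm_of_exponent_le (μ := γ) (f := id)
      (p := ENNReal.ofReal p) (q := 2) (by
        rw [← ENNReal.ofReal_ofNat]; exact ENNReal.ofReal_le_ofReal hp2)
      aestronglyMeasurable_id
    rw [eLpNorm_eq_lintegral_rpow_enorm_toReal (by simpa using hp0)
      ENNReal.ofReal_ne_top, ENNReal.toReal_ofReal hp0.le,
      (IsGaussian.memLp_two_id (μ := γ)).eLpNorm_eq_integral_rpow_norm two_ne_zero
        ENNReal.ofNat_ne_top] at h4
    simp only [id] at h4
    have h5 := ENNReal.rpow_le_rpow h4 hp0.le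
    rw [← ENNReal.rpow_mul, one_div, inv_mul_cancel₀ hp0.ne', ENNReal.rpow_one,
      ENNReal.ofReal_rpow_of_nonneg (by positivity) hp0.le] at h5
    refine h5.trans (le_of_eq ?_)
    congr 1
    have h6 := integral_norm_sq_stdGaussian_euclidean d
    simp only [ENNReal.toReal_ofNat, Real.rpow_ofNat]
    rw [h6, ← Real.rpow_mul (by positivity)]
    congr 1
    ring
  calc ∫⁻ x, ‖x - m‖ₑ ^ p ∂ν
      ≤ ∫⁻ x, ENNReal.ofReal 1.26 ^ p * ∫⁻ g, ‖(inner ℝ (x - m) g : ℝ)‖ₑ ^ p ∂γ ∂ν :=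
        lintegral_mono fun x => enorm_rpow_le_lintegral_stdGaussian hp (x - m)
    _ = ENNReal.ofReal 1.26 ^ p * ∫⁻ g, ∫⁻ x, ‖(inner ℝ (x - m) g : ℝ)‖ₑ ^ p ∂ν ∂γ := by
        have hmeas : Measurable fun q : EuclideanSpace ℝ (Fin d) × EuclideanSpace ℝ (Fin d) =>
            ‖(inner ℝ (q.1 - m) q.2 : ℝ)‖ₑ ^ p := by fun_prop
        rw [lintegral_const_mul _ hmeas.lintegral_prod_right',
          lintegral_lintegral_swap hmeas.aemeasurable]
    _ ≤ ENNReal.ofReal 1.26 ^ p * ENNReal.ofReal ((d : ℝ) ^ (p / 2)) :=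
        mul_le_mul_right ((lintegral_mono hhom).trans h3) _
    _ = _ := by
        rw [ENNReal.ofReal_rpow_of_nonneg (by norm_num) hp0.le, ← ENNReal.ofReal_mul (by positivity)]

end Moment

/-! ### The semidefinite program -/

section SDP

variable {k d : ℕ}

/-- The index set of the program as a sum type. -/
def MTIndex.equivSum (k d : ℕ) : MTIndex k d ≃ Unit ⊕ (Fin k ⊕ Fin d) where
  toFun
    | .one => .inl ()
    | .b i => .inr (.inl i)
    | .v j => .inr (.inr j)
  invFun
    | .inl _ => .one
    | .inr (.inl i) => .b i
    | .inr (.inr j) => .v j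
  left_inv a := by cases a <;> rfl
  right_inv a := by rcases a with _ | _ | _ <;> rfl

instance (k d : ℕ) : Fintype (MTIndex k d) := Fintype.ofEquiv _ (MTIndex.equivSum k d).symm

/-- The Euclidean space in which a feasible matrix is represented as a Gram matrix. -/
abbrev MTSpace (k d : ℕ) : Type := EuclideanSpace ℝ (MTIndex k d)

open scoped MatrixOrder Matrix.Norms.L2Operator in
/-- A positive semidefinite matrix is a Gram matrix. -/
theorem Matrix.PosSemidef.exists_gram {n : Type*} [Fintype n] {M : Matrix n n ℝ}
    (hM : M.PosSemidef) : ∃ a : n → EuclideanSpace ℝ n, ∀ i j, M i j = inner ℝ (a i) (a j) := by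
  classical
  obtain ⟨B, rfl⟩ := CStarAlgebra.nonneg_iff_eq_star_mul_self.mp hM.nonneg
  refine ⟨fun i => WithLp.toLp 2 fun l => B l i, fun i j => ?_⟩
  simp [Matrix.mul_apply, Matrix.star_eq_conjTranspose, PiLp.inner_apply, mul_comm]

/-- The contribution of a point `z` to the objective of the program is at most `mtTerm r e v z`,
where `e` and `v` represent the index `1` and the indices `v_1, …, v_d`. -/
def mtTerm (r : ℝ) (e : MTSpace k d) (v : Fin d → MTSpace k d) (z : EuclideanSpace ℝ (Fin d)) : ℝ :=
  min 1 ((inner ℝ e (synth v z) + ‖synth v z‖) / (2 * r))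

/-- The possible choices of the vectors that represent the indices `1, v_1, …, v_d`. -/
def MTFrame (k d : ℕ) : Type :=
  {p : MTSpace k d × (Fin d → MTSpace k d) // ‖p.1‖ = 1 ∧ ∑ j, ‖p.2 j‖ ^ 2 = 1}

/-- An upper bound for the value of the program at centred data `z`. -/
def mtBound (r : ℝ) (z : Fin k → EuclideanSpace ℝ (Fin d)) : ℝ :=
  ⨆ p : MTFrame k d, ∑ i, mtTerm r p.1.1 p.1.2 (z i)

theorem mtTerm_nonneg {r : ℝ} (hr : 0 < r) {e : MTSpace k d} (he : ‖e‖ = 1)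
    (v : Fin d → MTSpace k d) (z : EuclideanSpace ℝ (Fin d)) : 0 ≤ mtTerm r e v z := by
  refine le_min zero_le_one (div_nonneg ?_ (by positivity))
  have h := (abs_le.1 (abs_real_inner_le_norm e (synth v z))).1
  rw [he, one_mul] at h
  linarith

theorem mtTerm_le_one (r : ℝ) (e : MTSpace k d) (v : Fin d → MTSpace k d)
    (z : EuclideanSpace ℝ (Fin d)) : mtTerm r e v z ≤ 1 := min_le_left _ _

theorem sum_mtTerm_le (r : ℝ) (e : MTSpace k d) (v : Fin d → MTSpace k d)
    (z : Fin k → EuclideanSpace ℝ (Fin d)) : ∑ i, mtTerm r e v (z i) ≤ k := by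
  have h := Finset.sum_le_sum fun (i : Fin k) (_ : i ∈ Finset.univ) => mtTerm_le_one r e v (z i)
  simpa using h

theorem bddAbove_mtTerm (r : ℝ) (z : Fin k → EuclideanSpace ℝ (Fin d)) :
    BddAbove (Set.range fun p : MTFrame k d => ∑ i, mtTerm r p.1.1 p.1.2 (z i)) :=
  ⟨k, by rintro _ ⟨p, rfl⟩; exact sum_mtTerm_le r _ _ z⟩

theorem mtFrame_nonempty (hd : 0 < d) : Nonempty (MTFrame k d) := by
  classical
  refine ⟨⟨(EuclideanSpace.single .one 1, fun j => if j = ⟨0, hd⟩ then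
    EuclideanSpace.single .one 1 else 0), by simp, ?_⟩⟩
  rw [Finset.sum_eq_single (⟨0, hd⟩ : Fin d)]
  · simp
  · intro j _ hj
    simp [hj]
  · simp

theorem le_mtBound (r : ℝ) (z : Fin k → EuclideanSpace ℝ (Fin d)) (p : MTFrame k d) :
    ∑ i, mtTerm r p.1.1 p.1.2 (z i) ≤ mtBound r z :=
  le_ciSup (bddAbove_mtTerm r z) p

theorem abs_mtBound_le (hd : 0 < d) {r : ℝ} (hr : 0 < r) (z : Fin k → EuclideanSpace ℝ (Fin d)) :
    |mtBound r z| ≤ k := by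
  obtain ⟨p⟩ := mtFrame_nonempty (k := k) hd
  have : Nonempty (MTFrame k d) := ⟨p⟩
  rw [abs_of_nonneg]
  · exact ciSup_le fun p => sum_mtTerm_le r _ _ z
  · exact (Finset.sum_nonneg fun i _ => mtTerm_nonneg hr p.2.1 _ _).trans (le_mtBound r z p)

/-- Each summand lies in [0, 1], so replacing one point costs at most 1 for every frame. The cap in
`mtTerm` exists for this. -/
theorem mtBound_update_le (hd : 0 < d) {r : ℝ} (hr : 0 < r)
    (z : Fin k → EuclideanSpace ℝ (Fin d)) (i : Fin k) (y : EuclideanSpace ℝ (Fin d)) :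
    mtBound r (Function.update z i y) ≤ mtBound r z + 1 := by
  have := mtFrame_nonempty (k := k) hd
  refine ciSup_le fun p => ?_
  refine le_trans ?_ (add_le_add_left (le_mtBound r z p) 1)
  rw [← Finset.add_sum_erase _ _ (Finset.mem_univ i),
    ← Finset.add_sum_erase _ (fun j => mtTerm r p.1.1 p.1.2 (z j)) (Finset.mem_univ i),
    Function.update_self]
  have h1 : ∑ j ∈ Finset.univ.erase i, mtTerm r p.1.1 p.1.2 (Function.update z i y j)
      = ∑ j ∈ Finset.univ.erase i, mtTerm r p.1.1 p.1.2 (z j) :=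
    Finset.sum_congr rfl fun j hj => by
      rw [Function.update_of_ne (Finset.ne_of_mem_erase hj)]
  have h2 := mtTerm_le_one r p.1.1 p.1.2 y
  have h3 := mtTerm_nonneg hr p.2.1 p.1.2 (z i)
  rw [h1]
  linarith

/-- The supremum is over uncountably many frames, but a bounded supremum of continuous functions is
lower semicontinuous. -/
theorem measurable_mtBound (r : ℝ) :
    Measurable (mtBound r : (Fin k → EuclideanSpace ℝ (Fin d)) → ℝ) := by
  refine LowerSemicontinuous.measurable (lowerSemicontinuous_ciSup (bddAbove_mtTerm r)
    fun p => Continuous.lowerSemicontinuous ?_)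
  unfold mtTerm synth
  fun_prop

/-- The bound in terms of suprema of linear functionals. -/
theorem mtBound_le (hd : 0 < d) {r : ℝ} (hr : 0 < r) (z : Fin k → EuclideanSpace ℝ (Fin d)) :
    mtBound r z
      ≤ (‖∑ i, z i‖ + 1.26 * ballSup fun u => ∑ i, |inner ℝ u (z i)|) / (2 * r) := by
  have := mtFrame_nonempty (k := k) hd
  refine ciSup_le fun p => ?_
  obtain ⟨⟨e, v⟩, he, hv⟩ := p
  calc ∑ i, mtTerm r e v (z i)
      ≤ ∑ i, (inner ℝ e (synth v (z i)) + ‖synth v (z i)‖) / (2 * r) :=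
        Finset.sum_le_sum fun i _ => min_le_right _ _
    _ = (inner ℝ e (synth v (∑ i, z i)) + ∑ i, ‖synth v (z i)‖) / (2 * r) := by
        rw [← Finset.sum_div, Finset.sum_add_distrib, synth_sum, inner_sum]
    _ ≤ _ := by
        refine div_le_div_of_nonneg_right (add_le_add ?_ (sum_norm_synth_le hv z)) (by positivity)
        refine (real_inner_le_norm _ _).trans ?_
        rw [he, one_mul]
        exact norm_synth_le hv _

/-- Every feasible solution has objective at most `mtBound`. -/
theorem MTFeasible.mtObjective_le {x : EuclideanSpace ℝ (Fin d)} {r r' : ℝ} (hr : 0 < r)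
    (hrr' : r ≤ r') {Z : Fin k → EuclideanSpace ℝ (Fin d)} {X : Matrix (MTIndex k d) (MTIndex k d) ℝ}
    (hX : MTFeasible x r' Z X) : mtObjective X ≤ mtBound r fun i => Z i - x := by
  obtain ⟨a, ha⟩ := hX.posSemidef.exists_gram
  have he : ‖a .one‖ = 1 := by
    have h := hX.one_one
    rw [ha, real_inner_self_eq_norm_sq] at h
    nlinarith [norm_nonneg (a .one)]
  have hv : ∑ j, ‖a (.v j)‖ ^ 2 = 1 := by
    rw [← hX.v_trace]
    exact Finset.sum_congr rfl fun j _ => by rw [ha, real_inner_self_eq_norm_sq]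
  refine le_trans (Finset.sum_le_sum fun i _ => ?_)
    (le_mtBound r _ ⟨(a .one, fun j => a (.v j)), he, hv⟩)
  set e := a .one
  set b := a (.b i) with hb
  set w := synth (fun j => a (.v j)) (Z i - x) with hw
  have h1 : ‖b‖ ^ 2 = inner ℝ e b := by
    rw [← real_inner_self_eq_norm_sq, ← ha, ← ha]
    exact hX.b_b i
  have h2 : ‖b‖ ^ 2 * r' ≤ inner ℝ b w := by
    have h := hX.separation i
    rw [ha, real_inner_self_eq_norm_sq] at h
    refine h.trans (le_of_eq ?_)
    rw [hw, synth, inner_sum]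
    refine Finset.sum_congr rfl fun j _ => ?_
    rw [ha, real_inner_smul_right, mul_comm]
  have hXb : X (.b i) (.b i) = ‖b‖ ^ 2 := by rw [ha, real_inner_self_eq_norm_sq]
  have hb1 : ‖b‖ ^ 2 ≤ 1 := by
    have h := real_inner_le_norm e b
    rw [← h1, he, one_mul] at h
    nlinarith [norm_nonneg b]
  rw [hXb]
  refine le_min hb1 ?_
  -- The relation ‖b‖² = ⟨e, b⟩ places b on the sphere with diameter from 0 to e, so 2b - e is a
  -- unit vector. Pairing it with w improves on the crude bound ⟨b, w⟩ ≤ ‖w‖ by keeping the signed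
  -- part ⟨e, w⟩, which cancels in the sum over i.
  have h3 : ‖(2 : ℝ) • b - e‖ = 1 := by
    have h := norm_sub_sq_real ((2 : ℝ) • b) e
    rw [norm_smul, real_inner_smul_left, real_inner_comm, ← h1, he, Real.norm_ofNat] at h
    have h' : ‖(2 : ℝ) • b - e‖ ^ 2 = 1 := by rw [h]; ring
    nlinarith [norm_nonneg ((2 : ℝ) • b - e)]
  have h4 : 2 * inner ℝ b w ≤ inner ℝ e w + ‖w‖ := by
    have h := real_inner_le_norm ((2 : ℝ) • b - e) w
    rw [h3, one_mul, inner_sub_left, real_inner_smul_left] at h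
    linarith
  -- The separation constraint at the larger radius r' implies the one at r, since ‖b‖² is
  -- nonnegative.
  rw [le_div_iff₀ (by positivity)]
  nlinarith [mul_le_mul_of_nonneg_left hrr' (sq_nonneg ‖b‖)]

/-- The program has an optimal solution. -/
theorem exists_isMTValue (hd : 0 < d) (x : EuclideanSpace ℝ (Fin d)) (r : ℝ)
    (Z : Fin k → EuclideanSpace ℝ (Fin d)) : ∃ m, IsMTValue x r Z m := by
  classical
  set S := {X : Matrix (MTIndex k d) (MTIndex k d) ℝ | MTFeasible x r Z X} with hS
  have hSeq : S = {X | X.PosSemidef} ∩ {X | X .one .one = 1}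
      ∩ {X | ∀ i, X (.b i) (.b i) = X .one (.b i)} ∩ {X | ∑ j, X (.v j) (.v j) = 1}
      ∩ {X | ∀ i, X (.b i) (.b i) * r ≤ ∑ j, X (.b i) (.v j) * (Z i - x) j} := by
    ext X
    constructor
    · intro h
      exact ⟨⟨⟨⟨h.posSemidef, h.one_one⟩, h.b_b⟩, h.v_trace⟩, h.separation⟩
    · rintro ⟨⟨⟨⟨h1, h2⟩, h3⟩, h4⟩, h5⟩
      exact ⟨h1, h2, h3, h4, h5⟩
  have hentry : ∀ i j, Continuous fun X : Matrix (MTIndex k d) (MTIndex k d) ℝ => X i j :=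
    fun i j => continuous_id.matrix_elem i j
  have hpsd : IsClosed {X : Matrix (MTIndex k d) (MTIndex k d) ℝ | X.PosSemidef} := by
    have : {X : Matrix (MTIndex k d) (MTIndex k d) ℝ | X.PosSemidef}
        = {X | X.conjTranspose = X} ∩ ⋂ y : MTIndex k d → ℝ, {X | 0 ≤ star y ⬝ᵥ (X.mulVec y)} := by
      ext X
      simp only [Set.mem_ofPred_eq, Set.mem_inter_iff, Set.mem_iInter]
      exact Matrix.posSemidef_iff_dotProduct_mulVec
    rw [this]
    refine IsClosed.inter (isClosed_eq (by fun_prop) continuous_id)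
      (isClosed_iInter fun y => isClosed_le continuous_const ?_)
    fun_prop
  have hclosed : IsClosed S := by
    rw [hSeq]
    refine ((((hpsd.inter (isClosed_eq (hentry _ _) continuous_const)).inter ?_).inter ?_).inter ?_)
    · simp only [Set.ofPred_forall]
      exact isClosed_iInter fun i => isClosed_eq (hentry _ _) (hentry _ _)
    · exact isClosed_eq (continuous_finsetSum _ fun j _ => hentry _ _) continuous_const
    · simp only [Set.ofPred_forall]
      exact isClosed_iInter fun i => isClosed_le ((hentry _ _).mul continuous_const)
        (continuous_finsetSum _ fun j _ => (hentry _ _).mul continuous_const)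
  -- All Gram vectors have length at most 1: the first by normalization, the b_i because ‖b‖² = ⟨e,
  -- b⟩ ≤ ‖b‖, the v_j by the trace constraint. Cauchy–Schwarz bounds the entries.
  have hbdd : S ⊆ Set.univ.pi fun _ => Set.univ.pi fun _ => Set.Icc (-1 : ℝ) 1 := by
    intro X hX i _ j _
    obtain ⟨a, ha⟩ := MTFeasible.posSemidef hX |>.exists_gram
    have hsq : ∀ i, ‖a i‖ ^ 2 = X i i := fun i => by rw [ha, real_inner_self_eq_norm_sq]
    have hone : ‖a .one‖ = 1 := by
      have h := hsq .one
      rw [MTFeasible.one_one hX] at h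
      nlinarith [norm_nonneg (a .one)]
    have hle : ∀ i, ‖a i‖ ≤ 1 := by
      intro i
      cases i with
      | one => exact hone.le
      | b i =>
        have h1 := hsq (.b i)
        rw [MTFeasible.b_b hX, ha] at h1
        have h2 := real_inner_le_norm (a .one) (a (.b i))
        rw [← h1, hone, one_mul] at h2
        nlinarith [norm_nonneg (a (.b i))]
      | v j =>
        have h1 := MTFeasible.v_trace hX
        simp only [← hsq] at h1
        have h2 := Finset.single_le_sum (f := fun j => ‖a (.v j)‖ ^ 2)
          (fun j _ => sq_nonneg _) (Finset.mem_univ j)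
        rw [h1] at h2
        nlinarith [norm_nonneg (a (.v j))]
    have h := abs_real_inner_le_norm (a i) (a j)
    rw [← ha] at h
    exact abs_le.1 (h.trans (mul_le_one₀ (hle i) (norm_nonneg _) (hle j)))
  have hcompact : IsCompact S :=
    (isCompact_univ_pi fun _ => isCompact_univ_pi fun _ => isCompact_Icc).of_isClosed_subset
      hclosed hbdd
  -- With all b_i equal to 0 the separation constraints read 0 ≤ 0 for any r. The trace constraint
  -- is met by one v_j, which exists as d > 0.
  have hne : S.Nonempty := by
    let u : MTIndex k d → ℝ
      | .one => 1
      | .b _ => 0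
      | .v j => if j = ⟨0, hd⟩ then 1 else 0
    refine ⟨Matrix.diagonal u, ⟨Matrix.PosSemidef.diagonal fun i => ?_, by simp [u], by simp [u],
      by simp [u], by simp [u]⟩⟩
    cases i with
    | one => simp [u]
    | b i => simp [u]
    | v j => by_cases h : j = ⟨0, hd⟩ <;> simp [u, h]
  have hobj : Continuous (mtObjective : Matrix (MTIndex k d) (MTIndex k d) ℝ → ℝ) :=
    continuous_finsetSum _ fun i _ => hentry _ _
  exact (hcompact.image hobj).exists_isGreatest (hne.image _)

/-- If `mtBound` is small, then so are the values of the program for all larger radii. -/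
theorem forall_exists_isMTValue_le (hd : 0 < d) {x : EuclideanSpace ℝ (Fin d)} {r₀ c : ℝ}
    (hr₀ : 0 < r₀) {Z : Fin k → EuclideanSpace ℝ (Fin d)}
    (h : mtBound r₀ (fun i => Z i - x) ≤ c) (r : ℝ) (hr : r₀ ≤ r) :
    ∃ m, IsMTValue x r Z m ∧ m ≤ c := by
  obtain ⟨m, hm⟩ := exists_isMTValue hd x r Z
  refine ⟨m, hm, ?_⟩
  obtain ⟨X, hX, rfl⟩ := hm.1
  exact (MTFeasible.mtObjective_le hr₀ hr hX).trans h

end SDP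

/-! ### Expectation and tails of the bound for the program -/

section ExpectedBound

variable {k d : ℕ}

/-- The expectation of `mtBound` at independent centred points. -/
theorem integral_mtBound_le (hd : 0 < d) {r : ℝ} (hr : 0 < r)
    (ν : Fin k → Measure (EuclideanSpace ℝ (Fin d))) [∀ i, IsProbabilityMeasure (ν i)]
    (hν : ∀ i, MemLp (fun z => z) 2 (ν i)) (h0 : ∀ i, ∫ z, z ∂ν i = 0) {β V : ℝ}
    (hβ : ∀ i v, ‖v‖ ≤ 1 → ∫ z, |inner ℝ v z| ∂ν i ≤ β)
    (hV : ∀ i, ∫ z, ‖z‖ ^ 2 ∂ν i ≤ V) :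
    ∫ z, mtBound r z ∂Measure.pi ν ≤ (3.52 * √(k * V) + 1.26 * (k * β)) / (2 * r) := by
  have hi : ∀ i, Integrable (fun z : EuclideanSpace ℝ (Fin d) => z) (ν i) := fun i =>
    (hν i).integrable one_le_two
  have hsum : ∑ i, ∫ z, ‖z‖ ^ 2 ∂ν i ≤ k * V := by
    have := Finset.sum_le_sum fun i (_ : i ∈ (Finset.univ : Finset (Fin k))) => hV i
    simpa using this
  set m := fun (i : Fin k) v => ∫ z, |inner ℝ v z| ∂ν i with hm_def
  have hm : ∀ i, BallBounded (m i) := fun i => ballBounded_integral_abs_inner (hi i)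
  set C := fun z : Fin k → EuclideanSpace ℝ (Fin d) =>
    ballSup fun v => ∑ i, (|inner ℝ v (z i)| - m i v) with hC
  have hCb : ∀ z : Fin k → EuclideanSpace ℝ (Fin d),
      BallBounded fun v => ∑ i, (|inner ℝ v (z i)| - m i v) := fun z =>
    BallBounded.sum _ fun i => (ballBounded_abs_inner (z i)).sub (hm i)
  have hCi : Integrable C (Measure.pi ν) := by
    choose D hD using hm
    have hc : Continuous C := by
      refine continuous_ballSup (L := k) hCb fun z z' v hv => ?_
      have : ∑ i, (|inner ℝ v (z i)| - m i v)
          ≤ ∑ i : Fin k, ((|inner ℝ v (z' i)| - m i v) + dist z z') :=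
        Finset.sum_le_sum fun i _ => by
          have h1 := abs_inner_sub_le_dist hv (z i) (z' i)
          have h2 := dist_le_pi_dist z z' i
          linarith
      rw [Finset.sum_add_distrib, Finset.sum_const, Finset.card_univ, Fintype.card_fin,
        nsmul_eq_mul] at this
      linarith
    refine Integrable.mono' (g := fun z => ∑ i, (‖z i‖ + D i))
      (integrable_finsetSum _ fun i _ =>
        (integrable_comp_eval (hi i).norm).add (integrable_const _))
      hc.measurable.aestronglyMeasurable
      (Filter.Eventually.of_forall fun z => abs_ballSup_le fun v hv => ?_)
    refine (Finset.abs_sum_le_sum_abs _ _).trans (Finset.sum_le_sum fun i _ => ?_)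
    refine (abs_sub _ _).trans (add_le_add ?_ (hD i v hv))
    rw [abs_abs]
    exact abs_inner_le_of_norm_le_one hv _
  have hCint : ∫ z, C z ∂Measure.pi ν ≤ 2 * √(k * V) :=
    (integral_ballSup_sum_abs_inner_sub_le_sqrt ν hν).trans
      (mul_le_mul_of_nonneg_left (Real.sqrt_le_sqrt hsum) zero_le_two)
  have hSi : Integrable (fun z : Fin k → EuclideanSpace ℝ (Fin d) => ‖∑ i, z i‖)
      (Measure.pi ν) := (integrable_finsetSum _ fun i _ => integrable_pi_eval hi i).norm
  have hSint : ∫ z : Fin k → EuclideanSpace ℝ (Fin d), ‖∑ i, z i‖ ∂Measure.pi ν ≤ √(k * V) :=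
    (integral_norm_sum_pi_le_sqrt ν hν h0).trans (Real.sqrt_le_sqrt hsum)
  -- The supremum of ∑ |⟨u, z i⟩| is at most the centred supremum C plus the largest total mean,
  -- which is at most k β.
  have hle : ∀ z : Fin k → EuclideanSpace ℝ (Fin d),
      mtBound r z ≤ (‖∑ i, z i‖ + 1.26 * (C z + k * β)) / (2 * r) := by
    intro z
    refine (mtBound_le hd hr z).trans (div_le_div_of_nonneg_right ?_ (by positivity))
    refine add_le_add le_rfl (mul_le_mul_of_nonneg_left (ballSup_le fun v hv => ?_) (by norm_num))
    have h1 := (hCb z).le_ballSup hv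
    rw [Finset.sum_sub_distrib] at h1
    have h2 : ∑ i, m i v ≤ k * β := by
      have := Finset.sum_le_sum fun i (_ : i ∈ (Finset.univ : Finset (Fin k))) => hβ i v hv
      simpa using this
    simp only [hC]
    linarith
  calc ∫ z, mtBound r z ∂Measure.pi ν
      ≤ ∫ z, (‖∑ i, z i‖ + 1.26 * (C z + k * β)) / (2 * r) ∂Measure.pi ν :=
        integral_mono (integrable_of_measurable_of_bound (measurable_mtBound r)
          (abs_mtBound_le hd hr))
          ((hSi.add ((hCi.add (integrable_const _)).const_mul _)).div_const _) hle
    _ = (∫ z : Fin k → EuclideanSpace ℝ (Fin d), ‖∑ i, z i‖ ∂Measure.pi ν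
          + 1.26 * (∫ z, C z ∂Measure.pi ν + k * β)) / (2 * r) := by
        have hCk : Integrable (fun z => 1.26 * (C z + k * β)) (Measure.pi ν) :=
          (hCi.add (integrable_const _)).const_mul _
        rw [integral_div, integral_add hSi hCk,
          integral_const_mul, integral_add hCi (integrable_const _)]
        simp
    _ ≤ _ := by
        -- The constant is 3.52 = 1 + 1.26 · 2: one √(kV) from the norm of the sum, two from
        -- symmetrization.
        refine div_le_div_of_nonneg_right ?_ (by positivity)
        linarith

/-- **Markov's inequality** for `mtBound`. -/
theorem measureReal_mtBound_ge_le_markov (hd : 0 < d) (hk : 0 < k) {r : ℝ} (hr : 0 < r)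
    (ν : Fin k → Measure (EuclideanSpace ℝ (Fin d))) [∀ i, IsProbabilityMeasure (ν i)]
    (h : ∫ z, mtBound r z ∂Measure.pi ν ≤ k / 64) :
    (Measure.pi ν).real {z | (k : ℝ) / 20 ≤ mtBound r z} ≤ 5 / 16 := by
  have hint : Integrable (mtBound r) (Measure.pi ν) :=
    integrable_of_measurable_of_bound (measurable_mtBound r) (abs_mtBound_le hd hr)
  have := mtFrame_nonempty (k := k) hd
  have h1 := mul_meas_ge_le_integral_of_nonneg (μ := Measure.pi ν)
    (Filter.Eventually.of_forall fun z => Real.iSup_nonneg fun p =>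
      Finset.sum_nonneg fun i _ => mtTerm_nonneg hr p.2.1 _ _) hint ((k : ℝ) / 20)
  have hk' : (0 : ℝ) < k := by exact_mod_cast hk
  have h2 : (k : ℝ) / 20 * (Measure.pi ν).real {z | (k : ℝ) / 20 ≤ mtBound r z} ≤ k / 64 :=
    h1.trans h
  -- The ratio of k/64 to k/20 is 5/16.
  by_contra hcon
  push Not at hcon
  nlinarith

/-- The gap is k/20 - k/64 = (11/320) k, and McDiarmid's exponent 2 (11/320)² exceeds 1/500. -/
theorem measureReal_mtBound_ge_le_exp (hd : 0 < d) {r : ℝ} (hr : 0 < r)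
    (ν : Fin k → Measure (EuclideanSpace ℝ (Fin d))) [∀ i, IsProbabilityMeasure (ν i)]
    (h : ∫ z, mtBound r z ∂Measure.pi ν ≤ k / 64) :
    (Measure.pi ν).real {z | (k : ℝ) / 20 ≤ mtBound r z} ≤ Real.exp (-(k / 500)) := by
  refine (measureReal_ge_le_of_bounded_differences ν (measurable_mtBound r) (abs_mtBound_le hd hr)
    (mtBound_update_le hd hr) (ε := 11 / 320) (by norm_num) (by linarith)).trans ?_
  refine Real.exp_le_exp.2 (neg_le_neg ?_)
  have hk' : (0 : ℝ) ≤ k := by positivity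
  nlinarith

end ExpectedBound

/-! ### Averages of independent real random variables with a weak moment -/

section RealAverage

/-- Truncation at level `T`. -/
def truncAt (T y : ℝ) : ℝ := if |y| ≤ T then y else 0

theorem measurable_truncAt (T : ℝ) : Measurable (truncAt T) :=
  Measurable.ite (measurableSet_le measurable_norm measurable_const) measurable_id measurable_const

theorem abs_truncAt_le {T : ℝ} (hT : 0 ≤ T) (y : ℝ) : |truncAt T y| ≤ T := by
  unfold truncAt
  split_ifs with h
  · exact h
  · simpa using hT

/-- Beyond the level, 1 ≤ (|y| / T)^α. -/
theorem abs_sub_truncAt_le {α T : ℝ} (hα : 0 < α) (hT : 0 < T) (y : ℝ) :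
    |y - truncAt T y| ≤ T ^ (-α) * |y| ^ (1 + α) := by
  unfold truncAt
  split_ifs with h
  · simp only [sub_self, abs_zero]
    positivity
  · push Not at h
    have hy : 0 < |y| := hT.trans h
    rw [sub_zero, Real.rpow_add hy, Real.rpow_one, Real.rpow_neg hT.le, ← mul_assoc, mul_comm _ |y|,
      mul_assoc]
    refine le_mul_of_one_le_right hy.le ?_
    rw [inv_mul_eq_div, one_le_div (by positivity)]
    exact Real.rpow_le_rpow hT.le h.le hα.le

/-- Below the level, y² = |y|^(1-α) |y|^(1+α) and the first factor is at most T^(1-α). -/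
theorem truncAt_sq_le {α T : ℝ} (hα : 0 < α) (hα1 : α ≤ 1) (hT : 0 ≤ T) (y : ℝ) :
    truncAt T y ^ 2 ≤ T ^ (1 - α) * |y| ^ (1 + α) := by
  unfold truncAt
  split_ifs with h
  · rcases eq_or_ne y 0 with rfl | hy
    · rw [abs_zero, Real.zero_rpow (by linarith)]
      simp
    have hy : 0 < |y| := abs_pos.2 hy
    have e : y ^ 2 = |y| ^ (1 - α) * |y| ^ (1 + α) := by
      rw [← Real.rpow_add hy, ← sq_abs, ← Real.rpow_natCast]
      congr 1
      push_cast
      ring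
    rw [e]
    exact mul_le_mul_of_nonneg_right (Real.rpow_le_rpow hy.le h (by linarith)) (by positivity)
  · rw [zero_pow two_ne_zero]
    positivity

variable {Ω ι : Type*} [MeasurableSpace Ω] {P : Measure Ω} [IsProbabilityMeasure P]

theorem integral_sq_sub_integral_le {f : Ω → ℝ} (hf : MemLp f 2 P) :
    ∫ ω, (f ω - ∫ ω', f ω' ∂P) ^ 2 ∂P ≤ ∫ ω, f ω ^ 2 ∂P := by
  have h := variance_le_expectation_sq (μ := P) hf.1
  rwa [variance_eq_integral hf.1.aemeasurable] at h

/-- The mean absolute deviation of an average of independent variables with bounded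
`(1 + α)`-th moments. -/
theorem integral_abs_average_le {Y : ι → Ω → ℝ} (hind : iIndepFun Y P) {α T κ : ℝ} (hα : 0 < α)
    (hα1 : α ≤ 1) (hT : 0 < T) {s : Finset ι} (hs : s.Nonempty)
    (hY : ∀ j ∈ s, Integrable (Y j) P) (hYm : ∀ j, Measurable (Y j))
    (hint : ∀ j ∈ s, Integrable (fun ω => |Y j ω| ^ (1 + α)) P)
    (hκ : ∀ j ∈ s, ∫ ω, |Y j ω| ^ (1 + α) ∂P ≤ κ) :
    ∫ ω, |(s.card : ℝ)⁻¹ * ∑ j ∈ s, (Y j ω - ∫ ω', Y j ω' ∂P)| ∂P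
      ≤ 2 * (κ * T ^ (-α)) + √(κ * T ^ (1 - α) / s.card) := by
  set N := (s.card : ℝ) with hN
  have hNpos : 0 < N := by simpa [hN] using hs.card_pos
  -- The truncated parts have finite variance and gain from independence. The remainders R are
  -- merely small in L¹ and are summed by the triangle inequality, counted twice because of
  -- centring.
  set U := fun j ω => truncAt T (Y j ω) with hU
  have hUm : ∀ j, Measurable (U j) := fun j => (measurable_truncAt T).comp (hYm j)
  have hUL : ∀ j, MemLp (U j) 2 P := fun j =>
    MemLp.of_bound (hUm j).aestronglyMeasurable T
      (Filter.Eventually.of_forall fun ω => abs_truncAt_le hT.le _)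
  have hUi : ∀ j, Integrable (U j) P := fun j => (hUL j).integrable one_le_two
  set D := fun j ω => U j ω - ∫ ω', U j ω' ∂P with hD
  have hDL : ∀ j, MemLp (D j) 2 P := fun j => (hUL j).sub (memLp_const _)
  have hDind : iIndepFun D P :=
    hind.comp (fun j y => truncAt T y - ∫ ω', U j ω' ∂P)
      fun j => (measurable_truncAt T).sub_const _
  have hD0 : ∀ j, ∫ ω, D j ω ∂P = 0 := fun j => by
    simp only [hD]
    rw [integral_sub (hUi j) (integrable_const _)]
    simp
  set R := fun j ω => Y j ω - U j ω with hR
  have hRi : ∀ j ∈ s, Integrable (R j) P := fun j hj => (hY j hj).sub (hUi j)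
  have hRb : ∀ j ∈ s, ∫ ω, |R j ω| ∂P ≤ κ * T ^ (-α) := fun j hj =>
    calc ∫ ω, |R j ω| ∂P ≤ ∫ ω, T ^ (-α) * |Y j ω| ^ (1 + α) ∂P :=
          integral_mono (hRi j hj).abs ((hint j hj).const_mul _)
            fun ω => abs_sub_truncAt_le hα hT _
      _ ≤ κ * T ^ (-α) := by
          rw [integral_const_mul, mul_comm]
          exact mul_le_mul_of_nonneg_right (hκ j hj) (by positivity)
  have hDb : ∀ j ∈ s, ∫ ω, ‖D j ω‖ ^ 2 ∂P ≤ κ * T ^ (1 - α) := fun j hj =>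
    calc ∫ ω, ‖D j ω‖ ^ 2 ∂P = ∫ ω, (U j ω - ∫ ω', U j ω' ∂P) ^ 2 ∂P := by
          simp only [Real.norm_eq_abs, sq_abs, hD]
      _ ≤ ∫ ω, U j ω ^ 2 ∂P := integral_sq_sub_integral_le (hUL j)
      _ ≤ ∫ ω, T ^ (1 - α) * |Y j ω| ^ (1 + α) ∂P :=
          integral_mono (hUL j).integrable_sq ((hint j hj).const_mul _)
            fun ω => truncAt_sq_le hα hα1 hT.le _
      _ ≤ κ * T ^ (1 - α) := by
          rw [integral_const_mul, mul_comm]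
          exact mul_le_mul_of_nonneg_right (hκ j hj) (by positivity)
  have hDs : ∫ ω, ‖∑ j ∈ s, D j ω‖ ∂P ≤ √(N * (κ * T ^ (1 - α))) := by
    refine (integral_norm_sum_le_sqrt hDind s (fun j _ => hDL j) fun j _ => hD0 j).trans
      (Real.sqrt_le_sqrt ?_)
    have := Finset.sum_le_sum hDb
    simpa using this
  have hDsi : Integrable (fun ω => ‖∑ j ∈ s, D j ω‖) P :=
    (integrable_finsetSum _ fun j _ => (hDL j).integrable one_le_two).norm
  have hRsi : Integrable (fun ω => ∑ j ∈ s, (|R j ω| + ∫ ω', |R j ω'| ∂P)) P :=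
    integrable_finsetSum _ fun j hj => (hRi j hj).abs.add (integrable_const _)
  have hpt : ∀ ω, |N⁻¹ * ∑ j ∈ s, (Y j ω - ∫ ω', Y j ω' ∂P)|
      ≤ N⁻¹ * (‖∑ j ∈ s, D j ω‖ + ∑ j ∈ s, (|R j ω| + ∫ ω', |R j ω'| ∂P)) := by
    intro ω
    rw [abs_mul, abs_of_pos (inv_pos.2 hNpos)]
    refine mul_le_mul_of_nonneg_left ?_ (inv_pos.2 hNpos).le
    have e : ∑ j ∈ s, (Y j ω - ∫ ω', Y j ω' ∂P)
        = ∑ j ∈ s, D j ω + ∑ j ∈ s, (R j ω - ∫ ω', R j ω' ∂P) := by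
      rw [← Finset.sum_add_distrib]
      refine Finset.sum_congr rfl fun j hj => ?_
      have h : ∫ ω', R j ω' ∂P = ∫ ω', Y j ω' ∂P - ∫ ω', U j ω' ∂P :=
        integral_sub (hY j hj) (hUi j)
      rw [h]
      simp only [hD, hR]
      ring
    rw [e]
    refine (abs_add_le _ _).trans (add_le_add le_rfl ?_)
    refine (Finset.abs_sum_le_sum_abs _ _).trans (Finset.sum_le_sum fun j _ => ?_)
    exact (abs_sub _ _).trans (add_le_add le_rfl (abs_integral_le_integral_abs))
  have hYi : Integrable (fun ω => ∑ j ∈ s, (Y j ω - ∫ ω', Y j ω' ∂P)) P :=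
    integrable_finsetSum _ fun j hj => (hY j hj).sub (integrable_const _)
  calc ∫ ω, |N⁻¹ * ∑ j ∈ s, (Y j ω - ∫ ω', Y j ω' ∂P)| ∂P
      ≤ ∫ ω, N⁻¹ * (‖∑ j ∈ s, D j ω‖ + ∑ j ∈ s, (|R j ω| + ∫ ω', |R j ω'| ∂P)) ∂P :=
        integral_mono (hYi.const_mul _).abs ((hDsi.add hRsi).const_mul _) hpt
    _ = N⁻¹ * (∫ ω, ‖∑ j ∈ s, D j ω‖ ∂P + ∑ j ∈ s, (2 * ∫ ω', |R j ω'| ∂P)) := by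
        have hRa : ∀ j ∈ s, Integrable (fun ω => |R j ω| + ∫ ω', |R j ω'| ∂P) P := fun j hj =>
          (hRi j hj).abs.add (integrable_const _)
        rw [integral_const_mul, integral_add hDsi hRsi, integral_finsetSum _ hRa]
        congr 2
        refine Finset.sum_congr rfl fun j hj => ?_
        rw [integral_add (hRi j hj).abs (integrable_const _)]
        simp only [integral_const, probReal_univ, one_smul]
        ring
    _ ≤ N⁻¹ * (√(N * (κ * T ^ (1 - α))) + N * (2 * (κ * T ^ (-α)))) := by
        refine mul_le_mul_of_nonneg_left (add_le_add hDs ?_) (inv_pos.2 hNpos).le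
        have := Finset.sum_le_sum fun j hj => mul_le_mul_of_nonneg_left (hRb j hj) zero_le_two
        simpa using this
    _ = 2 * (κ * T ^ (-α)) + √(κ * T ^ (1 - α) / N) := by
        rw [mul_add, inv_mul_cancel_left₀ hNpos.ne', add_comm]
        congr 1
        rw [← Real.sqrt_sq (inv_pos.2 hNpos).le, ← Real.sqrt_mul (by positivity)]
        congr 1
        field_simp

end RealAverage

/-! ### Moments of the law and of its truncation -/

section Moments

theorem integrable_and_integral_le_of_lintegral_le {Ω : Type*} [MeasurableSpace Ω] {P : Measure Ω}
    {f : Ω → ℝ} (hf : Measurable f) (h0 : ∀ ω, 0 ≤ f ω) {c : ℝ} (hc : 0 ≤ c)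
    (h : ∫⁻ ω, ENNReal.ofReal (f ω) ∂P ≤ ENNReal.ofReal c) :
    Integrable f P ∧ ∫ ω, f ω ∂P ≤ c := by
  have hi : Integrable f P :=
    (lintegral_ofReal_ne_top_iff_integrable hf.aestronglyMeasurable
      (Filter.Eventually.of_forall h0)).1 (ne_top_of_le_ne_top ENNReal.ofReal_ne_top h)
  refine ⟨hi, ?_⟩
  rw [← ofReal_integral_eq_lintegral_ofReal hi (Filter.Eventually.of_forall h0)] at h
  exact (ENNReal.ofReal_le_ofReal_iff hc).1 h

variable {d : ℕ} {α : ℝ} {ν : Measure (EuclideanSpace ℝ (Fin d))} {m : EuclideanSpace ℝ (Fin d)}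

theorem WeakMoment.integrable_and_integral_le (hα : 0 < α) (h : WeakMoment α ν m)
    {v : EuclideanSpace ℝ (Fin d)} (hv : ‖v‖ ≤ 1) :
    Integrable (fun x => |inner ℝ v (x - m)| ^ (1 + α)) ν ∧
      ∫ x, |inner ℝ v (x - m)| ^ (1 + α) ∂ν ≤ 1 := by
  refine integrable_and_integral_le_of_lintegral_le (by fun_prop)
    (fun x => Real.rpow_nonneg (abs_nonneg _) _) zero_le_one ?_
  rw [ENNReal.ofReal_one]
  rcases eq_or_ne v 0 with rfl | hv0
  · simp [Real.zero_rpow (by linarith : 1 + α ≠ 0)]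
  refine le_trans (lintegral_mono fun x => ENNReal.ofReal_le_ofReal ?_)
    (h _ (norm_inv_norm_smul hv0))
  refine Real.rpow_le_rpow (abs_nonneg _) ?_ (by linarith)
  rw [real_inner_smul_right, real_inner_comm, abs_mul, abs_inv, abs_norm]
  exact le_mul_of_one_le_left (abs_nonneg _) (one_le_inv₀ (norm_pos_iff.2 hv0) |>.2 hv)

theorem WeakMoment.integrable_and_integral_norm_le [SFinite ν] (hα : 0 < α) (hα1 : α ≤ 1)
    (h : WeakMoment α ν m) :
    Integrable (fun x => ‖x - m‖ ^ (1 + α)) ν ∧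
      ∫ x, ‖x - m‖ ^ (1 + α) ∂ν ≤ (1.26 * √d) ^ (1 + α) := by
  have e : ∀ (F : Type) [NormedAddCommGroup F] (y : F),
      ENNReal.ofReal (‖y‖ ^ (1 + α)) = ‖y‖ₑ ^ (1 + α) := fun F _ y => by
    rw [← ofReal_norm, ENNReal.ofReal_rpow_of_nonneg (norm_nonneg _) (by linarith)]
  refine integrable_and_integral_le_of_lintegral_le (by fun_prop)
    (fun x => Real.rpow_nonneg (norm_nonneg _) _) (by positivity) ?_
  simp only [e]
  refine (lintegral_enorm_rpow_le (by linarith) (by linarith) m fun v hv => ?_).trans (le_of_eq ?_)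
  · refine le_trans (le_of_eq ?_) (h v hv)
    simp only [← Real.norm_eq_abs, e]
  · congr 1
    rw [Real.mul_rpow (by norm_num) (Real.sqrt_nonneg _), Real.sqrt_eq_rpow, ← Real.rpow_mul
      (by positivity)]
    congr 2
    ring

end Moments

/-! ### Consequences of the choice of the pruning radius -/

section PruneRadius

variable {n d : ℕ} {α : ℝ}

theorem le_pruneRadius : 100 * √d ≤ pruneRadius n d α := le_max_right _ _

theorem pruneRadius_pos (hd : 0 < d) : 0 < pruneRadius n d α := by
  have : (0 : ℝ) < d := by exact_mod_cast hd
  exact lt_of_lt_of_le (by positivity) le_pruneRadius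

/-- As τ ≥ 100 √d, the error 24 √d of the initial estimate is at most 0.24 τ. Hence the factors 0.76
here and 1.24 for kept points. -/
theorem norm_sub_mean_gt {m x₀ x : EuclideanSpace ℝ (Fin d)} (hx₀ : ‖x₀ - m‖ ≤ 24 * √d)
    (hx : pruneRadius n d α < ‖x - x₀‖) : 0.76 * pruneRadius n d α ≤ ‖x - m‖ := by
  have h1 : ‖x - x₀‖ ≤ ‖x - m‖ + ‖x₀ - m‖ := by
    have := norm_sub_le (x - m) (x₀ - m)
    rwa [sub_sub_sub_cancel_right] at this
  have h2 : 100 * √d ≤ pruneRadius n d α := le_pruneRadius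
  linarith

theorem norm_sub_mean_le {m x₀ x : EuclideanSpace ℝ (Fin d)} (hx₀ : ‖x₀ - m‖ ≤ 24 * √d)
    (hx : ‖x - x₀‖ ≤ pruneRadius n d α) : ‖x - m‖ ≤ 1.24 * pruneRadius n d α := by
  have h1 : ‖x - m‖ ≤ ‖x - x₀‖ + ‖x₀ - m‖ := norm_sub_le_norm_sub_add_norm_sub x x₀ m
  have h2 : 100 * √d ≤ pruneRadius n d α := le_pruneRadius
  linarith

/-- The ratio of the typical norm to the pruning radius is small. -/
theorem ratio_rpow_le_const (hd : 0 < d) (hα : 0 < α) :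
    (1.26 * √d / (0.76 * pruneRadius n d α)) ^ (1 + α) ≤ 1 / 60 := by
  have hτ : 0 < pruneRadius n d α := pruneRadius_pos hd
  have h1 : 1.26 * √d / (0.76 * pruneRadius n d α) ≤ 1 / 60 := by
    rw [div_le_iff₀ (by positivity)]
    have h2 : 100 * √d ≤ pruneRadius n d α := le_pruneRadius
    linarith [Real.sqrt_nonneg (d : ℝ)]
  have h0 : 0 ≤ 1.26 * √d / (0.76 * pruneRadius n d α) := by positivity
  refine (Real.rpow_le_rpow_of_exponent_ge' h0 (h1.trans (by norm_num)) zero_le_one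
    (by linarith)).trans ?_
  rwa [Real.rpow_one]

/-- If t denotes the first term of the maximum in τ without its factor 100, the exponents in t are
such that (√d / t)^(1+α) equals d / n exactly. -/
theorem ratio_rpow_le_div (hn : 0 < n) (hd : 0 < d) (hα : 0 < α) :
    (1.26 * √d / (0.76 * pruneRadius n d α)) ^ (1 + α) ≤ (d : ℝ) / n := by
  have hd' : (0 : ℝ) < d := by exact_mod_cast hd
  have hn' : (0 : ℝ) < n := by exact_mod_cast hn
  have hα' : 0 < 1 + α := by linarith
  set t := (n : ℝ) ^ (1 / (1 + α)) * (d : ℝ) ^ (-((1 - α) / (2 * (1 + α)))) with ht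
  have htpos : 0 < t := by positivity
  have hτ : 100 * t ≤ pruneRadius n d α := by
    rw [ht, ← mul_assoc]
    exact le_max_left _ _
  have h1 : 1.26 * √d / (0.76 * pruneRadius n d α) ≤ √d / t := by
    rw [div_le_div_iff₀ (by linarith) htpos]
    nlinarith [Real.sqrt_nonneg (d : ℝ), mul_le_mul_of_nonneg_left hτ (Real.sqrt_nonneg (d : ℝ)),
      mul_nonneg (Real.sqrt_nonneg (d : ℝ)) htpos.le]
  have h0 : 0 ≤ 1.26 * √d / (0.76 * pruneRadius n d α) := by
    have := pruneRadius_pos (n := n) (α := α) hd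
    positivity
  refine (Real.rpow_le_rpow h0 h1 hα'.le).trans (le_of_eq ?_)
  rw [Real.div_rpow (Real.sqrt_nonneg _) htpos.le, ht, Real.mul_rpow (by positivity)
    (by positivity), ← Real.rpow_mul hn'.le, ← Real.rpow_mul hd'.le, Real.sqrt_eq_rpow,
    ← Real.rpow_mul hd'.le, one_div_mul_cancel hα'.ne', Real.rpow_one, div_mul_eq_div_div_swap,
    ← Real.rpow_sub hd']
  congr 1
  rw [show 1 / 2 * (1 + α) - -((1 - α) / (2 * (1 + α))) * (1 + α) = 1 by field_simp; ring,
    Real.rpow_one]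

/-- The product that controls the second moment of the truncated law. -/
theorem pruneRadius_rpow_mul_le (hd : 0 < d) (hα : 0 < α) :
    (1.24 * pruneRadius n d α) ^ (1 - α) * (1.26 * √d) ^ (1 + α)
      ≤ 156.24 * max ((n : ℝ) ^ ((1 - α) / (1 + α)) * (d : ℝ) ^ (2 * α / (1 + α))) (d : ℝ) := by
  have hd' : (0 : ℝ) < d := by exact_mod_cast hd
  have hα' : 0 < 1 + α := by linarith
  set t := (n : ℝ) ^ (1 / (1 + α)) * (d : ℝ) ^ (-((1 - α) / (2 * (1 + α)))) with ht
  have ht0 : 0 ≤ t := by positivity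
  have hτ : pruneRadius n d α = 100 * max t (√d) := by
    rw [pruneRadius, mul_max_of_nonneg _ _ (by norm_num), ht, mul_assoc]
  have hmax0 : 0 ≤ max t (√d) := le_max_of_le_left ht0
  have e1 : t ^ (1 - α) * √d ^ (1 + α)
      = (n : ℝ) ^ ((1 - α) / (1 + α)) * (d : ℝ) ^ (2 * α / (1 + α)) := by
    rw [ht, Real.mul_rpow (by positivity) (by positivity), ← Real.rpow_mul (by positivity),
      ← Real.rpow_mul hd'.le, Real.sqrt_eq_rpow, ← Real.rpow_mul hd'.le, mul_assoc,
      ← Real.rpow_add hd']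
    congr 2
    · ring
    · field_simp
      ring
  have e2 : √d ^ (1 - α) * √d ^ (1 + α) = d := by
    rw [← Real.rpow_add (Real.sqrt_pos.2 hd'), show 1 - α + (1 + α) = (2 : ℕ) by push_cast; ring,
      Real.rpow_natCast, Real.sq_sqrt hd'.le]
  -- Whichever term wins in τ produces the corresponding term of the maximum on the right.
  have hmain : max t (√d) ^ (1 - α) * √d ^ (1 + α)
      ≤ max ((n : ℝ) ^ ((1 - α) / (1 + α)) * (d : ℝ) ^ (2 * α / (1 + α))) (d : ℝ) := by
    rcases le_total t (√d) with h | h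
    · rw [max_eq_right h, e2]
      exact le_max_right _ _
    · rw [max_eq_left h, e1]
      exact le_max_left _ _
  -- Here 124 = 1.24 · 100, and the product is 124 · 1.26 = 156.24 times (1.26/124)^α ≤ 1.
  have hconst : (124 : ℝ) ^ (1 - α) * 1.26 ^ (1 + α) ≤ 156.24 := by
    have h1 : (124 : ℝ) ^ (1 - α) * 1.26 ^ (1 + α) = 124 * 1.26 * (1.26 / 124) ^ α := by
      rw [Real.rpow_sub (by norm_num), Real.rpow_add (by norm_num),
        Real.div_rpow (by norm_num) (by norm_num), Real.rpow_one, Real.rpow_one]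
      ring
    rw [h1]
    have h2 : (1.26 / 124 : ℝ) ^ α ≤ 1 := Real.rpow_le_one (by norm_num) (by norm_num) hα.le
    linarith
  calc (1.24 * pruneRadius n d α) ^ (1 - α) * (1.26 * √d) ^ (1 + α)
      = ((124 : ℝ) ^ (1 - α) * 1.26 ^ (1 + α)) * (max t (√d) ^ (1 - α) * √d ^ (1 + α)) := by
        rw [hτ, ← mul_assoc, Real.mul_rpow (by norm_num) hmax0,
          Real.mul_rpow (by norm_num) (Real.sqrt_nonneg _)]
        norm_num
        ring
    _ ≤ _ := mul_le_mul hconst hmain (by positivity) (by norm_num)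

end PruneRadius

/-! ### The law conditioned on surviving the pruning -/

section Conditioned

/-- The set of points that survive the pruning. -/
def keepSet (n : ℕ) {d : ℕ} (α : ℝ) (x₀ : EuclideanSpace ℝ (Fin d)) :
    Set (EuclideanSpace ℝ (Fin d)) := {x | ‖x - x₀‖ ≤ pruneRadius n d α}

theorem measurableSet_keepSet (n : ℕ) {d : ℕ} (α : ℝ) (x₀ : EuclideanSpace ℝ (Fin d)) :
    MeasurableSet (keepSet n α x₀) :=
  measurableSet_le (by fun_prop) measurable_const

theorem integral_cond {Ω F : Type*} [MeasurableSpace Ω] [NormedAddCommGroup F] [NormedSpace ℝ F]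
    (P : Measure Ω) (s : Set Ω) (f : Ω → F) :
    ∫ ω, f ω ∂P[|s] = (P.real s)⁻¹ • ∫ ω in s, f ω ∂P := by
  rw [ProbabilityTheory.cond, integral_smul_measure, ENNReal.toReal_inv]
  rfl

theorem integrable_cond {Ω F : Type*} [MeasurableSpace Ω] [NormedAddCommGroup F]
    {P : Measure Ω} {s : Set Ω} {f : Ω → F} (hs : P s ≠ 0) (hf : IntegrableOn f s P) :
    Integrable f P[|s] :=
  Integrable.smul_measure hf (ENNReal.inv_ne_top.2 hs)

variable {n d : ℕ} {α : ℝ} {ν : Measure (EuclideanSpace ℝ (Fin d))} [IsProbabilityMeasure ν]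
  {m x₀ : EuclideanSpace ℝ (Fin d)}

/-- A discarded point lies at distance at least 0.76 τ from the mean, so Markov's inequality for the
(1+α)-th moment of the norm applies. -/
theorem measureReal_compl_keepSet_le_ratio (hd : 0 < d) (hα : 0 < α) (hα1 : α ≤ 1)
    (hmom : WeakMoment α ν m) (hx₀ : ‖x₀ - m‖ ≤ 24 * √d) :
    ν.real (keepSet n α x₀)ᶜ ≤ (1.26 * √d / (0.76 * pruneRadius n d α)) ^ (1 + α) := by
  have hτ : 0 < pruneRadius n d α := pruneRadius_pos hd
  obtain ⟨hi, hle⟩ := hmom.integrable_and_integral_norm_le hα hα1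
  have h1 := mul_meas_ge_le_integral_of_nonneg (Filter.Eventually.of_forall fun x =>
    Real.rpow_nonneg (norm_nonneg (x - m)) (1 + α)) hi ((0.76 * pruneRadius n d α) ^ (1 + α))
  have h2 : ν.real (keepSet n α x₀)ᶜ
      ≤ ν.real {x | (0.76 * pruneRadius n d α) ^ (1 + α) ≤ ‖x - m‖ ^ (1 + α)} := by
    refine measureReal_mono fun x hx => ?_
    have hx' : pruneRadius n d α < ‖x - x₀‖ := not_le.1 hx
    exact Real.rpow_le_rpow (by positivity) (norm_sub_mean_gt hx₀ hx') (by linarith)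
  rw [Real.div_rpow (by positivity) (by positivity), le_div_iff₀ (by positivity), mul_comm]
  exact (mul_le_mul_of_nonneg_left h2 (by positivity)).trans (h1.trans hle)

theorem measureReal_compl_keepSet_le (hd : 0 < d) (hα : 0 < α) (hα1 : α ≤ 1)
    (hmom : WeakMoment α ν m) (hx₀ : ‖x₀ - m‖ ≤ 24 * √d) :
    ν.real (keepSet n α x₀)ᶜ ≤ 1 / 60 :=
  (measureReal_compl_keepSet_le_ratio hd hα hα1 hmom hx₀).trans (ratio_rpow_le_const hd hα)

theorem le_measureReal_keepSet (hd : 0 < d) (hα : 0 < α) (hα1 : α ≤ 1)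
    (hmom : WeakMoment α ν m) (hx₀ : ‖x₀ - m‖ ≤ 24 * √d) :
    59 / 60 ≤ ν.real (keepSet n α x₀) := by
  have h1 := measureReal_compl_keepSet_le (n := n) hd hα hα1 hmom hx₀
  have h2 := probReal_compl_eq_one_sub (μ := ν) (measurableSet_keepSet n α x₀)
  linarith

theorem measure_keepSet_ne_zero (hd : 0 < d) (hα : 0 < α) (hα1 : α ≤ 1)
    (hmom : WeakMoment α ν m) (hx₀ : ‖x₀ - m‖ ≤ 24 * √d) : ν (keepSet n α x₀) ≠ 0 := by
  intro h
  have := le_measureReal_keepSet (n := n) hd hα hα1 hmom hx₀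
  rw [measureReal_def, h] at this
  norm_num at this

theorem inv_measureReal_keepSet_le (hd : 0 < d) (hα : 0 < α) (hα1 : α ≤ 1)
    (hmom : WeakMoment α ν m) (hx₀ : ‖x₀ - m‖ ≤ 24 * √d) :
    (ν.real (keepSet n α x₀))⁻¹ ≤ 60 / 59 := by
  have h := le_measureReal_keepSet (n := n) hd hα hα1 hmom hx₀
  rw [inv_le_comm₀ (by linarith) (by norm_num)]
  norm_num
  linarith

/-- The weak moment of the conditioned law. -/
theorem integral_cond_weakMoment (hd : 0 < d) (hα : 0 < α) (hα1 : α ≤ 1)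
    (hmom : WeakMoment α ν m) (hx₀ : ‖x₀ - m‖ ≤ 24 * √d) {v : EuclideanSpace ℝ (Fin d)}
    (hv : ‖v‖ ≤ 1) :
    Integrable (fun x => |inner ℝ v (x - m)| ^ (1 + α)) ν[|keepSet n α x₀] ∧
      ∫ x, |inner ℝ v (x - m)| ^ (1 + α) ∂ν[|keepSet n α x₀] ≤ 2 := by
  obtain ⟨hi, hle⟩ := hmom.integrable_and_integral_le hα hv
  refine ⟨integrable_cond (measure_keepSet_ne_zero hd hα hα1 hmom hx₀) hi.integrableOn, ?_⟩
  rw [integral_cond, smul_eq_mul]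
  have h1 : ∫ x in keepSet n α x₀, |inner ℝ v (x - m)| ^ (1 + α) ∂ν ≤ 1 :=
    (setIntegral_le_integral hi (Filter.Eventually.of_forall fun x =>
      Real.rpow_nonneg (abs_nonneg _) _)).trans hle
  have h2 := inv_measureReal_keepSet_le (n := n) hd hα hα1 hmom hx₀
  calc (ν.real (keepSet n α x₀))⁻¹ * ∫ x in keepSet n α x₀, |inner ℝ v (x - m)| ^ (1 + α) ∂ν
      ≤ (60 / 59) * 1 := mul_le_mul h2 h1 (integral_nonneg fun x =>
        Real.rpow_nonneg (abs_nonneg _) _) (by norm_num)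
    _ ≤ 2 := by norm_num

theorem ae_cond_norm_sub_le (hx₀ : ‖x₀ - m‖ ≤ 24 * √d) :
    ∀ᵐ x ∂ν[|keepSet n α x₀], ‖x - m‖ ≤ 1.24 * pruneRadius n d α := by
  filter_upwards [ae_cond_mem (μ := ν) (measurableSet_keepSet n α x₀)] with x hx
  exact norm_sub_mean_le hx₀ hx

/-- Kept points are bounded. The centre is arbitrary because later moments are taken about the
original mean and about the conditioned one. -/
theorem memLp_cond (hd : 0 < d) (hα : 0 < α) (hα1 : α ≤ 1)
    (hmom : WeakMoment α ν m) (hx₀ : ‖x₀ - m‖ ≤ 24 * √d) (c : EuclideanSpace ℝ (Fin d)) :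
    MemLp (fun x => x - c) 2 ν[|keepSet n α x₀] := by
  have : IsProbabilityMeasure ν[|keepSet n α x₀] :=
    cond_isProbabilityMeasure (measure_keepSet_ne_zero hd hα hα1 hmom hx₀)
  have h : MemLp (fun x => x - m) 2 ν[|keepSet n α x₀] :=
    MemLp.of_bound (by fun_prop) _ (ae_cond_norm_sub_le hx₀)
  have h2 := h.add (memLp_const (m - c))
  refine h2.congr_norm (by fun_prop) (Filter.Eventually.of_forall fun x => ?_)
  simp

/-- The second moment of the conditioned law. -/
theorem integral_cond_norm_sq_le (hd : 0 < d) (hα : 0 < α) (hα1 : α ≤ 1)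
    (hmom : WeakMoment α ν m) (hx₀ : ‖x₀ - m‖ ≤ 24 * √d) :
    ∫ x, ‖x - m‖ ^ 2 ∂ν[|keepSet n α x₀]
      ≤ 160 * max ((n : ℝ) ^ ((1 - α) / (1 + α)) * (d : ℝ) ^ (2 * α / (1 + α))) (d : ℝ) := by
  set M := max ((n : ℝ) ^ ((1 - α) / (1 + α)) * (d : ℝ) ^ (2 * α / (1 + α))) (d : ℝ) with hM
  have hM0 : 0 ≤ M := le_max_of_le_right (by positivity)
  set τ := pruneRadius n d α with hτ_def
  have hτ : 0 < τ := pruneRadius_pos hd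
  obtain ⟨hi, hle⟩ := hmom.integrable_and_integral_norm_le hα hα1
  have hne := measure_keepSet_ne_zero (n := n) hd hα hα1 hmom hx₀
  have hic := integrable_cond hne hi.integrableOn
  have h1 : ∫ x, ‖x - m‖ ^ (1 + α) ∂ν[|keepSet n α x₀] ≤ 60 / 59 * (1.26 * √d) ^ (1 + α) := by
    rw [integral_cond, smul_eq_mul]
    exact mul_le_mul (inv_measureReal_keepSet_le hd hα hα1 hmom hx₀)
      ((setIntegral_le_integral hi (Filter.Eventually.of_forall fun x =>
        Real.rpow_nonneg (norm_nonneg _) _)).trans hle)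
      (integral_nonneg fun x => Real.rpow_nonneg (norm_nonneg _) _) (by norm_num)
  -- The bound ‖x - m‖ ≤ 1.24 τ trades 1 - α powers of the norm for powers of τ, leaving the finite
  -- (1+α)-th moment.
  calc ∫ x, ‖x - m‖ ^ 2 ∂ν[|keepSet n α x₀]
      ≤ ∫ x, (1.24 * τ) ^ (1 - α) * ‖x - m‖ ^ (1 + α) ∂ν[|keepSet n α x₀] := by
        refine integral_mono_ae ((memLp_cond hd hα hα1 hmom hx₀ m).integrable_norm_pow two_ne_zero)
          (hic.const_mul _) ?_
        filter_upwards [ae_cond_norm_sub_le (ν := ν) (α := α) (n := n) hx₀] with x hx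
        rcases eq_or_lt_of_le (norm_nonneg (x - m)) with h | h
        · rw [← h, Real.zero_rpow (by linarith)]
          simp
        · have e : ‖x - m‖ ^ 2 = ‖x - m‖ ^ (1 - α) * ‖x - m‖ ^ (1 + α) := by
            rw [← Real.rpow_add h, ← Real.rpow_natCast]
            congr 1
            push_cast
            ring
          rw [e]
          exact mul_le_mul_of_nonneg_right (Real.rpow_le_rpow h.le hx (by linarith))
            (by positivity)
    _ ≤ (1.24 * τ) ^ (1 - α) * (60 / 59 * (1.26 * √d) ^ (1 + α)) := by
        rw [integral_const_mul]
        exact mul_le_mul_of_nonneg_left h1 (by positivity)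
    _ = 60 / 59 * ((1.24 * τ) ^ (1 - α) * (1.26 * √d) ^ (1 + α)) := by ring
    _ ≤ 60 / 59 * (156.24 * M) :=
        mul_le_mul_of_nonneg_left (pruneRadius_rpow_mul_le hd hα) (by norm_num)
    _ ≤ 160 * M := by nlinarith

theorem integral_inner_sub_const {P : Measure (EuclideanSpace ℝ (Fin d))}
    [IsProbabilityMeasure P] (hi : Integrable (fun x => x) P) (v c : EuclideanSpace ℝ (Fin d)) :
    ∫ x, (inner ℝ v (x - c) : ℝ) ∂P = inner ℝ v (∫ x, x ∂P - c) := by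
  have h : Integrable (fun x => x - c) P := hi.sub (integrable_const c)
  rw [integral_inner h, integral_sub hi (integrable_const c)]
  simp

/-- The mean minimizes the second moment: the difference of the two sides is ‖c - m‖² with c the
mean. -/
theorem integral_norm_sub_integral_sq_le {P : Measure (EuclideanSpace ℝ (Fin d))}
    [IsProbabilityMeasure P] (h : MemLp (fun x => x - m) 2 P) :
    ∫ x, ‖x - ∫ y, y ∂P‖ ^ 2 ∂P ≤ ∫ x, ‖x - m‖ ^ 2 ∂P := by
  set c := ∫ y, y ∂P with hc
  have hi : Integrable (fun x => x - m) P := h.integrable one_le_two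
  have hid : Integrable (fun x : EuclideanSpace ℝ (Fin d) => x) P := by
    have := hi.add (integrable_const m)
    refine this.congr (Filter.Eventually.of_forall fun x => ?_)
    simp
  have e : ∀ x, ‖x - c‖ ^ 2 = ‖x - m‖ ^ 2 - 2 * inner ℝ (c - m) (x - m) + ‖c - m‖ ^ 2 := by
    intro x
    rw [← sub_sub_sub_cancel_right x c m, norm_sub_sq_real, real_inner_comm]
  have hin : ∫ x, (inner ℝ (c - m) (x - m) : ℝ) ∂P = ‖c - m‖ ^ 2 := by
    rw [integral_inner_sub_const hid, ← hc, real_inner_self_eq_norm_sq]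
  have hsq := h.integrable_norm_pow two_ne_zero
  have hin' : Integrable (fun x => 2 * (inner ℝ (c - m) (x - m) : ℝ)) P :=
    (hi.const_inner (c - m)).const_mul 2
  have hd' : Integrable (fun x => ‖x - m‖ ^ 2 - 2 * (inner ℝ (c - m) (x - m) : ℝ)) P :=
    hsq.sub hin'
  simp only [e]
  rw [integral_add hd' (integrable_const _), integral_sub hsq hin', integral_const_mul, hin]
  simp only [integral_const, probReal_univ, one_smul]
  nlinarith [sq_nonneg ‖c - m‖]

/-- Hölder's inequality for the integral over a small set. -/
theorem setIntegral_abs_inner_le (hα : 0 < α) (hmom : WeakMoment α ν m)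
    {v : EuclideanSpace ℝ (Fin d)} (hv : ‖v‖ ≤ 1) (s : Set (EuclideanSpace ℝ (Fin d))) :
    ∫ x in s, |inner ℝ v (x - m)| ∂ν ≤ ν.real s ^ (α / (1 + α)) := by
  have hα' : 0 < 1 + α := by linarith
  obtain ⟨hip, hle⟩ := hmom.integrable_and_integral_le hα hv
  have hpq : (1 + α).HolderConjugate ((1 + α) / α) :=
    (Real.holderConjugate_iff).2 ⟨by linarith, by field_simp⟩
  have hmem : MemLp (fun x => |inner ℝ v (x - m)|) (ENNReal.ofReal (1 + α)) (ν.restrict s) := by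
    refine (integrable_norm_rpow_iff (by fun_prop) (by simpa using hα')
      ENNReal.ofReal_ne_top).1 ?_
    rw [ENNReal.toReal_ofReal hα'.le]
    simpa using hip.restrict
  have h := integral_mul_le_Lp_mul_Lq_of_nonneg (μ := ν.restrict s) hpq
    (Filter.Eventually.of_forall fun x => abs_nonneg (inner ℝ v (x - m)))
    (Filter.Eventually.of_forall fun _ => zero_le_one) hmem (memLp_const 1)
  simp only [mul_one, Real.one_rpow, integral_const, smul_eq_mul, measureReal_restrict_apply_univ]
    at h
  have e : 1 / ((1 + α) / α) = α / (1 + α) := by rw [one_div_div]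
  rw [e] at h
  refine h.trans (mul_le_of_le_one_left (by positivity) (Real.rpow_le_one
    (integral_nonneg fun x => by positivity) ?_ (by positivity)))
  exact (setIntegral_le_integral hip (Filter.Eventually.of_forall fun x =>
    Real.rpow_nonneg (abs_nonneg _) _)).trans hle

/-- The mean of the conditioned law is close to the mean of the law. -/
theorem norm_integral_cond_sub_le (hn : 0 < n) (hd : 0 < d) (hα : 0 < α) (hα1 : α ≤ 1)
    (hint : Integrable (fun x => x) ν) (hmean : ∫ x, x ∂ν = m)
    (hmom : WeakMoment α ν m) (hx₀ : ‖x₀ - m‖ ≤ 24 * √d) :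
    ‖∫ x, x ∂ν[|keepSet n α x₀] - m‖ ≤ 2 * ((d : ℝ) / n) ^ (α / (1 + α)) := by
  set B := keepSet n α x₀ with hB
  have hBm : MeasurableSet B := measurableSet_keepSet n α x₀
  have hne := measure_keepSet_ne_zero (n := n) hd hα hα1 hmom hx₀
  have hprob : IsProbabilityMeasure ν[|B] := cond_isProbabilityMeasure hne
  have hintc : Integrable (fun x => x) ν[|B] := integrable_cond hne hint.integrableOn
  set w := ∫ x, x ∂ν[|B] - m with hw
  rcases eq_or_ne w 0 with h0 | h0
  · rw [h0, norm_zero]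
    positivity
  set v := ‖w‖⁻¹ • w with hv
  have hv1 : ‖v‖ ≤ 1 := (norm_inv_norm_smul h0).le
  have hi : Integrable (fun x => (inner ℝ v (x - m) : ℝ)) ν :=
    (hint.sub (integrable_const m)).const_inner v
  have h1 : ‖w‖ = ∫ x, (inner ℝ v (x - m) : ℝ) ∂ν[|B] := by
    rw [integral_inner_sub_const hintc, ← hw, hv, real_inner_smul_left, real_inner_self_eq_norm_sq]
    have := norm_ne_zero_iff.2 h0
    field_simp
  -- The full integral vanishes, so the bias is carried by the rare complement, where Hölder's
  -- inequality is effective.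
  have h2 : ∫ x in B, (inner ℝ v (x - m) : ℝ) ∂ν = - ∫ x in Bᶜ, (inner ℝ v (x - m) : ℝ) ∂ν := by
    have h := integral_add_compl hBm hi
    have h' : ∫ x, (inner ℝ v (x - m) : ℝ) ∂ν = 0 := by
      rw [integral_inner_sub_const hint, hmean, sub_self, inner_zero_right]
    rw [h'] at h
    linarith
  have h3 : ν.real Bᶜ ≤ (d : ℝ) / n :=
    (measureReal_compl_keepSet_le_ratio hd hα hα1 hmom hx₀).trans (ratio_rpow_le_div hn hd hα)
  have h4 : |∫ x in Bᶜ, (inner ℝ v (x - m) : ℝ) ∂ν| ≤ ((d : ℝ) / n) ^ (α / (1 + α)) :=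
    (abs_integral_le_integral_abs).trans ((setIntegral_abs_inner_le hα hmom hv1 _).trans
      (Real.rpow_le_rpow measureReal_nonneg h3 (by positivity)))
  rw [h1, integral_cond, smul_eq_mul, h2]
  refine mul_le_mul ((inv_measureReal_keepSet_le hd hα hα1 hmom hx₀).trans (by norm_num))
    ((neg_le_abs _).trans h4) ?_ zero_le_two
  -- Multiplying the two bounds requires the second factor to be nonnegative. It is, because the
  -- product equals ‖w‖ and the first factor is positive.
  have h5 : 0 ≤ (ν.real B)⁻¹ * -∫ x in Bᶜ, (inner ℝ v (x - m) : ℝ) ∂ν := by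
    rw [← h2, ← smul_eq_mul, ← integral_cond, ← h1]
    exact norm_nonneg _
  have h6 : 0 < (ν.real B)⁻¹ :=
    inv_pos.2 (lt_of_lt_of_le (by norm_num) (le_measureReal_keepSet hd hα hα1 hmom hx₀))
  exact nonneg_of_mul_nonneg_right h5 h6

end Conditioned

/-! ### Buckets -/

section Buckets

variable {n : ℕ}

theorem position_lt_of_lt {S : Finset (Fin n)} {i j : Fin n} (hi : i ∈ S) (hij : i < j) :
    position S i < position S j := by
  refine Finset.card_lt_card (Finset.ssubset_iff_of_subset ?_ |>.2 ⟨i, ?_, ?_⟩)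
  · intro l hl
    rw [Finset.mem_filter] at hl ⊢
    exact ⟨hl.1, hl.2.trans hij⟩
  · exact Finset.mem_filter.2 ⟨hi, hij⟩
  · simp

theorem injOn_position (S : Finset (Fin n)) : Set.InjOn (position S) S := by
  intro i hi j hj h
  rcases lt_trichotomy i j with hlt | heq | hlt
  · exact absurd h (position_lt_of_lt hi hlt).ne
  · exact heq
  · exact absurd h (position_lt_of_lt hj hlt).ne'

theorem position_lt_card {S : Finset (Fin n)} {j : Fin n} (hj : j ∈ S) :
    position S j < S.card :=
  Finset.card_lt_card (Finset.ssubset_iff_of_subset (Finset.filter_subset _ _) |>.2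
    ⟨j, hj, by simp⟩)

theorem image_position (S : Finset (Fin n)) : S.image (position S) = Finset.range S.card := by
  refine Finset.eq_of_subset_of_card_le (fun l hl => ?_) ?_
  · obtain ⟨j, hj, rfl⟩ := Finset.mem_image.1 hl
    exact Finset.mem_range.2 (position_lt_card hj)
  · rw [Finset.card_range, Finset.card_image_of_injOn (injOn_position S)]

theorem bucket_subset (S : Finset (Fin n)) (k : ℕ) (i : Fin k) : bucket S k i ⊆ S :=
  Finset.filter_subset _ _

/-- `position` is a bijection from S onto the range of |S|, and (i + 1) q ≤ k q ≤ |S| for q = |S| /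
k, so no bucket is cut short. If k > |S| then q = 0 and all buckets are empty. -/
theorem card_bucket (S : Finset (Fin n)) {k : ℕ} (i : Fin k) :
    (bucket S k i).card = S.card / k := by
  set q := S.card / k with hq
  have himg : (bucket S k i).image (position S)
      = Finset.Ico ((i : ℕ) * q) (((i : ℕ) + 1) * q) := by
    ext l
    simp only [Finset.mem_image, bucket, Finset.mem_filter, Finset.mem_Ico]
    constructor
    · rintro ⟨j, ⟨_, h1, h2⟩, rfl⟩
      exact ⟨h1, h2⟩
    · rintro ⟨h1, h2⟩
      have hl : l ∈ S.image (position S) := by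
        rw [image_position, Finset.mem_range]
        calc l < ((i : ℕ) + 1) * q := h2
          _ ≤ k * q := Nat.mul_le_mul_right _ i.2
          _ ≤ S.card := Nat.mul_div_le _ _
      obtain ⟨j, hj, rfl⟩ := Finset.mem_image.1 hl
      exact ⟨j, ⟨hj, h1, h2⟩, rfl⟩
  rw [← Finset.card_image_of_injOn ((injOn_position S).mono (Finset.coe_subset.2
    (bucket_subset S k i))), himg, Nat.card_Ico, add_mul, one_mul, Nat.add_sub_cancel_left]

theorem eq_of_mem_bucket {S : Finset (Fin n)} {k : ℕ} {i i' : Fin k} {j : Fin n}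
    (h : j ∈ bucket S k i) (h' : j ∈ bucket S k i') : i = i' := by
  simp only [bucket, Finset.mem_filter] at h h'
  obtain ⟨_, h1, h2⟩ := h
  obtain ⟨_, h3, h4⟩ := h'
  have h5 : (i : ℕ) < i' + 1 := lt_of_mul_lt_mul_right (h1.trans_lt h4) (Nat.zero_le _)
  have h6 : (i' : ℕ) < i + 1 := lt_of_mul_lt_mul_right (h3.trans_lt h2) (Nat.zero_le _)
  exact Fin.ext (by omega)

end Buckets

/-! ### Functions of disjoint blocks of independent variables -/

section Blocks

variable {Ω ι G : Type*} [MeasurableSpace Ω] {P : Measure Ω} [IsProbabilityMeasure P]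
  [MeasurableSpace G]

/-- Independence is a product formula for the joint law, and currying turns a product over pairs
into a product of products. -/
theorem ProbabilityTheory.iIndepFun.curry {κ : ι → Type*} {X : ∀ i, κ i → Ω → G}
    (hX : ∀ i j, Measurable (X i j)) (h : iIndepFun (fun p : Σ i, κ i => X p.1 p.2) P) :
    iIndepFun (fun i ω (j : κ i) => X i j ω) P := by
  have : ∀ i j, IsProbabilityMeasure (P.map (X i j)) := fun i j =>
    Measure.isProbabilityMeasure_map (hX i j).aemeasurable
  have hsec : ∀ i, P.map (fun ω (j : κ i) => X i j ω) = Measure.infinitePi fun j => P.map (X i j) :=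
    fun i => (iIndepFun_iff_map_fun_eq_infinitePi_map (hX i)).1
      (h.precomp (g := Sigma.mk i) sigma_mk_injective)
  have hall := (iIndepFun_iff_map_fun_eq_infinitePi_map fun p : Σ i, κ i => hX p.1 p.2).1 h
  rw [iIndepFun_iff_map_fun_eq_infinitePi_map fun i => measurable_pi_lambda _ fun j => hX i j]
  simp only [hsec]
  have hc := Measure.infinitePi_map_piCurry (X := fun (i : ι) (_ : κ i) => G)
    (μ := fun i j => P.map (X i j))
  have hm := Measure.map_map (μ := P)
    (MeasurableEquiv.piCurry fun (i : ι) (_ : κ i) => G).measurable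
    (measurable_pi_lambda (fun ω (p : Σ i, κ i) => X p.1 p.2 ω) fun p => hX p.1 p.2)
  rw [← hc, ← hall]
  exact hm.symm

/-- Averages over disjoint blocks of independent random vectors are independent. -/
theorem ProbabilityTheory.iIndepFun.sum_blocks {E κ : Type*} [NormedAddCommGroup E]
    [NormedSpace ℝ E] [FiniteDimensional ℝ E] [MeasurableSpace E] [BorelSpace E] {Y : ι → Ω → E}
    (hY : ∀ j, Measurable (Y j)) (h : iIndepFun Y P) (b : κ → Finset ι)
    (hb : ∀ i i' j, j ∈ b i → j ∈ b i' → i = i') (a : κ → ℝ) (c : E) :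
    iIndepFun (fun i ω => a i • ∑ j ∈ b i, Y j ω - c) P := by
  have hinj : Function.Injective fun p : Σ i, b i => (p.2 : ι) := by
    rintro ⟨i, j, hj⟩ ⟨i', j', hj'⟩ heq
    obtain rfl : j = j' := heq
    obtain rfl := hb _ _ _ hj hj'
    rfl
  have h1 := (h.precomp hinj).curry (X := fun i (j : b i) => Y j) fun i j => hY j
  have h2 := h1.comp (fun i (y : b i → E) => a i • ∑ j, y j - c) fun i =>
    ((Finset.measurable_sum _ fun j _ => measurable_pi_apply j).const_smul (a i)).sub_const c
  refine h2.congr fun i => Filter.Eventually.of_forall fun ω => ?_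
  simp only [Function.comp_apply]
  rw [Finset.sum_coe_sort (b i) fun j => Y j ω]

end Blocks

/-! ### Moments of bucket means -/

section BlockMoments

variable {n d : ℕ} {Q : Fin n → Measure (EuclideanSpace ℝ (Fin d))}
  [∀ j, IsProbabilityMeasure (Q j)] {ρ : Measure (EuclideanSpace ℝ (Fin d))}
  [IsProbabilityMeasure ρ] {b : Finset (Fin n)} {m : EuclideanSpace ℝ (Fin d)}

/-- The mean over a block of coordinates, centred at `c`. -/
def blockMean (b : Finset (Fin n)) (c : EuclideanSpace ℝ (Fin d))
    (x : Fin n → EuclideanSpace ℝ (Fin d)) : EuclideanSpace ℝ (Fin d) :=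
  (b.card : ℝ)⁻¹ • ∑ j ∈ b, x j - c

theorem measurable_blockMean (b : Finset (Fin n)) (c : EuclideanSpace ℝ (Fin d)) :
    Measurable (blockMean b c) := by
  have h : Measurable fun x : Fin n → EuclideanSpace ℝ (Fin d) => ∑ j ∈ b, x j :=
    Finset.measurable_sum _ fun j _ => measurable_pi_apply j
  exact (h.const_smul (b.card : ℝ)⁻¹).sub_const c

theorem blockMean_eq (hb : b.Nonempty) (c : EuclideanSpace ℝ (Fin d))
    (x : Fin n → EuclideanSpace ℝ (Fin d)) :
    blockMean b c x = (b.card : ℝ)⁻¹ • ∑ j ∈ b, (x j - c) := by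
  have hN : (b.card : ℝ) ≠ 0 := by exact_mod_cast hb.card_pos.ne'
  rw [Finset.sum_sub_distrib, Finset.sum_const, smul_sub, ← Nat.cast_smul_eq_nsmul ℝ,
    inv_smul_smul₀ hN, blockMean]

theorem iIndepFun_eval (Q : Fin n → Measure (EuclideanSpace ℝ (Fin d)))
    [∀ j, IsProbabilityMeasure (Q j)] : iIndepFun (fun j x => x j) (Measure.pi Q) :=
  iIndepFun_pi (X := fun _ z => z) fun _ => aemeasurable_id

theorem memLp_eval_sub (hQ : ∀ j ∈ b, Q j = ρ) {c : EuclideanSpace ℝ (Fin d)}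
    (hρ : MemLp (fun x => x - c) 2 ρ) {j : Fin n} (hj : j ∈ b) :
    MemLp (fun x => x j - c) 2 (Measure.pi Q) := by
  rw [← hQ j hj] at hρ
  exact hρ.comp_measurePreserving (measurePreserving_eval Q j)

theorem memLp_blockMean (hb : b.Nonempty) (hQ : ∀ j ∈ b, Q j = ρ) {c : EuclideanSpace ℝ (Fin d)}
    (hρ : MemLp (fun x => x - c) 2 ρ) : MemLp (blockMean b c) 2 (Measure.pi Q) := by
  have h : MemLp (fun x => ∑ j ∈ b, (x j - c)) 2 (Measure.pi Q) :=
    memLp_finsetSum b fun j hj => memLp_eval_sub hQ hρ hj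
  have e : blockMean b c = fun x => (b.card : ℝ)⁻¹ • ∑ j ∈ b, (x j - c) :=
    funext (blockMean_eq hb c)
  rw [e]
  exact h.const_smul (b.card : ℝ)⁻¹

theorem integral_pi_eval_eq (hQ : ∀ j ∈ b, Q j = ρ) {j : Fin n} (hj : j ∈ b) {F : Type*}
    [NormedAddCommGroup F] [NormedSpace ℝ F] {f : EuclideanSpace ℝ (Fin d) → F}
    (hf : AEStronglyMeasurable f ρ) : ∫ x, f (x j) ∂Measure.pi Q = ∫ x, f x ∂ρ := by
  rw [← hQ j hj] at hf ⊢
  exact integral_comp_eval hf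

theorem integrable_of_memLp_sub {c : EuclideanSpace ℝ (Fin d)}
    (hρ : MemLp (fun x => x - c) 2 ρ) : Integrable (fun x => x) ρ := by
  refine ((hρ.integrable one_le_two).add (integrable_const c)).congr
    (Filter.Eventually.of_forall fun x => ?_)
  simp

theorem integral_sub_integral_eq_zero {c : EuclideanSpace ℝ (Fin d)}
    (hρ : MemLp (fun x => x - c) 2 ρ) : ∫ x, (x - ∫ y, y ∂ρ) ∂ρ = 0 := by
  rw [integral_sub (integrable_of_memLp_sub hρ) (integrable_const _)]
  simp

theorem integral_blockMean (hb : b.Nonempty) (hQ : ∀ j ∈ b, Q j = ρ)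
    (hρ : ∀ c, MemLp (fun x => x - c) 2 ρ) :
    ∫ x, blockMean b (∫ y, y ∂ρ) x ∂Measure.pi Q = 0 := by
  simp only [blockMean_eq hb]
  rw [integral_smul, integral_finsetSum _ fun j hj =>
    (memLp_eval_sub hQ (hρ _) hj).integrable one_le_two, Finset.sum_eq_zero, smul_zero]
  intro j hj
  rw [integral_pi_eval_eq hQ hj (f := fun x => x - ∫ y, y ∂ρ) (by fun_prop)]
  exact integral_sub_integral_eq_zero (hρ 0)

/-- Independence removes the cross terms, and each remaining variance is at most the second moment
about m. -/
theorem integral_norm_sq_blockMean_le (hb : b.Nonempty) (hQ : ∀ j ∈ b, Q j = ρ)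
    (hρ : ∀ c, MemLp (fun x => x - c) 2 ρ) {V : ℝ} (hV : ∫ x, ‖x - m‖ ^ 2 ∂ρ ≤ V) :
    ∫ x, ‖blockMean b (∫ y, y ∂ρ) x‖ ^ 2 ∂Measure.pi Q ≤ V / b.card := by
  set c := ∫ y, y ∂ρ with hc
  have hN : (0 : ℝ) < b.card := by exact_mod_cast hb.card_pos
  have hind : iIndepFun (fun (j : Fin n) (x : Fin n → EuclideanSpace ℝ (Fin d)) => x j - c)
      (Measure.pi Q) := (iIndepFun_eval Q).comp (fun _ y => y - c) fun _ => by fun_prop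
  have h0 : ∀ j ∈ b, ∫ x, (x j - c) ∂Measure.pi Q = 0 := fun j hj => by
    rw [integral_pi_eval_eq hQ hj (f := fun x => x - c) (by fun_prop)]
    exact integral_sub_integral_eq_zero (hρ 0)
  have h1 := integral_norm_sq_sum_of_iIndepFun hind b
    (fun j hj => memLp_eval_sub hQ (hρ c) hj) h0
  have h2 : ∀ j ∈ b, ∫ x, ‖x j - c‖ ^ 2 ∂Measure.pi Q ≤ V := fun j hj => by
    rw [integral_pi_eval_eq hQ hj (f := fun x => ‖x - c‖ ^ 2) (by fun_prop)]
    exact (integral_norm_sub_integral_sq_le (hρ m)).trans hV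
  have h3 := Finset.sum_le_sum h2
  simp only [Finset.sum_const, nsmul_eq_mul] at h3
  simp only [blockMean_eq hb, norm_smul, mul_pow, norm_inv, Real.norm_natCast]
  rw [integral_const_mul, h1, inv_pow, inv_mul_eq_div, div_le_div_iff₀ (by positivity) hN]
  nlinarith

/-- The block mean is centred at the mean of ρ but the moment is taken about m. This is harmless:
subtracting its mean from ⟨v, x j - m⟩ leaves ⟨v, x j - c⟩. -/
theorem integral_abs_inner_blockMean_le (hb : b.Nonempty) (hQ : ∀ j ∈ b, Q j = ρ)
    (hρ : ∀ c, MemLp (fun x => x - c) 2 ρ) {α T κ : ℝ} (hα : 0 < α) (hα1 : α ≤ 1) (hT : 0 < T)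
    {v : EuclideanSpace ℝ (Fin d)} (hi : Integrable (fun x => |inner ℝ v (x - m)| ^ (1 + α)) ρ)
    (hκ : ∫ x, |inner ℝ v (x - m)| ^ (1 + α) ∂ρ ≤ κ) :
    ∫ x, |inner ℝ v (blockMean b (∫ y, y ∂ρ) x)| ∂Measure.pi Q
      ≤ 2 * (κ * T ^ (-α)) + √(κ * T ^ (1 - α) / b.card) := by
  set c := ∫ y, y ∂ρ with hc
  set Y := fun (j : Fin n) (x : Fin n → EuclideanSpace ℝ (Fin d)) => (inner ℝ v (x j - m) : ℝ)
    with hY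
  have hind : iIndepFun Y (Measure.pi Q) :=
    (iIndepFun_eval Q).comp (fun _ y => (inner ℝ v (y - m) : ℝ)) fun _ => by fun_prop
  have hYint : ∀ j ∈ b, ∫ x, Y j x ∂Measure.pi Q = inner ℝ v (c - m) := fun j hj => by
    rw [integral_pi_eval_eq hQ hj (f := fun x => (inner ℝ v (x - m) : ℝ)) (by fun_prop),
      integral_inner_sub_const (integrable_of_memLp_sub (hρ 0))]
  have h := integral_abs_average_le hind hα hα1 hT hb (κ := κ)
    (fun j hj => ((memLp_eval_sub hQ (hρ m) hj).integrable one_le_two).const_inner v)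
    (fun j => by fun_prop)
    (fun j hj => by
      rw [← hQ j hj] at hi
      exact integrable_comp_eval (μ := Q) (i := j)
        (f := fun x : EuclideanSpace ℝ (Fin d) => |inner ℝ v (x - m)| ^ (1 + α)) hi)
    (fun j hj => by
      rw [integral_pi_eval_eq hQ hj (f := fun x => |inner ℝ v (x - m)| ^ (1 + α)) hi.1]
      exact hκ)
  refine le_trans (le_of_eq ?_) h
  congr 1
  funext x
  rw [blockMean_eq hb, real_inner_smul_right, inner_sum]
  congr 2
  refine Finset.sum_congr rfl fun j hj => ?_
  rw [hYint j hj, hY, ← inner_sub_right, sub_sub_sub_cancel_right]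

end BlockMoments

/-! ### The choice of constants -/

section Numerics

/-- The remainder is less than k, and k ≤ k (s / k) once the quotient is at least 1. -/
theorem two_mul_div_mul_ge {s k : ℕ} (hk : 0 < k) (hks : k ≤ s) : s ≤ 2 * (k * (s / k)) := by
  have h1 := Nat.div_add_mod s k
  have h2 := Nat.mod_lt s hk
  have h3 : 1 ≤ s / k := (Nat.one_le_div_iff hk).2 hks
  have h4 : k * 1 ≤ k * (s / k) := Nat.mul_le_mul_left k h3
  omega

variable {α t : ℝ}

/-- The truncation level belonging to the sampling ratio `t = k / n`. -/
theorem rpow_threshold (hα : 0 < α) (ht : 0 < t) {R : ℝ} (hR : R = (80 * t ^ α) ^ (1 / (1 + α))) :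
    0 < R ∧ (R / t) ^ (-α) = R / 80 ∧ t * (R / t) ^ (1 - α) = R ^ 2 / 80 := by
  have hα' : 1 + α ≠ 0 := by linarith
  have hRpos : 0 < R := by rw [hR]; positivity
  -- This equation defining R makes the truncation level R / t balance bias and standard deviation,
  -- both proportional to R.
  have hpow : R ^ (1 + α) = 80 * t ^ α := by
    rw [hR, ← Real.rpow_mul (by positivity), one_div_mul_cancel hα', Real.rpow_one]
  have htα : t ^ α = R ^ (1 + α) / 80 := by rw [hpow]; ring
  refine ⟨hRpos, ?_, ?_⟩
  · rw [Real.rpow_neg (by positivity), Real.div_rpow hRpos.le ht.le, inv_div, htα,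
      Real.rpow_add hRpos, Real.rpow_one]
    have : R ^ α ≠ 0 := by positivity
    field_simp
  · have e1 : t * (R / t) ^ (1 - α) = R ^ (1 - α) * t ^ α := by
      rw [Real.div_rpow hRpos.le ht.le, Real.rpow_sub ht, Real.rpow_one]
      have : t ^ α ≠ 0 := by positivity
      field_simp
    rw [e1, htα, ← mul_div_assoc, ← Real.rpow_add hRpos, show 1 - α + (1 + α) = (2 : ℕ) by
      push_cast; ring, Real.rpow_natCast]

end Numerics

/-! ### The expected bound for the bucket means -/

section BucketBound

variable {n d k : ℕ} {α : ℝ}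

theorem mtRadius_pos (hn : 0 < n) (hd : 0 < d) (hk : 0 < k) : 0 < mtRadius n d k α := by
  have hn' : (0 : ℝ) < n := by exact_mod_cast hn
  have hk' : (0 : ℝ) < k := by exact_mod_cast hk
  have : 0 < 40 * (80 * ((k : ℝ) / n) ^ α) ^ (1 / (1 + α)) := by positivity
  unfold mtRadius
  positivity

/-- The first term of `mtRadius` absorbs the second moment of the bucket means and the second term
their mean absolute deviations. Only the laws of the points in S are prescribed, because the buckets
use no others. -/
theorem integral_mtBound_bucket_le (hn : 0 < n) (hd : 0 < d) (hk : 0 < k)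
    (hα : 0 < α) (hα1 : α ≤ 1) {Q : Fin n → Measure (EuclideanSpace ℝ (Fin d))}
    [∀ j, IsProbabilityMeasure (Q j)] {ρ : Measure (EuclideanSpace ℝ (Fin d))}
    [IsProbabilityMeasure ρ] {S : Finset (Fin n)} {m : EuclideanSpace ℝ (Fin d)}
    (hS : 3 * n ≤ 4 * S.card) (hkS : k ≤ S.card) (hQ : ∀ j ∈ S, Q j = ρ)
    (hρ : ∀ c, MemLp (fun x => x - c) 2 ρ)
    (hV : ∫ x, ‖x - m‖ ^ 2 ∂ρ
      ≤ 160 * max ((n : ℝ) ^ ((1 - α) / (1 + α)) * (d : ℝ) ^ (2 * α / (1 + α))) (d : ℝ))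
    (hW : ∀ v : EuclideanSpace ℝ (Fin d), ‖v‖ ≤ 1 →
      Integrable (fun x => |inner ℝ v (x - m)| ^ (1 + α)) ρ ∧
        ∫ x, |inner ℝ v (x - m)| ^ (1 + α) ∂ρ ≤ 2) :
    ∫ z, mtBound (mtRadius n d k α) z ∂(Measure.pi fun i : Fin k =>
      (Measure.pi Q).map (blockMean (bucket S k i) (∫ y, y ∂ρ))) ≤ k / 64 := by
  have hn' : (0 : ℝ) < n := by exact_mod_cast hn
  have hk' : (0 : ℝ) < k := by exact_mod_cast hk
  set M := max ((n : ℝ) ^ ((1 - α) / (1 + α)) * (d : ℝ) ^ (2 * α / (1 + α))) (d : ℝ) with hM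
  have hM0 : 0 ≤ M := le_max_of_le_right (by positivity)
  set c := ∫ y, y ∂ρ with hc
  set N := S.card / k with hN
  have hN1 : 1 ≤ N := (Nat.one_le_div_iff hk).2 hkS
  have hkN : 3 * n ≤ 8 * (k * N) := by
    have := two_mul_div_mul_ge hk hkS
    rw [← hN] at this
    omega
  have hN' : (0 : ℝ) < N := by exact_mod_cast hN1
  have hkN' : 3 * (n : ℝ) ≤ 8 * (k * N) := by exact_mod_cast hkN
  have hbne : ∀ i : Fin k, (bucket S k i).Nonempty := fun i => by
    rw [← Finset.card_pos, card_bucket]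
    exact hN1
  have hQb : ∀ i : Fin k, ∀ j ∈ bucket S k i, Q j = ρ := fun i j hj =>
    hQ j (bucket_subset S k i hj)
  have hmeas : ∀ i : Fin k, AEMeasurable (blockMean (bucket S k i) c) (Measure.pi Q) := fun i =>
    (measurable_blockMean _ _).aemeasurable
  have : ∀ i : Fin k, IsProbabilityMeasure ((Measure.pi Q).map (blockMean (bucket S k i) c)) :=
    fun i => Measure.isProbabilityMeasure_map (hmeas i)
  set t := (k : ℝ) / n with ht
  have htpos : 0 < t := by positivity
  set R := (80 * t ^ α) ^ (1 / (1 + α)) with hR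
  obtain ⟨hRpos, hT1, hT2⟩ := rpow_threshold hα htpos hR
  set T := R / t with hT
  have hTpos : 0 < T := by positivity
  have hNt : 1 / (N : ℝ) ≤ 8 / 3 * t := by
    rw [ht, div_le_iff₀ hN', ← mul_div_assoc, div_mul_eq_mul_div, le_div_iff₀ hn']
    linarith
  -- The bias contributes 4R/80 = 0.05 R, the variance at most √(2 · (8/3) / 80) R = R/√15 ≤ 0.26 R.
  have hβ : 2 * (2 * T ^ (-α)) + √(2 * T ^ (1 - α) / N) ≤ 0.31 * R := by
    have h1 : √(2 * T ^ (1 - α) / N) ≤ 0.26 * R := by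
      refine Real.sqrt_le_iff.2 ⟨by positivity, ?_⟩
      have h2 : 2 * T ^ (1 - α) / N ≤ 2 * T ^ (1 - α) * (8 / 3 * t) := by
        rw [div_eq_mul_one_div]
        exact mul_le_mul_of_nonneg_left hNt (by positivity)
      nlinarith [sq_nonneg R]
    rw [hT1]
    linarith
  set q := √(750 * M / n) with hq
  have hqsq : q ^ 2 = 750 * M / n := Real.sq_sqrt (by positivity)
  have hq0 : 0 ≤ q := Real.sqrt_nonneg _
  -- From 1/N ≤ (8/3) k/n the claim is 160 · 8/3 ≤ 0.76² · 750.
  have hVk : √(k * (160 * M / N)) ≤ 0.76 * (k * q) := by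
    refine Real.sqrt_le_iff.2 ⟨by positivity, ?_⟩
    have h1 : (0.76 * (k * q)) ^ 2 = 0.5776 * k ^ 2 * (750 * M / n) := by
      rw [← hqsq]; ring
    have h2 : (k : ℝ) * (160 * M / N) = 160 * M * k * (1 / N) := by ring
    rw [h1, h2]
    calc 160 * M * k * (1 / N) ≤ 160 * M * k * (8 / 3 * t) :=
          mul_le_mul_of_nonneg_left hNt (by positivity)
      _ = (160 * 8 / 3) * (k ^ 2 * M / n) := by rw [ht]; ring
      _ ≤ (0.5776 * 750) * (k ^ 2 * M / n) :=
          mul_le_mul_of_nonneg_right (by norm_num) (by positivity)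
      _ = _ := by ring
  have hr : mtRadius n d k α = 100 * q + 40 * R := rfl
  have hrpos : 0 < mtRadius n d k α := mtRadius_pos hn hd hk
  have hmain := integral_mtBound_le hd hrpos
    (fun i : Fin k => (Measure.pi Q).map (blockMean (bucket S k i) c))
    (β := 0.31 * R) (V := 160 * M / N)
    (fun i => (memLp_map_measure_iff aestronglyMeasurable_id (hmeas i)).2
      (memLp_blockMean (hbne i) (hQb i) (hρ c)))
    (fun i => by
      rw [integral_map (hmeas i) (f := fun z => z) (by fun_prop)]
      exact integral_blockMean (hbne i) (hQb i) hρ)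
    (fun i v hv => by
      rw [integral_map (hmeas i) (by fun_prop)]
      refine (integral_abs_inner_blockMean_le (hbne i) (hQb i) hρ hα hα1 hTpos
        (hW v hv).1 (hW v hv).2).trans ?_
      rw [card_bucket]
      exact hβ)
    (fun i => by
      rw [integral_map (hmeas i) (by fun_prop)]
      refine (integral_norm_sq_blockMean_le (hbne i) (hQb i) hρ hV).trans (le_of_eq ?_)
      rw [card_bucket])
  refine hmain.trans ?_
  rw [div_le_iff₀ (by positivity), hr]
  have h1 : 0 ≤ k * q := by positivity
  have h2 : 0 ≤ k * R := by positivity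
  -- Compared separately in q and R: 64 · 3.52 · 0.76 ≤ 200 and 64 · 1.26 · 0.31 ≤ 80.
  nlinarith

end BucketBound

/-! ### Conditioning on the set of survivors -/

section Survivors

variable {n d : ℕ}

/-- Checked on boxes, factor by factor. Null factors are allowed: both sides are then zero. -/
theorem pi_restrict_eq_smul_pi_cond {ι : Type*} [Fintype ι] {E : ι → Type*}
    [∀ j, MeasurableSpace (E j)] (μ : ∀ j, Measure (E j)) [∀ j, IsProbabilityMeasure (μ j)]
    (A : ∀ j, Set (E j)) :
    (Measure.pi μ).restrict (Set.univ.pi A) =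
      (Measure.pi μ (Set.univ.pi A)) • Measure.pi fun j => (μ j)[|A j] := by
  rw [Measure.restrict_pi_pi]
  refine Measure.pi_eq fun s hs => ?_
  rw [Measure.smul_apply, Measure.pi_pi, Measure.pi_pi, smul_eq_mul, ← Finset.prod_mul_distrib]
  refine Finset.prod_congr rfl fun j _ => ?_
  rw [cond_apply' (hs j), Measure.restrict_apply (hs j), Set.inter_comm, ← mul_assoc]
  by_cases h : μ j (A j) = 0
  · rw [measure_mono_null Set.inter_subset_right h, mul_zero]
  · rw [ENNReal.mul_inv_cancel h (measure_ne_top _ _), one_mul]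

/-- To bound the probability of an event that depends on the set of survivors, it suffices to
bound it for independent points whose survivors have the conditioned law. -/
theorem measureReal_pi_survivors_le {α : ℝ} {x₀ : EuclideanSpace ℝ (Fin d)}
    {ν : Measure (EuclideanSpace ℝ (Fin d))} [IsProbabilityMeasure ν]
    (T : Finset (Fin n) → Set (Fin n → EuclideanSpace ℝ (Fin d))) {B : ℝ} (hB : 0 ≤ B)
    (h : ∀ S, ∀ Q : Fin n → Measure (EuclideanSpace ℝ (Fin d)),
      (∀ j, IsProbabilityMeasure (Q j)) → (∀ j ∈ S, Q j = ν[|keepSet n α x₀]) →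
        (Measure.pi Q).real (T S) ≤ B) :
    (Measure.pi fun _ : Fin n => ν).real {x | x ∈ T (survivors α x₀ x)} ≤ B := by
  classical
  set π := Measure.pi fun _ : Fin n => ν with hπ
  set K := keepSet n α x₀ with hK
  have hKm : MeasurableSet K := measurableSet_keepSet n α x₀
  -- The event that the survivors are exactly S also constrains the other points to lie in Kᶜ, so
  -- their law is ν conditioned on Kᶜ. This is why Q is free outside S.
  set A : Finset (Fin n) → Fin n → Set (EuclideanSpace ℝ (Fin d)) :=
    fun S j => if j ∈ S then K else Kᶜ with hA
  have hAm : ∀ S, MeasurableSet (Set.univ.pi (A S)) := fun S => by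
    refine MeasurableSet.univ_pi fun j => ?_
    by_cases hj : j ∈ S
    · simp only [hA, hj, if_true, hKm]
    · simp only [hA, hj, if_false, hKm.compl]
  have hbox : ∀ S x, x ∈ Set.univ.pi (A S) ↔ survivors α x₀ x = S := by
    intro S x
    have hs : ∀ j, j ∈ survivors α x₀ x ↔ x j ∈ K := fun j => by
      simp [survivors, hK, keepSet]
    rw [Finset.ext_iff, Set.mem_univ_pi]
    refine forall_congr' fun j => ?_
    rw [hs j]
    by_cases hj : j ∈ S
    · simp [hA, hj]
    · simp [hA, hj]
  have hone : ∀ S, π.real (T S ∩ Set.univ.pi (A S)) ≤ π.real (Set.univ.pi (A S)) * B := by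
    intro S
    -- On a null box some conditioned law is the zero measure, to which the hypothesis does not
    -- apply, but nothing has to be shown there.
    by_cases h0 : π (Set.univ.pi (A S)) = 0
    · have h1 : π (T S ∩ Set.univ.pi (A S)) = 0 := measure_mono_null Set.inter_subset_right h0
      rw [measureReal_def, measureReal_def, h0, h1]
      simp
    have hne : ∀ j, ν (A S j) ≠ 0 := by
      rw [hπ, Measure.pi_pi, ← ne_eq, Finset.prod_ne_zero_iff] at h0
      exact fun j => h0 j (Finset.mem_univ j)
    have hprob : ∀ j, IsProbabilityMeasure ν[|A S j] := fun j => cond_isProbabilityMeasure (hne j)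
    have h1 := h S (fun j => ν[|A S j]) hprob fun j hj => by simp only [hA, hj, if_true]
    have h2 := congrArg (fun m : Measure _ => m.real (T S))
      (pi_restrict_eq_smul_pi_cond (fun _ : Fin n => ν) (A S))
    simp only [measureReal_def, Measure.restrict_apply' (hAm S), Measure.smul_apply,
      smul_eq_mul, ENNReal.toReal_mul] at h2
    rw [measureReal_def, measureReal_def, h2]
    exact mul_le_mul_of_nonneg_left h1 ENNReal.toReal_nonneg
  have hsub : {x | x ∈ T (survivors α x₀ x)}
      ⊆ ⋃ S ∈ (Finset.univ : Finset (Finset (Fin n))), T S ∩ Set.univ.pi (A S) := by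
    intro x hx
    simp only [Set.mem_iUnion]
    exact ⟨survivors α x₀ x, Finset.mem_univ _, hx, (hbox _ x).2 rfl⟩
  have hdisj : (((Finset.univ : Finset (Finset (Fin n))) : Set (Finset (Fin n)))).PairwiseDisjoint
      fun S => Set.univ.pi (A S) := fun S _ S' _ hne =>
    Set.disjoint_left.2 fun x hx hx' => hne (((hbox S x).1 hx).symm.trans ((hbox S' x).1 hx'))
  calc π.real {x | x ∈ T (survivors α x₀ x)}
      ≤ π.real (⋃ S ∈ (Finset.univ : Finset (Finset (Fin n))), T S ∩ Set.univ.pi (A S)) :=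
        measureReal_mono hsub (measure_ne_top _ _)
    _ ≤ ∑ S, π.real (T S ∩ Set.univ.pi (A S)) := measureReal_biUnion_finset_le _ _
    _ ≤ ∑ S, π.real (Set.univ.pi (A S)) * B := Finset.sum_le_sum fun S _ => hone S
    _ = π.real (⋃ S ∈ (Finset.univ : Finset (Finset (Fin n))), Set.univ.pi (A S)) * B := by
        rw [← Finset.sum_mul, measureReal_biUnion_finset hdisj fun S _ => hAm S]
    _ ≤ 1 * B := mul_le_mul_of_nonneg_right measureReal_le_one hB
    _ = B := one_mul B

/-! ### The number of survivors -/

theorem card_survivors_eq (α : ℝ) (x₀ : EuclideanSpace ℝ (Fin d))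
    (x : Fin n → EuclideanSpace ℝ (Fin d)) :
    ((survivors α x₀ x).card : ℝ)
      = n - ∑ j, (keepSet n α x₀)ᶜ.indicator (fun _ => (1 : ℝ)) (x j) := by
  classical
  have h : ∀ j, (keepSet n α x₀)ᶜ.indicator (fun _ => (1 : ℝ)) (x j)
      = 1 - if ‖x j - x₀‖ ≤ pruneRadius n d α then 1 else 0 := fun j => by
    by_cases hj : ‖x j - x₀‖ ≤ pruneRadius n d α
    · simp [keepSet, hj]
    · simp only [keepSet, Set.indicator, Set.mem_compl_iff, Set.mem_ofPred_eq, hj]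
      simp
  simp only [h, Finset.sum_sub_distrib, Finset.sum_const, Finset.card_univ, Fintype.card_fin,
    Finset.sum_boole, survivors, nsmul_eq_mul, mul_one, sub_sub_cancel]

/-- The number of discarded points has mean at most n/60 and would have to reach n/4. Markov's
inequality gives 1/15. McDiarmid's, with ε = 1/4 - 1/60 = 7/30, gives the exponent (49/450) n ≥
n/10. -/
theorem measureReal_card_survivors_lt_le {α : ℝ} {x₀ : EuclideanSpace ℝ (Fin d)}
    {ν : Measure (EuclideanSpace ℝ (Fin d))} [IsProbabilityMeasure ν] (hn : 0 < n)
    (hν : ν.real (keepSet n α x₀)ᶜ ≤ 1 / 60) :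
    (Measure.pi fun _ : Fin n => ν).real {x | 4 * (survivors α x₀ x).card < 3 * n}
      ≤ min (1 / 15) (Real.exp (-(n / 10))) := by
  set K := keepSet n α x₀ with hK
  have hKm : MeasurableSet Kᶜ := (measurableSet_keepSet n α x₀).compl
  set π := Measure.pi fun _ : Fin n => ν with hπ
  set g : EuclideanSpace ℝ (Fin d) → ℝ := Kᶜ.indicator fun _ => 1 with hg
  set f : (Fin n → EuclideanSpace ℝ (Fin d)) → ℝ := fun x => ∑ j, g (x j) with hf
  have hn' : (0 : ℝ) < n := by exact_mod_cast hn
  have hgm : Measurable g := measurable_const.indicator hKm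
  have hg0 : ∀ y, 0 ≤ g y := fun y => Set.indicator_nonneg (fun _ _ => zero_le_one) y
  have hg1 : ∀ y, g y ≤ 1 := fun y => Set.indicator_le_self' (fun _ _ => zero_le_one) y
  have hfm : Measurable f := Finset.measurable_sum _ fun j _ => hgm.comp (measurable_pi_apply j)
  have hf0 : ∀ x, 0 ≤ f x := fun x => Finset.sum_nonneg fun j _ => hg0 _
  have hfC : ∀ x, |f x| ≤ n := fun x => by
    rw [abs_of_nonneg (hf0 x)]
    calc f x ≤ ∑ _j : Fin n, (1 : ℝ) := Finset.sum_le_sum fun j _ => hg1 _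
      _ = n := by simp
  have hfd : ∀ x i y, f (Function.update x i y) ≤ f x + 1 := fun x i y => by
    have h1 : f (Function.update x i y) = g y + ∑ j ∈ Finset.univ.erase i, g (x j) := by
      change ∑ j, g (Function.update x i y j) = _
      rw [← Finset.add_sum_erase _ _ (Finset.mem_univ i)]
      simp only [Function.update_self]
      congr 1
      refine Finset.sum_congr rfl fun j hj => ?_
      rw [Function.update_of_ne (Finset.ne_of_mem_erase hj)]
    have h2 : f x = g (x i) + ∑ j ∈ Finset.univ.erase i, g (x j) :=
      (Finset.add_sum_erase _ (fun j => g (x j)) (Finset.mem_univ i)).symm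
    rw [h1, h2]
    linarith [hg1 y, hg0 (x i)]
  have hfi : Integrable f π := integrable_of_measurable_of_bound hfm hfC
  have hmean : ∫ x, f x ∂π ≤ n / 60 := by
    have h1 : ∀ j : Fin n, ∫ x, g (x j) ∂π = ν.real Kᶜ := fun j => by
      rw [hπ, integral_comp_eval (μ := fun _ : Fin n => ν) (f := g) hgm.aestronglyMeasurable, hg,
        integral_indicator_const _ hKm, smul_eq_mul, mul_one]
    have h2 : ∀ j : Fin n, Integrable (fun x => g (x j)) π := fun j =>
      integrable_of_measurable_of_bound (C := 1) (hgm.comp (measurable_pi_apply j)) fun x =>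
        (abs_of_nonneg (hg0 (x j))).le.trans (hg1 (x j))
    change ∫ x, ∑ j, g (x j) ∂π ≤ n / 60
    rw [integral_finsetSum _ fun j _ => h2 j]
    simp only [h1, Finset.sum_const, Finset.card_univ, Fintype.card_fin, nsmul_eq_mul]
    nlinarith
  have hsub : {x | 4 * (survivors α x₀ x).card < 3 * n} ⊆ {x | (n : ℝ) / 4 ≤ f x} := fun x hx => by
    have h1 : (4 : ℝ) * (survivors α x₀ x).card < 3 * n := by exact_mod_cast hx
    rw [card_survivors_eq] at h1
    change (n : ℝ) / 4 ≤ ∑ j, g (x j)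
    linarith
  refine (measureReal_mono hsub (measure_ne_top _ _)).trans (le_min ?_ ?_)
  · have h1 := mul_meas_ge_le_integral_of_nonneg (μ := π)
      (Filter.Eventually.of_forall hf0) hfi ((n : ℝ) / 4)
    have h2 : (n : ℝ) * (π.real {x | (n : ℝ) / 4 ≤ f x} - 1 / 15) ≤ 0 := by
      linarith [h1.trans hmean]
    nlinarith [nonpos_of_mul_nonpos_right h2 hn']
  · refine (measureReal_ge_le_of_bounded_differences (fun _ : Fin n => ν) hfm hfC hfd
      (ε := 7 / 30) (by norm_num) (by linarith)).trans (Real.exp_le_exp.2 ?_)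
    nlinarith

end Survivors

/-! ### The bound for the localization algorithm -/

section Localization

variable {n d k : ℕ} {α : ℝ}

theorem pi_map_blockMean (Q : Fin n → Measure (EuclideanSpace ℝ (Fin d)))
    [∀ j, IsProbabilityMeasure (Q j)] (S : Finset (Fin n)) (c : EuclideanSpace ℝ (Fin d)) :
    (Measure.pi Q).map (fun x (i : Fin k) => blockMean (bucket S k i) c x)
      = Measure.pi fun i : Fin k => (Measure.pi Q).map (blockMean (bucket S k i) c) :=
  iIndepFun.map_fun_eq_pi_map (fun _ => (measurable_blockMean _ _).aemeasurable)
    ((iIndepFun_eval Q).sum_blocks (fun j => measurable_pi_apply j) (fun i : Fin k => bucket S k i)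
      (fun _ _ _ h h' => eq_of_mem_bucket h h') (fun i => ((bucket S k i).card : ℝ)⁻¹) c)

theorem measureReal_mtBound_survivors_le (hn : 0 < n) (hd : 0 < d) (hk : 0 < k)
    (hkn : 2 * k ≤ n + 1) (hα : 0 < α) (hα1 : α ≤ 1) {ν : Measure (EuclideanSpace ℝ (Fin d))}
    [IsProbabilityMeasure ν] {m x₀ : EuclideanSpace ℝ (Fin d)} (hmom : WeakMoment α ν m)
    (hx₀ : ‖x₀ - m‖ ≤ 24 * √d) :
    (Measure.pi fun _ : Fin n => ν).real {x | (k : ℝ) / 20 ≤ mtBound (mtRadius n d k α)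
        fun i => blockMean (bucket (survivors α x₀ x) k i) (∫ y, y ∂ν[|keepSet n α x₀]) x}
      ≤ min (1 / 15) (Real.exp (-(n / 10))) + min (5 / 16) (Real.exp (-(k / 500))) := by
  set c := ∫ y, y ∂ν[|keepSet n α x₀] with hc
  set r := mtRadius n d k α with hr_def
  have hr : 0 < r := mtRadius_pos hn hd hk
  have hρ : IsProbabilityMeasure ν[|keepSet n α x₀] :=
    cond_isProbabilityMeasure (measure_keepSet_ne_zero hd hα hα1 hmom hx₀)
  -- Putting the cardinality condition into the event makes it empty for the small sets S, which are
  -- charged to the survivor count instead.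
  set T : Finset (Fin n) → Set (Fin n → EuclideanSpace ℝ (Fin d)) := fun S =>
    {x | 3 * n ≤ 4 * S.card ∧
      (k : ℝ) / 20 ≤ mtBound r fun i => blockMean (bucket S k i) c x} with hT
  have hB : 0 ≤ min (5 / 16) (Real.exp (-(k / 500 : ℝ))) :=
    le_min (by norm_num) (Real.exp_pos _).le
  have h := measureReal_pi_survivors_le (α := α) (x₀ := x₀) (ν := ν) T hB fun S Q hQ hQS => by
    by_cases hS : 3 * n ≤ 4 * S.card
    · have hm : Measurable fun x (i : Fin k) => blockMean (bucket S k i) c x :=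
        measurable_pi_lambda _ fun i => measurable_blockMean _ _
      have hprob : ∀ i : Fin k,
          IsProbabilityMeasure ((Measure.pi Q).map (blockMean (bucket S k i) c)) := fun i =>
        Measure.isProbabilityMeasure_map (measurable_blockMean _ _).aemeasurable
      -- The arithmetic side goal is k ≤ |S|, from 4 |S| ≥ 3 n and n ≥ 2 k - 1: no bucket is empty.
      have hint := integral_mtBound_bucket_le hn hd hk hα hα1 (m := m) hS (by omega) hQS
        (fun c => memLp_cond hd hα hα1 hmom hx₀ c)
        (integral_cond_norm_sq_le hd hα hα1 hmom hx₀)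
        (fun v hv => integral_cond_weakMoment hd hα hα1 hmom hx₀ hv)
      have hset : MeasurableSet {z : Fin k → EuclideanSpace ℝ (Fin d) |
          (k : ℝ) / 20 ≤ mtBound r z} := measurableSet_le measurable_const (measurable_mtBound r)
      have h1 := le_min (measureReal_mtBound_ge_le_markov hd hk hr _ hint)
        (measureReal_mtBound_ge_le_exp hd hr _ hint)
      rw [← pi_map_blockMean, map_measureReal_apply hm hset] at h1
      refine (measureReal_mono ?_ (measure_ne_top _ _)).trans h1
      exact fun x hx => hx.2
    · have : T S = ∅ := Set.eq_empty_of_forall_notMem fun x hx => hS hx.1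
      rw [this, measureReal_empty]
      exact hB
  have hsub : {x | (k : ℝ) / 20 ≤ mtBound r fun i => blockMean (bucket (survivors α x₀ x) k i) c x}
      ⊆ {x | 4 * (survivors α x₀ x).card < 3 * n} ∪ {x | x ∈ T (survivors α x₀ x)} := by
    intro x hx
    by_cases hS : 4 * (survivors α x₀ x).card < 3 * n
    · exact Or.inl hS
    · exact Or.inr ⟨not_lt.1 hS, hx⟩
  exact (measureReal_mono hsub (measure_ne_top _ _)).trans ((measureReal_union_le _ _).trans
    (add_le_add (measureReal_card_survivors_lt_le hn
      (measureReal_compl_keepSet_le hd hα hα1 hmom hx₀)) h))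

end Localization

/-! ### The number of buckets -/

section NumBuckets

variable {n : ℕ} {δ : ℝ}

theorem numBuckets_eq_zero (hδ : 1 ≤ δ) : numBuckets δ = 0 := by
  have h : Real.log (1 / δ) ≤ 0 :=
    Real.log_nonpos (by positivity) (by rw [div_le_one (by linarith)]; exact hδ)
  exact Nat.ceil_eq_zero.2 (by linarith)

theorem numBuckets_pos (hδ0 : 0 < δ) (hδ : δ < 1) : 0 < numBuckets δ := by
  have h : 0 < Real.log (1 / δ) := Real.log_pos (by rwa [lt_div_iff₀ hδ0, one_mul])
  exact Nat.ceil_pos.2 (by linarith)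

/-- The lower bound on δ says 4000 log(1/δ) < n/2, and rounding up adds less than 1. -/
theorem two_mul_numBuckets_le (hδ : Real.exp (-(n : ℝ) / 8000) < δ) (hδ1 : δ < 1) :
    2 * numBuckets δ ≤ n + 1 := by
  have hδ0 : 0 < δ := (Real.exp_pos _).trans hδ
  have h := (Real.lt_log_iff_exp_lt hδ0).2 hδ
  have hl : 0 ≤ 4000 * Real.log (1 / δ) := by
    rw [one_div, Real.log_inv]
    linarith [Real.log_neg hδ0 hδ1]
  have h2 := Nat.ceil_lt_add_one hl
  rw [one_div, Real.log_inv] at h2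
  have h3 : (numBuckets δ : ℝ) = ⌈4000 * -Real.log δ⌉₊ := by
    rw [numBuckets, one_div, Real.log_inv]
  have h4 : 2 * (numBuckets δ : ℝ) < n + 2 := by
    rw [h3]
    linarith
  have h5 : 2 * numBuckets δ < n + 2 := by exact_mod_cast h4
  omega

/-- For δ ≥ 0.76 the constants suffice: 1/15 + 5/16 < 0.38. Below that both exponentials are at most
δ⁸, and 2 · 0.76⁷ < 1/2. -/
theorem failure_probability_le (hδ : Real.exp (-(n : ℝ) / 8000) < δ) (hδ1 : δ < 1) :
    min (1 / 15) (Real.exp (-(n / 10))) + min (5 / 16) (Real.exp (-(numBuckets δ / 500)))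
      ≤ δ / 2 := by
  have hδ0 : 0 < δ := (Real.exp_pos _).trans hδ
  rcases le_or_gt 0.76 δ with h | h
  · linarith [min_le_left (1 / 15) (Real.exp (-(n / 10 : ℝ))),
      min_le_left (5 / 16) (Real.exp (-(numBuckets δ / 500 : ℝ)))]
  have hlog := (Real.lt_log_iff_exp_lt hδ0).2 hδ
  have hk : -(4000 * Real.log δ) ≤ numBuckets δ := by
    have := Nat.le_ceil (4000 * Real.log (1 / δ))
    rw [one_div, Real.log_inv] at this
    rw [numBuckets, one_div, Real.log_inv]
    linarith
  have hpow : Real.exp (8 * Real.log δ) = δ ^ 8 := by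
    rw [show (8 : ℝ) = (8 : ℕ) by norm_num, Real.exp_nat_mul, Real.exp_log hδ0]
  have h1 : Real.exp (-(n / 10 : ℝ)) ≤ δ ^ 8 := by
    rw [← hpow]
    refine Real.exp_le_exp.2 ?_
    linarith [Real.log_neg hδ0 hδ1]
  have h2 : Real.exp (-(numBuckets δ / 500 : ℝ)) ≤ δ ^ 8 := by
    rw [← hpow]
    exact Real.exp_le_exp.2 (by linarith)
  have h7 : δ ^ 7 ≤ 0.76 ^ 7 := pow_le_pow_left₀ hδ0.le h.le 7
  have h8 : δ ^ 8 = δ ^ 7 * δ := by ring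
  have h9 : δ ^ 7 * δ ≤ 0.76 ^ 7 * δ := mul_le_mul_of_nonneg_right h7 hδ0.le
  norm_num at h9
  linarith [min_le_right (1 / 15) (Real.exp (-(n / 10 : ℝ))),
      min_le_right (5 / 16) (Real.exp (-(numBuckets δ / 500 : ℝ)))]

end NumBuckets

theorem mainTheorem1 {Ω : Type*} [MeasurableSpace Ω] (P : Measure Ω) [IsProbabilityMeasure P]
    (n d : ℕ) (hd : 0 < d) (α : ℝ) (hα : 0 < α) (hα1 : α ≤ 1)
    (δ : ℝ) (hδ : Real.exp (-(n : ℝ) / 8000) < δ)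
    (ν : Measure (EuclideanSpace ℝ (Fin d))) (μ : EuclideanSpace ℝ (Fin d))
    (hint : Integrable (fun x => x) ν) (hmean : ∫ x, x ∂ν = μ) (hmom : WeakMoment α ν μ)
    (X : Fin n → Ω → EuclideanSpace ℝ (Fin d)) (hmeas : ∀ i, Measurable (X i))
    (hlaw : ∀ i, P.map (X i) = ν) (hindep : iIndepFun X P)
    (x₀ : EuclideanSpace ℝ (Fin d)) (hx₀ : ‖x₀ - μ‖ ≤ 24 * Real.sqrt d) :
    ∃ μ' : EuclideanSpace ℝ (Fin d),
      ‖μ' - μ‖ ≤ 2 * ((d : ℝ) / n) ^ (α / (1 + α)) ∧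
      ENNReal.ofReal (1 - δ / 2) ≤
        P {ω | ∀ r : ℝ, mtRadius n d (numBuckets δ) α ≤ r →
          ∃ m : ℝ, IsMTValue μ' r (bucketMeans α (fun i => X i ω) x₀ δ) m ∧
            m ≤ (numBuckets δ : ℝ) / 20} := by
  have hδ0 : 0 < δ := (Real.exp_pos _).trans hδ
  set k := numBuckets δ with hk_def
  obtain ⟨μ', hμ', hμc⟩ : ∃ μ' : EuclideanSpace ℝ (Fin d),
      ‖μ' - μ‖ ≤ 2 * ((d : ℝ) / n) ^ (α / (1 + α)) ∧
        (0 < n → μ' = ∫ y, y ∂ν[|keepSet n α x₀]) := by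
    -- For n = 0 the required distance is 0, so the point must be μ. For n > 0 the common law of the
    -- X i shows that ν is a probability measure.
    rcases Nat.eq_zero_or_pos n with hn | hn
    · refine ⟨μ, ?_, fun h => absurd hn h.ne'⟩
      rw [sub_self, norm_zero]
      positivity
    · have : IsProbabilityMeasure ν := by
        rw [← hlaw ⟨0, hn⟩]
        exact Measure.isProbabilityMeasure_map (hmeas _).aemeasurable
      exact ⟨_, norm_integral_cond_sub_le hn hd hα hα1 hint hmean hmom hx₀, fun _ => rfl⟩
  refine ⟨μ', hμ', ?_⟩
  set G := {ω | ∀ r : ℝ, mtRadius n d k α ≤ r →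
    ∃ m : ℝ, IsMTValue μ' r (bucketMeans α (fun i => X i ω) x₀ δ) m ∧ m ≤ (k : ℝ) / 20} with hG
  -- If δ ≥ 1 there are no buckets, the objective is an empty sum, and the event is certain.
  rcases le_or_gt 1 δ with hδ1 | hδ1
  · have hk0 : k = 0 := numBuckets_eq_zero hδ1
    have hGu : G = Set.univ := Set.eq_univ_of_forall fun ω r _ => by
      obtain ⟨m, hm⟩ := exists_isMTValue hd μ' r (bucketMeans α (fun i => X i ω) x₀ δ)
      refine ⟨m, hm, ?_⟩
      obtain ⟨Y, -, rfl⟩ := hm.1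
      have : IsEmpty (Fin (numBuckets δ)) := by
        rw [← hk_def, hk0]
        infer_instance
      rw [mtObjective, Finset.univ_eq_empty, Finset.sum_empty]
      positivity
    rw [hGu, measure_univ]
    exact ENNReal.ofReal_le_one.2 (by linarith)
  have hkpos : 0 < k := numBuckets_pos hδ0 hδ1
  have hkn : 2 * k ≤ n + 1 := two_mul_numBuckets_le hδ hδ1
  have hn : 0 < n := by omega
  have hνp : IsProbabilityMeasure ν := by
    rw [← hlaw ⟨0, hn⟩]
    exact Measure.isProbabilityMeasure_map (hmeas _).aemeasurable
  set bad := {x : Fin n → EuclideanSpace ℝ (Fin d) | (k : ℝ) / 20 ≤ mtBound (mtRadius n d k α)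
    fun i => blockMean (bucket (survivors α x₀ x) k i) (∫ y, y ∂ν[|keepSet n α x₀]) x} with hbad
  have hprob : (Measure.pi fun _ : Fin n => ν).real bad ≤ δ / 2 :=
    (measureReal_mtBound_survivors_le hn hd hkpos hkn hα hα1 hmom hx₀).trans
      (failure_probability_le hδ hδ1)
  have hXm : Measurable fun ω i => X i ω := measurable_pi_lambda _ hmeas
  have hmap : P.map (fun ω i => X i ω) = Measure.pi fun _ : Fin n => ν := by
    rw [hindep.map_fun_eq_pi_map fun i => (hmeas i).aemeasurable]
    simp only [hlaw]
  have hsub : Gᶜ ⊆ (fun ω i => X i ω) ⁻¹' bad := by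
    intro ω hω
    by_contra hb
    refine hω fun r hr => ?_
    refine forall_exists_isMTValue_le hd (mtRadius_pos hn hd hkpos) (le_of_lt ?_) r hr
    rw [hμc hn]
    exact not_le.1 fun h => hb h
  have hGc : P Gᶜ ≤ ENNReal.ofReal (δ / 2) := by
    -- Neither `bad` nor G is shown to be measurable: `Measure.le_map_apply` and subadditivity hold
    -- for arbitrary sets.
    refine (measure_mono hsub).trans ((Measure.le_map_apply hXm.aemeasurable _).trans ?_)
    rw [hmap, ← ofReal_measureReal]
    exact ENNReal.ofReal_le_ofReal hprob
  rw [ENNReal.ofReal_sub _ (by positivity), ENNReal.ofReal_one, tsub_le_iff_right]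
  calc (1 : ENNReal) = P Set.univ := measure_univ.symm
    _ ≤ P G + P Gᶜ := by rw [← Set.union_compl_self G]; exact measure_union_le _ _
    _ ≤ P G + ENNReal.ofReal (δ / 2) := add_le_add le_rfl hGc

end
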